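/- Let $\mathbf H$ be the quaternions, written $q=z+jw$ with $z,w\in\mathbf C$, $zj=j\bar z$; identify $\mathbf C^4=\mathbf H^2$ by $(z_1,z_2,z_3,z_4)\sim(z_1+jz_2,z_3+jz_4)$, and put $\langle(q_1,q_2),(p_1,p_2)\rangle=\bar q_1p_1-\bar q_2p_2$. Let $$\Psi S^7=\{v\in\mathbf H^2:\langle v,v\rangle=1\},\qquad \Psi\mathbf{CP}^3=\Psi S^7/S^1,\qquad \Psi\mathbf{HP}^1=\Psi S^7/S^3,$$ where the unit complex numbers $S^1$ and the unit quaternions $S^3$ act by right multiplication, and let $T:\Psi\mathbf{CP}^3\to\Psi\mathbf{HP}^1$ be the projection. The coordinate $[p,q]\mapsto qp^{-1}$ identifies $\Psi\mathbf{HP}^1$ with the unit ball of $\mathbf H$; with the metric $|dx|^2/(1-|x|^2)^2$ this is hyperbolic 4-space $H^4$. Let $\mathfrak F\cong Sp(1,1)$ be the space of pairs $(e_1,e_2)$ in $\mathbf H^2$ with $\langle e_1,e_1\rangle=1$, $\langle e_2,e_2\rangle=-1$, $\langle e_1,e_2\rangle=0$, let $\phi$ be its Maurer–Cartan form, $de_a=e_b\phi^b_a$,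 and define complex 1-forms $\omega_1,\omega_2,\omega_3$ on $\mathfrak F$ by $\phi^2_1=\omega_1+j\omega_2$ and $\phi^1_1=i\rho_1+j\overline{\omega_3}$ with $\rho_1$ real. Let $\mathtt j:\mathfrak F\to\Psi\mathbf{CP}^3$, $\mathtt j(e_1,e_2)=e_1S^1$. Let $C(z+jw)=\bar z+j\bar w$ and let $c$ be the map $[p,q]\mapsto[C(p),C(q)]$ of $\Psi\mathbf{CP}^3$. Finally let $\Psi\mathbf{RP}^3=\Psi S^3/\{\pm1\}$, where $\Psi S^3=\{x\in\mathbf R^4:x_1^2+x_2^2-x_3^2-x_4^2=1\}$. **Theorem.** 1. There are a Riemannian metric $g$, a 2-form $\Omega$ and a complex 3-form $\Psi$ on $\Psi\mathbf{CP}^3$ with $\mathtt j^*g=\sum_k|\omega_k|^2$, $\mathtt j^*\Omega=\frac{i}{2}\sum_k\omega_k\wedge\overline{\omega_k}$ and $\mathtt j^*\Psi=\omega_1\wedge\omega_2\wedge\omega_3$. They form an $SU(3)$-structure, and it is nearly Calabi–Yau: $d\Omega=0$ and $d(\mathrm{Im}\,\Psi)=0$. 2. $T$ is the twistor fibration of $H^4$: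 it is smooth, it pulls the metric of $H^4$ back to $|\omega_1|^2+|\omega_2|^2$, and its fibre over $y$ corresponds bijectively to the orthogonal complex structures of $T_yH^4$ compatible with a fixed orientation, the structure given by $[e_1]$ being the one for which $\omega_1,\omega_2$ are complex linear. 3. The map $c$ is a smooth involution with $c^*\Omega=-\Omega$ and $c^*\Psi=\overline\Psi$. Its fixed set is the image of $\Psi\mathbf{RP}^3$ under $[x]\mapsto[x]$. 4. The map $\Psi\mathbf{RP}^3\to\Psi\mathbf{CP}^3$, $[x]\mapsto[x]$, is a smooth embedding, and its image is a special Lagrangian submanifold: $\mathrm{Re}\,\Psi$ restricts to the volume form of the induced metric for one of the orientations, and $\Omega$ and $\mathrm{Im}\,\Psi$ restrict to zero. The induced metric on $\Psi\mathbf{RP}^3$ is complete. 5. $T$ restricts to a smooth locally trivial fibre bundle $\Psi\mathbf{RP}^3\to H^2$ with fibre $S^1$, where $H^2\subset H^4$ is the hyperbolic plane $\{a+jb:a,b\in\mathbf R,\ a^2+b^2<1\}$, smoothly and isometrically embedded with the metric $(da^2+db^2)/(1-a^2-b^2)^2$. -/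

import Mathlib

open scoped Manifold ContDiff Topology ENNReal Quaternion ComplexConjugate

noncomputable section

/-! ### Differential forms on manifolds -/

/-- `F`-valued differential `k`-forms (not necessarily smooth) on a manifold `M` modelled on `E`. -/
abbrev DiffForm (E : Type) [NormedAddCommGroup E] [NormedSpace ℝ E] (M : Type) [TopologicalSpace M]
    [ChartedSpace E M] (F : Type) [NormedAddCommGroup F] [NormedSpace ℝ F] (k : ℕ) : Type :=
  ∀ x : M, (TangentSpace 𝓘(ℝ, E) x) [⋀^Fin k]→L[ℝ] F

namespace DiffForm

variable {E : Type} [NormedAddCommGroup E] [NormedSpace ℝ E] {M : Type} [TopologicalSpace M]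
  [ChartedSpace E M] {F : Type} [NormedAddCommGroup F] [NormedSpace ℝ F] {k : ℕ}

/-- The coordinate expression of a form in the preferred chart at `x₀`: its pullback by the inverse
of the chart. -/
def inChart (α : DiffForm E M F k) (x₀ : M) (y : E) : E [⋀^Fin k]→L[ℝ] F :=
  (α ((chartAt E x₀).symm y)).compContinuousLinearMap
    (mfderiv 𝓘(ℝ, E) 𝓘(ℝ, E) (chartAt E x₀).symm y)

/-- A form is smooth if all its coordinate expressions are. -/
def IsSmooth (α : DiffForm E M F k) : Prop :=
  ∀ x₀ : M, ContDiffOn ℝ ∞ (inChart α x₀) (chartAt E x₀).target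

/-- The exterior derivative, computed at `x` in the preferred chart at `x`. -/
def extD (α : DiffForm E M F k) : DiffForm E M F (k + 1) := fun x =>
  (extDeriv (inChart α x) (chartAt E x x)).compContinuousLinearMap
    (mfderiv 𝓘(ℝ, E) 𝓘(ℝ, E) (chartAt E x) x)

/-- The imaginary part of a complex-valued form. -/
def imPart (α : DiffForm E M ℂ k) : DiffForm E M ℝ k := fun x =>
  Complex.imCLM.compContinuousAlternatingMap (α x)

end DiffForm

/-! ### `SU(3)`-structures -/

/-- The standard metric on `ℂ³`. -/
def stdMetric (v w : Fin 3 → ℂ) : ℝ := ∑ k, (conj (v k) * w k).re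

/-- The standard Kähler form `(i/2) ∑ dz_k ∧ dz̄_k` on `ℂ³`; its value on `(v, w)` is
`(i/2) ∑ (v_k w̄_k - w_k v̄_k) = ∑ Im (v̄_k w_k)`. -/
def stdKahler : (Fin 3 → ℂ) [⋀^Fin 2]→L[ℝ] ℝ where
  toFun v := ∑ k, (conj (v 0 k) * v 1 k).im
  map_update_add' := by
    intro inst v i x y
    obtain rfl : inst = instDecidableEqFin 2 := Subsingleton.elim _ _
    fin_cases i <;> simp [Fin.sum_univ_three] <;> ring
  map_update_smul' := by
    intro inst v i c x
    obtain rfl : inst = instDecidableEqFin 2 := Subsingleton.elim _ _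
    fin_cases i <;> simp [Fin.sum_univ_three] <;> ring
  map_eq_zero_of_eq' := by
    intro v i j h hij
    have h01 : v 0 = v 1 := by
      fin_cases i <;> fin_cases j <;> simp_all
    simp only [h01, Fin.sum_univ_three, Complex.mul_im, Complex.conj_re, Complex.conj_im]
    ring
  cont := by
    have h : ∀ (i : Fin 2) (k : Fin 3), Continuous fun v : Fin 2 → Fin 3 → ℂ => v i k :=
      fun i k => (continuous_apply k).comp (continuous_apply i)
    exact continuous_finsetSum _ fun k _ =>
      Complex.continuous_im.comp ((Complex.continuous_conj.comp (h 0 k)).mul (h 1 k))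

/-- The standard holomorphic volume form `dz₁ ∧ dz₂ ∧ dz₃` on `ℂ³`. -/
def stdVolume : (Fin 3 → ℂ) [⋀^Fin 3]→L[ℝ] ℂ where
  toFun v := Matrix.det (Matrix.of v)
  map_update_add' := by
    intro inst v i x y
    obtain rfl : inst = instDecidableEqFin 3 := Subsingleton.elim _ _
    exact (Matrix.detRowAlternating (R := ℂ)).map_update_add v i x y
  map_update_smul' := by
    intro inst v i c x
    obtain rfl : inst = instDecidableEqFin 3 := Subsingleton.elim _ _
    have h := (Matrix.detRowAlternating (R := ℂ)).map_update_smul v i (c : ℂ) x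
    have e : (c : ℂ) • x = c • x := by funext k; simp
    rw [e, smul_eq_mul, ← Complex.real_smul] at h
    exact h
  map_eq_zero_of_eq' := fun v i j h hij =>
    (Matrix.detRowAlternating (R := ℂ)).map_eq_zero_of_eq v h hij
  cont := by
    have : Continuous fun v : Matrix (Fin 3) (Fin 3) ℂ => v.det := continuous_id.matrix_det
    exact this

section SU3

variable {E : Type} [NormedAddCommGroup E] [NormedSpace ℝ E] {M : Type} [TopologicalSpace M]
  [ChartedSpace E M]

/-- `(g, Ω, Ψ)` is an `SU(3)`-structure: `Ω` and `Ψ` are smooth and every tangent space has a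
real-linear isomorphism to `ℂ³` that takes the standard metric, Kähler form and holomorphic volume
form to `g`, `Ω` and `Ψ`. (The metric is determined by `Ω` and `Ψ`.) -/
structure IsSU3Structure (g : ∀ x : M, TangentSpace 𝓘(ℝ, E) x → TangentSpace 𝓘(ℝ, E) x → ℝ)
    (Ω : DiffForm E M ℝ 2) (Ψ : DiffForm E M ℂ 3) : Prop where
  smooth_kahler : Ω.IsSmooth
  smooth_volume : Ψ.IsSmooth
  exists_coframe : ∀ x : M, ∃ u : TangentSpace 𝓘(ℝ, E) x ≃L[ℝ] (Fin 3 → ℂ),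
    (∀ v w, g x v w = stdMetric (u v) (u w)) ∧
    Ω x = stdKahler.compContinuousLinearMap (u : TangentSpace 𝓘(ℝ, E) x →L[ℝ] (Fin 3 → ℂ)) ∧
    Ψ x = stdVolume.compContinuousLinearMap (u : TangentSpace 𝓘(ℝ, E) x →L[ℝ] (Fin 3 → ℂ))

/-- A nearly Calabi-Yau structure: an `SU(3)`-structure with `dΩ = d(Im Ψ) = 0`. -/
structure IsNearlyCalabiYau (g : ∀ x : M, TangentSpace 𝓘(ℝ, E) x → TangentSpace 𝓘(ℝ, E) x → ℝ)
    (Ω : DiffForm E M ℝ 2) (Ψ : DiffForm E M ℂ 3) : Prop extends IsSU3Structure g Ω Ψ where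
  closed_kahler : Ω.extD = 0
  closed_im_volume : Ψ.imPart.extD = 0

/-- `c` is a real structure (anti-complex involution): a smooth involution with `c^*Ω = -Ω` and
`c^*Ψ = Ψ̄`. -/
structure IsRealStructure (Ω : DiffForm E M ℝ 2) (Ψ : DiffForm E M ℂ 3) (c : M → M) : Prop where
  smooth : ContMDiff 𝓘(ℝ, E) 𝓘(ℝ, E) ∞ c
  involutive : Function.Involutive c
  pullback_kahler : ∀ (x : M) (v : Fin 2 → TangentSpace 𝓘(ℝ, E) x),
    Ω (c x) (fun i => mfderiv 𝓘(ℝ, E) 𝓘(ℝ, E) c x (v i)) = -Ω x v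
  pullback_volume : ∀ (x : M) (v : Fin 3 → TangentSpace 𝓘(ℝ, E) x),
    Ψ (c x) (fun i => mfderiv 𝓘(ℝ, E) 𝓘(ℝ, E) c x (v i)) = conj (Ψ x v)

variable {E' : Type} [NormedAddCommGroup E'] [NormedSpace ℝ E'] {L : Type} [TopologicalSpace L]
  [ChartedSpace E' L]

/-- The embedding `f : L → M` of a 3-manifold is special Lagrangian: `f^*(Re Ψ)` is the
volume form of the induced metric, for the orientation it defines (that is, it takes the values
`±1` on the orthonormal bases of the tangent spaces of `L`), and `f^*Ω = f^*(Im Ψ) = 0`. -/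
structure IsSpecialLagrangian
    (g : ∀ x : M, TangentSpace 𝓘(ℝ, E) x → TangentSpace 𝓘(ℝ, E) x → ℝ)
    (Ω : DiffForm E M ℝ 2) (Ψ : DiffForm E M ℂ 3) (f : L → M) : Prop where
  embedding : Manifold.IsSmoothEmbedding 𝓘(ℝ, E') 𝓘(ℝ, E) ∞ f
  finrank_eq : Module.finrank ℝ E' = 3
  calibrated : ∀ (x : L) (v : Fin 3 → TangentSpace 𝓘(ℝ, E') x),
    (∀ i j, g (f x) (mfderiv 𝓘(ℝ, E') 𝓘(ℝ, E) f x (v i)) (mfderiv 𝓘(ℝ, E') 𝓘(ℝ, E) f x (v j)) =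
      if i = j then 1 else 0) →
    |(Ψ (f x) (fun i => mfderiv 𝓘(ℝ, E') 𝓘(ℝ, E) f x (v i))).re| = 1
  kahler_eq_zero : ∀ (x : L) (v : Fin 2 → TangentSpace 𝓘(ℝ, E') x),
    Ω (f x) (fun i => mfderiv 𝓘(ℝ, E') 𝓘(ℝ, E) f x (v i)) = 0
  im_volume_eq_zero : ∀ (x : L) (v : Fin 3 → TangentSpace 𝓘(ℝ, E') x),
    (Ψ (f x) (fun i => mfderiv 𝓘(ℝ, E') 𝓘(ℝ, E) f x (v i))).im = 0

/-- The Riemannian distance of the metric induced on `L` by `f : L → M`: the infimum of the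
lengths of `C¹` paths. -/
def inducedEDist (g : ∀ x : M, TangentSpace 𝓘(ℝ, E) x → TangentSpace 𝓘(ℝ, E) x → ℝ) (f : L → M)
    (x y : L) : ℝ≥0∞ :=
  letI : ∀ z : L, ENorm (TangentSpace 𝓘(ℝ, E') z) := fun z =>
    ⟨fun v => ENNReal.ofReal (Real.sqrt (g (f z) (mfderiv 𝓘(ℝ, E') 𝓘(ℝ, E) f z v)
      (mfderiv 𝓘(ℝ, E') 𝓘(ℝ, E) f z v)))⟩
  Manifold.riemannianEDist 𝓘(ℝ, E') x y

/-- Completeness of the induced Riemannian metric: Cauchy sequences converge. -/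
def IsCompleteInduced (g : ∀ x : M, TangentSpace 𝓘(ℝ, E) x → TangentSpace 𝓘(ℝ, E) x → ℝ)
    (f : L → M) : Prop :=
  ∀ u : ℕ → L,
    (∀ ε : ℝ≥0∞, 0 < ε → ∃ N, ∀ m ≥ N, ∀ n ≥ N, inducedEDist (E' := E') g f (u m) (u n) < ε) →
    ∃ x, Filter.Tendsto (fun n => inducedEDist (E' := E') g f (u n) x) Filter.atTop (𝓝 0)

/-- `p : L → M` is a smooth locally trivial fibre bundle with fibre the circle. -/
def IsSmoothCircleBundle (p : L → M) : Prop :=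
  ∀ y : M, ∃ (U : Set M) (Φ : OpenPartialHomeomorph L (M × Circle)), IsOpen U ∧ y ∈ U ∧
    Φ.source = p ⁻¹' U ∧ Φ.target = U ×ˢ Set.univ ∧ (∀ x ∈ Φ.source, (Φ x).1 = p x) ∧
    ContMDiffOn 𝓘(ℝ, E') (𝓘(ℝ, E).prod (𝓡 1)) ∞ Φ Φ.source ∧
    ContMDiffOn (𝓘(ℝ, E).prod (𝓡 1)) 𝓘(ℝ, E') ∞ Φ.symm Φ.target

end SU3

/-! ### The pseudo-projective spaces `Ψ RP³` and `Ψ CP³` -/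

/-- The quadratic form `|z₀|² + |z₁|² - |z₂|² - |z₃|²` on `𝕜⁴`, `𝕜 = ℝ, ℂ`. -/
def psiQ {𝕜 : Type} [RCLike 𝕜] (z : Fin 4 → 𝕜) : ℝ :=
  ‖z 0‖ ^ 2 + ‖z 1‖ ^ 2 - ‖z 2‖ ^ 2 - ‖z 3‖ ^ 2

theorem psiQ_smul {𝕜 : Type} [RCLike 𝕜] (c : 𝕜) (z : Fin 4 → 𝕜) :
    psiQ (c • z) = ‖c‖ ^ 2 * psiQ z := by
  simp only [psiQ, Pi.smul_apply, smul_eq_mul, norm_mul]; ring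

theorem continuous_psiQ {𝕜 : Type} [RCLike 𝕜] : Continuous (psiQ (𝕜 := 𝕜)) := by
  unfold psiQ; fun_prop

/-- The pseudo-sphere: `Ψ S³` for `𝕜 = ℝ`, `Ψ S⁷` for `𝕜 = ℂ`. -/
def PsiSphere (𝕜 : Type) [RCLike 𝕜] : Set (Fin 4 → 𝕜) := {z | psiQ z = 1}

/-- Two points are equivalent if they differ by a scalar of absolute value one: an element of
`{±1}` for `𝕜 = ℝ`, of `S¹` for `𝕜 = ℂ`. -/
def PsiP.setoid (𝕜 : Type) [RCLike 𝕜] : Setoid (PsiSphere 𝕜) where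
  r z w := ∃ c : 𝕜, ‖c‖ = 1 ∧ (w : Fin 4 → 𝕜) = c • (z : Fin 4 → 𝕜)
  iseqv :=
    { refl := fun z => ⟨1, by simp, by simp⟩
      symm := by
        rintro z w ⟨c, hc, h⟩
        have hc0 : c ≠ 0 := by rintro rfl; simp at hc
        exact ⟨c⁻¹, by simp [hc], by rw [h, smul_smul, inv_mul_cancel₀ hc0, one_smul]⟩
      trans := by
        rintro z w t ⟨c, hc, h⟩ ⟨d, hd, h'⟩
        exact ⟨d * c, by simp [hc, hd], by rw [h', h, smul_smul]⟩ }

/-- The pseudo-projective space: `PsiP ℝ` is `Ψ RP³ = Ψ S³ / {±1}` and `PsiP ℂ` is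
`Ψ CP³ = Ψ S⁷ / S¹`. -/
def PsiP (𝕜 : Type) [RCLike 𝕜] : Type := Quotient (PsiP.setoid 𝕜)

namespace PsiP

instance (𝕜 : Type) [RCLike 𝕜] : TopologicalSpace (PsiP 𝕜) :=
  inferInstanceAs (TopologicalSpace (Quotient (PsiP.setoid 𝕜)))

/-- The quotient map. -/
def proj {𝕜 : Type} [RCLike 𝕜] (z : PsiSphere 𝕜) : PsiP 𝕜 := Quotient.mk (PsiP.setoid 𝕜) z

theorem isQuotientMap_proj {𝕜 : Type} [RCLike 𝕜] :
    Topology.IsQuotientMap (proj (𝕜 := 𝕜)) := isQuotientMap_quot_mk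

theorem proj_eq_iff {𝕜 : Type} [RCLike 𝕜] {z w : PsiSphere 𝕜} :
    proj z = proj w ↔ ∃ c : 𝕜, ‖c‖ = 1 ∧ (w : Fin 4 → 𝕜) = c • (z : Fin 4 → 𝕜) :=
  Quotient.eq (r := PsiP.setoid 𝕜)

theorem normalize_mem {𝕜 : Type} [RCLike 𝕜] (z : Fin 4 → 𝕜) (h : 0 < psiQ z) :
    (((Real.sqrt (psiQ z))⁻¹ : ℝ) : 𝕜) • z ∈ PsiSphere 𝕜 := by
  have h1 : psiQ ((((Real.sqrt (psiQ z))⁻¹ : ℝ) : 𝕜) • z) = 1 := by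
    rw [psiQ_smul, RCLike.norm_ofReal, sq_abs, inv_pow, Real.sq_sqrt h.le, inv_mul_cancel₀ h.ne']
  exact h1

/-- The class `[z] = [z / √(psiQ z)]` of a vector of the open cone `{psiQ > 0}` (and a fixed point
outside the cone). -/
def mk {𝕜 : Type} [RCLike 𝕜] (z : Fin 4 → 𝕜) : PsiP 𝕜 := by
  classical
  exact if h : 0 < psiQ z then proj ⟨_, normalize_mem z h⟩
    else proj ⟨![1, 0, 0, 0], by simp [PsiSphere, psiQ]⟩

theorem mk_of_pos {𝕜 : Type} [RCLike 𝕜] (z : Fin 4 → 𝕜) (h : 0 < psiQ z) :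
    mk z = proj ⟨_, normalize_mem z h⟩ := by simp [mk, h]

theorem mk_smul {𝕜 : Type} [RCLike 𝕜] (z : PsiSphere 𝕜) (c : 𝕜) (hc : c ≠ 0) :
    mk (c • (z : Fin 4 → 𝕜)) = proj z := by
  have hz : psiQ (z : Fin 4 → 𝕜) = 1 := z.2
  have hq : psiQ (c • (z : Fin 4 → 𝕜)) = ‖c‖ ^ 2 := by rw [psiQ_smul, hz, mul_one]
  have hp : 0 < ‖c‖ := norm_pos_iff.2 hc
  rw [mk_of_pos _ (by rw [hq]; positivity), eq_comm, proj_eq_iff]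
  refine ⟨((‖c‖⁻¹ : ℝ) : 𝕜) * c, ?_, ?_⟩
  · rw [norm_mul, RCLike.norm_ofReal, abs_of_pos (by positivity), inv_mul_cancel₀ hp.ne']
  · simp only [hq, Real.sqrt_sq hp.le, smul_smul]

theorem continuousOn_mk {𝕜 : Type} [RCLike 𝕜] :
    ContinuousOn (mk (𝕜 := 𝕜)) {z | 0 < psiQ z} := by
  rw [continuousOn_iff_continuous_domRestrict]
  have : Continuous fun z : {z : Fin 4 → 𝕜 | 0 < psiQ z} =>
      proj (⟨_, normalize_mem z.1 z.2⟩ : PsiSphere 𝕜) := by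
    have hr : Continuous fun z : {z : Fin 4 → 𝕜 | 0 < psiQ z} => (Real.sqrt (psiQ z.1))⁻¹ :=
      Continuous.inv₀ (continuous_psiQ.comp continuous_subtype_val).sqrt
        fun z => (Real.sqrt_pos.2 z.2).ne'
    have hs : Continuous fun z : {z : Fin 4 → 𝕜 | 0 < psiQ z} =>
        (((Real.sqrt (psiQ z.1))⁻¹ : ℝ) : 𝕜) • z.1 :=
      ((RCLike.continuous_ofReal (K := 𝕜)).comp hr).fun_smul continuous_subtype_val
    exact (isQuotientMap_proj (𝕜 := 𝕜)).continuous.comp (hs.subtype_mk _)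
  refine this.congr fun z => (mk_of_pos z.1 z.2).symm

/-- The quotient `z_k / z_i`. -/
def ratio {𝕜 : Type} [RCLike 𝕜] (i k : Fin 4) : PsiP 𝕜 → 𝕜 :=
  Quotient.lift (fun z : PsiSphere 𝕜 => z.1 k / z.1 i) (by
    rintro z w ⟨c, hc, h⟩
    have hc0 : c ≠ 0 := by rintro rfl; simp at hc
    simp [h, mul_div_mul_left _ _ hc0])

/-- The set `{z_i ≠ 0}`. -/
def affineSet (𝕜 : Type) [RCLike 𝕜] (i : Fin 4) : Set (PsiP 𝕜) := {x | ratio i i x ≠ 0}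

theorem ratio_proj {𝕜 : Type} [RCLike 𝕜] (i k : Fin 4) (z : PsiSphere 𝕜) :
    ratio i k (proj z) = z.1 k / z.1 i := rfl

theorem proj_mem_affineSet {𝕜 : Type} [RCLike 𝕜] (i : Fin 4) (z : PsiSphere 𝕜) :
    proj z ∈ affineSet 𝕜 i ↔ z.1 i ≠ 0 := by
  simp [affineSet, ratio_proj]

theorem ratio_mk {𝕜 : Type} [RCLike 𝕜] (i k : Fin 4) (z : Fin 4 → 𝕜) (h : 0 < psiQ z) :
    ratio i k (mk z) = z k / z i := by
  rw [mk_of_pos z h, ratio_proj]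
  have : (((Real.sqrt (psiQ z))⁻¹ : ℝ) : 𝕜) ≠ 0 := by
    rw [Ne, RCLike.ofReal_eq_zero]; exact inv_ne_zero (Real.sqrt_pos.2 h).ne'
  simp only [Pi.smul_apply, smul_eq_mul, mul_div_mul_left _ _ this]

theorem isOpen_affineSet (𝕜 : Type) [RCLike 𝕜] (i : Fin 4) : IsOpen (affineSet 𝕜 i) := by
  rw [← isQuotientMap_proj.isOpen_preimage]
  have : proj ⁻¹' affineSet 𝕜 i = {z : PsiSphere 𝕜 | z.1 i ≠ 0} := by
    ext z; exact proj_mem_affineSet i z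
  rw [this]
  exact isOpen_ne_fun ((continuous_apply i).comp continuous_subtype_val) continuous_const

theorem continuousOn_ratio {𝕜 : Type} [RCLike 𝕜] (i k : Fin 4) :
    ContinuousOn (ratio (𝕜 := 𝕜) i k) (affineSet 𝕜 i) := by
  rw [isQuotientMap_proj.continuousOn_isOpen_iff (isOpen_affineSet 𝕜 i)]
  intro z hz
  have hz' : z.1 i ≠ 0 := (proj_mem_affineSet i z).1 hz
  refine ContinuousAt.continuousWithinAt ?_
  have h1 : Continuous fun z : PsiSphere 𝕜 => z.1 k :=
    (continuous_apply k).comp continuous_subtype_val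
  have h2 : Continuous fun z : PsiSphere 𝕜 => z.1 i :=
    (continuous_apply i).comp continuous_subtype_val
  exact h1.continuousAt.div h2.continuousAt hz'

/-- The index of the distinguished affine coordinate of the two charts. -/
def idx (b : Bool) : Fin 4 := cond b 1 0

/-- The point of affine coordinates `u` of the two charts. -/
def affinePt {𝕜 : Type} [RCLike 𝕜] (b : Bool) (u : Fin 3 → 𝕜) : Fin 4 → 𝕜 :=
  cond b ![u 0, 1, u 1, u 2] ![1, u 0, u 1, u 2]

theorem continuous_affinePt {𝕜 : Type} [RCLike 𝕜] (b : Bool) :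
    Continuous (affinePt (𝕜 := 𝕜) b) := by
  refine continuous_pi fun k => ?_
  cases b <;> fin_cases k <;> simp [affinePt] <;> fun_prop

theorem affinePt_idx {𝕜 : Type} [RCLike 𝕜] (b : Bool) (u : Fin 3 → 𝕜) :
    affinePt b u (idx b) = 1 := by
  cases b <;> simp [affinePt, idx]

theorem smul_affinePt {𝕜 : Type} [RCLike 𝕜] (b : Bool) (z : Fin 4 → 𝕜) (h : z (idx b) ≠ 0) :
    affinePt b ![z (idx !b) / z (idx b), z 2 / z (idx b), z 3 / z (idx b)]
      = (z (idx b))⁻¹ • z := by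
  funext k
  cases b <;> simp [idx] at h <;> fin_cases k <;> simp [affinePt, idx, div_eq_inv_mul, h]

/-- The affine chart `[z] ↦ (z_1, z_2, z_3) / z_0` (for `b = false`) or
`[z] ↦ (z_0, z_2, z_3) / z_1` (for `b = true`). -/
def chart (𝕜 : Type) [RCLike 𝕜] (b : Bool) : OpenPartialHomeomorph (PsiP 𝕜) (Fin 3 → 𝕜) where
  toFun x := ![ratio (idx b) (idx !b) x, ratio (idx b) 2 x, ratio (idx b) 3 x]
  invFun u := mk (affinePt b u)
  source := affineSet 𝕜 (idx b)
  target := {u | 0 < psiQ (affinePt b u)}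
  map_source' := by
    intro x hx
    induction x using Quotient.ind with | _ z =>
    have hz := (proj_mem_affineSet (idx b) z).1 hx
    change 0 < psiQ (affinePt b ![z.1 (idx !b) / z.1 (idx b), z.1 2 / z.1 (idx b),
      z.1 3 / z.1 (idx b)])
    have h1 : psiQ z.1 = 1 := z.2
    rw [smul_affinePt b z.1 hz, psiQ_smul, h1]
    have := norm_pos_iff.2 hz
    rw [norm_inv]; positivity
  map_target' := by
    intro u hu
    change ratio (idx b) (idx b) (mk _) ≠ 0
    rw [ratio_mk _ _ _ hu, affinePt_idx]; simp
  left_inv' := by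
    intro x hx
    induction x using Quotient.ind with | _ z =>
    have hz := (proj_mem_affineSet (idx b) z).1 hx
    change mk (affinePt b ![z.1 (idx !b) / z.1 (idx b), z.1 2 / z.1 (idx b),
      z.1 3 / z.1 (idx b)]) = proj z
    rw [smul_affinePt b z.1 hz, mk_smul z _ (inv_ne_zero hz)]
  right_inv' := by
    intro u hu
    have hu' : 0 < psiQ (affinePt b u) := hu
    simp only [ratio_mk _ _ _ hu', affinePt_idx]
    funext k
    cases b <;> fin_cases k <;> simp [affinePt, idx]
  open_source := isOpen_affineSet 𝕜 _
  open_target := isOpen_lt continuous_const (continuous_psiQ.comp (continuous_affinePt b))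
  continuousOn_toFun := by
    refine continuousOn_pi.2 fun k => ?_
    fin_cases k <;> simp <;> exact continuousOn_ratio _ _
  continuousOn_invFun :=
    continuousOn_mk.comp (continuous_affinePt b).continuousOn fun _ h => h

theorem mem_affineSet_or {𝕜 : Type} [RCLike 𝕜] (x : PsiP 𝕜) (h : x ∉ affineSet 𝕜 0) :
    x ∈ affineSet 𝕜 1 := by
  induction x using Quotient.ind with | _ z =>
  have h0 : z.1 0 = 0 := by
    by_contra h'; exact h ((proj_mem_affineSet 0 z).2 h')
  refine (proj_mem_affineSet 1 z).2 fun h1 => ?_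
  have hz : psiQ z.1 = 1 := z.2
  simp only [psiQ, h0, h1, norm_zero] at hz
  nlinarith [sq_nonneg ‖z.1 2‖, sq_nonneg ‖z.1 3‖]

open Classical in
/-- The index of the preferred chart at a point. -/
def chartIdx {𝕜 : Type} [RCLike 𝕜] (x : PsiP 𝕜) : Bool := if x ∈ affineSet 𝕜 0 then false else true

theorem mem_chart_source {𝕜 : Type} [RCLike 𝕜] (x : PsiP 𝕜) :
    x ∈ (chart 𝕜 (chartIdx x)).source := by
  change x ∈ affineSet 𝕜 (idx (chartIdx x))
  by_cases h : x ∈ affineSet 𝕜 0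
  · simp [chartIdx, h, idx]
  · simpa [chartIdx, h, idx] using mem_affineSet_or x h

instance (𝕜 : Type) [RCLike 𝕜] : ChartedSpace (Fin 3 → 𝕜) (PsiP 𝕜) where
  atlas := Set.range (chart 𝕜)
  chartAt x := chart 𝕜 (chartIdx x)
  mem_chart_source := mem_chart_source
  chart_mem_atlas _ := ⟨_, rfl⟩

instance (𝕜 : Type) [RCLike 𝕜] : IsManifold 𝓘(ℝ, Fin 3 → 𝕜) ∞ (PsiP 𝕜) := by
  refine isManifold_of_contDiffOn _ _ _ ?_
  rintro _ _ ⟨b, rfl⟩ ⟨b', rfl⟩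
  simp only [modelWithCornersSelf_coe, modelWithCornersSelf_coe_symm, Function.comp_id,
    Function.id_comp, Set.preimage_id, Set.range_id, Set.inter_univ]
  have key : ∀ u ∈ ((chart 𝕜 b).symm.trans (chart 𝕜 b')).source,
      affinePt b u (idx b') ≠ 0 ∧ ((chart 𝕜 b).symm.trans (chart 𝕜 b')) u =
      ![affinePt b u (idx !b') / affinePt b u (idx b'), affinePt b u 2 / affinePt b u (idx b'),
        affinePt b u 3 / affinePt b u (idx b')] := by
    intro u hu
    rw [OpenPartialHomeomorph.trans_source] at hu
    have h1 : 0 < psiQ (affinePt b u) := hu.1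
    have h2 : ratio (idx b') (idx b') (mk (affinePt b u)) ≠ 0 := hu.2
    rw [ratio_mk _ _ _ h1] at h2
    refine ⟨fun h => h2 (by simp [h]), ?_⟩
    change ![ratio (idx b') (idx !b') (mk (affinePt b u)), ratio (idx b') 2 (mk (affinePt b u)),
      ratio (idx b') 3 (mk (affinePt b u))] = _
    simp only [ratio_mk _ _ _ h1]
  refine ContDiffOn.congr ?_ fun u hu => (key u hu).2
  have hs : ∀ k, ContDiff ℝ ∞ fun u : Fin 3 → 𝕜 => affinePt b u k := by
    intro k
    cases b <;> fin_cases k <;> simp [affinePt] <;> fun_prop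
  refine contDiffOn_pi.2 fun k => ?_
  fin_cases k <;> simp [div_eq_mul_inv] <;>
    exact (hs _).contDiffOn.mul ((hs _).contDiffOn.inv fun u hu => (key u hu).1)

end PsiP

/-! ### Quaternions -/

/-- The complex number `z` in `q = z + j w`. -/
def quatZ : ℍ[ℝ] →L[ℝ] ℂ := LinearMap.toContinuousLinearMap
  { toFun := fun q => ⟨q.re, q.imI⟩
    map_add' := fun _ _ => by apply Complex.ext <;> simp
    map_smul' := fun _ _ => by apply Complex.ext <;> simp }

/-- The complex number `w` in `q = z + j w`. -/
def quatW : ℍ[ℝ] →L[ℝ] ℂ := LinearMap.toContinuousLinearMap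
  { toFun := fun q => ⟨q.imJ, -q.imK⟩
    map_add' := fun _ _ => by apply Complex.ext <;> simp; ring
    map_smul' := fun _ _ => by apply Complex.ext <;> simp }

/-- The quaternion `j`; it satisfies `z j = j z̄` for complex `z`. -/
def quatJ : ℍ[ℝ] := ⟨0, 0, 1, 0⟩

/-- The quaternion `z + j w`. -/
def quatOf (z w : ℂ) : ℍ[ℝ] := (z : ℍ[ℝ]) + quatJ * (w : ℍ[ℝ])

theorem quatOf_re (z w : ℂ) : (quatOf z w).re = z.re := by
  simp only [quatOf, Quaternion.re_add, Quaternion.re_mul]; simp [quatJ]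

theorem quatOf_imI (z w : ℂ) : (quatOf z w).imI = z.im := by
  simp only [quatOf, Quaternion.imI_add, Quaternion.imI_mul]; simp [quatJ]

theorem quatOf_imJ (z w : ℂ) : (quatOf z w).imJ = w.re := by
  simp only [quatOf, Quaternion.imJ_add, Quaternion.imJ_mul]; simp [quatJ]

theorem quatOf_imK (z w : ℂ) : (quatOf z w).imK = -w.im := by
  simp only [quatOf, Quaternion.imK_add, Quaternion.imK_mul]; simp [quatJ]

theorem normSq_quatOf (z w : ℂ) : Quaternion.normSq (quatOf z w) = ‖z‖ ^ 2 + ‖w‖ ^ 2 := by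
  rw [Quaternion.normSq_def', quatOf_re, quatOf_imI, quatOf_imJ, quatOf_imK,
    ← Complex.normSq_eq_norm_sq, ← Complex.normSq_eq_norm_sq, Complex.normSq_apply,
    Complex.normSq_apply]
  ring

theorem quatOf_quatZ_quatW (q : ℍ[ℝ]) : quatOf (quatZ q) (quatW q) = q := by
  ext <;> simp [quatOf_re, quatOf_imI, quatOf_imJ, quatOf_imK, quatZ, quatW]

/-- `(z₀, z₁, z₂, z₃) ↦ (z₀ + j z₁, z₂ + j z₃)`. -/
def toQuat (z : Fin 4 → ℂ) : ℍ[ℝ] × ℍ[ℝ] := (quatOf (z 0) (z 1), quatOf (z 2) (z 3))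

/-- The inverse identification `ℍ² = ℂ⁴`. -/
def ofQuat : (ℍ[ℝ] × ℍ[ℝ]) →L[ℝ] (Fin 4 → ℂ) :=
  ContinuousLinearMap.pi ![quatZ ∘L .fst ℝ _ _, quatW ∘L .fst ℝ _ _,
    quatZ ∘L .snd ℝ _ _, quatW ∘L .snd ℝ _ _]

theorem toQuat_ofQuat (v : ℍ[ℝ] × ℍ[ℝ]) : toQuat (ofQuat v) = v := by
  simp [toQuat, ofQuat, quatOf_quatZ_quatW]

theorem ofQuat_toQuat (z : Fin 4 → ℂ) : ofQuat (toQuat z) = z := by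
  funext k
  fin_cases k <;> apply Complex.ext <;> simp [toQuat, ofQuat, quatZ, quatW, quatOf_re, quatOf_imI, quatOf_imJ, quatOf_imK]

/-- The `(1,1)` quaternionic inner product `⟨(q₁, q₂), (p₁, p₂)⟩ = q̄₁ p₁ - q̄₂ p₂`. -/
def quatForm (v w : ℍ[ℝ] × ℍ[ℝ]) : ℍ[ℝ] := star v.1 * w.1 - star v.2 * w.2

theorem quatForm_toQuat_self (z : Fin 4 → ℂ) :
    quatForm (toQuat z) (toQuat z) = ((psiQ z : ℝ) : ℍ[ℝ]) := by
  rw [quatForm, Quaternion.star_mul_self, Quaternion.star_mul_self, ← Quaternion.coe_sub]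
  simp only [toQuat, normSq_quatOf, psiQ]
  congr 1; ring

/-- The space `𝔉 ≅ Sp(1,1)` of pairs `(e₁, e₂)` in `ℍ²` with `⟨e₁, e₁⟩ = 1`, `⟨e₂, e₂⟩ = -1` and
`⟨e₁, e₂⟩ = 0`. -/
structure PsiFrame where
  e₁ : ℍ[ℝ] × ℍ[ℝ]
  e₂ : ℍ[ℝ] × ℍ[ℝ]
  form₁₁ : quatForm e₁ e₁ = 1
  form₂₂ : quatForm e₂ e₂ = -1
  form₁₂ : quatForm e₁ e₂ = 0

theorem normSq_of_psiSphere (z : PsiSphere ℂ) :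
    Quaternion.normSq (toQuat z.1).1 = 1 + Quaternion.normSq (toQuat z.1).2 := by
  have h : psiQ z.1 = 1 := z.2
  simp only [psiQ] at h
  simp only [toQuat, normSq_quatOf]
  linarith

theorem normSq_pos_of_psiSphere (z : PsiSphere ℂ) : 0 < Quaternion.normSq (toQuat z.1).1 := by
  rw [normSq_of_psiSphere]
  have := Quaternion.normSq_nonneg (a := (toQuat z.1).2)
  linarith

theorem quatForm_completion₁₂ (p q : ℍ[ℝ]) (h0 : Quaternion.normSq p ≠ 0) :
    quatForm (p, q) (((Quaternion.normSq p)⁻¹ : ℝ) • (p * star q * p), p) = 0 := by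
  simp only [quatForm, mul_smul_comm]
  rw [mul_assoc p, ← mul_assoc (star p), Quaternion.star_mul_self, Quaternion.coe_mul_eq_smul,
    smul_smul, inv_mul_cancel₀ h0, one_smul, sub_self]

theorem quatForm_completion₂₂ (p q : ℍ[ℝ]) (h0 : Quaternion.normSq p ≠ 0)
    (h1 : Quaternion.normSq p = 1 + Quaternion.normSq q) :
    quatForm (((Quaternion.normSq p)⁻¹ : ℝ) • (p * star q * p), p)
      (((Quaternion.normSq p)⁻¹ : ℝ) • (p * star q * p), p) = -1 := by
  simp only [quatForm]
  rw [Quaternion.star_mul_self, Quaternion.star_mul_self, ← Quaternion.coe_sub,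
    Quaternion.normSq_smul, map_mul, map_mul, Quaternion.normSq_star]
  have : (Quaternion.normSq p)⁻¹ ^ 2 * (Quaternion.normSq p * Quaternion.normSq q *
      Quaternion.normSq p) - Quaternion.normSq p = -1 := by
    field_simp
    linarith
  rw [this]; simp

/-- The frame with `e₁ = (p, q)` the given point and `e₂ = (p q̄ p / |p|², p)`. -/
def PsiFrame.ofSphere (z : PsiSphere ℂ) : PsiFrame where
  e₁ := toQuat z.1
  e₂ := (((Quaternion.normSq (toQuat z.1).1)⁻¹ : ℝ) •
    ((toQuat z.1).1 * star (toQuat z.1).2 * (toQuat z.1).1), (toQuat z.1).1)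
  form₁₁ := by
    have h : psiQ z.1 = 1 := z.2
    rw [quatForm_toQuat_self, h]; simp
  form₂₂ := quatForm_completion₂₂ _ _ (normSq_pos_of_psiSphere z).ne' (normSq_of_psiSphere z)
  form₁₂ := quatForm_completion₁₂ _ _ (normSq_pos_of_psiSphere z).ne'

/-- The components `(ω₁, ω₂, ω₃)` of the Maurer-Cartan form `φ` of `𝔉`, which is given by
`de_a = e_b φ^b_a`, at the frame `f` and as a function of `v = de₁`. Pairing
`v = e₁ φ¹₁ + e₂ φ²₁` with `e₁` and `e₂` gives `φ¹₁ = ⟨e₁, v⟩` and `φ²₁ = -⟨e₂, v⟩`, and one writes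
`φ²₁ = ω₁ + j ω₂` and `φ¹₁ = i ρ₁ + j ω̄₃`. -/
def PsiFrame.omega (f : PsiFrame) : (ℍ[ℝ] × ℍ[ℝ]) →L[ℝ] (Fin 3 → ℂ) :=
  LinearMap.toContinuousLinearMap
    { toFun := fun v =>
        ![quatZ (-quatForm f.e₂ v), quatW (-quatForm f.e₂ v), conj (quatW (quatForm f.e₁ v))]
      map_add' := fun v w => by
        funext k
        fin_cases k <;> simp [quatForm, mul_add, add_sub_add_comm] <;> ring
      map_smul' := fun c v => by
        funext k
        fin_cases k <;> simp [quatForm, ← smul_sub, mul_sub] }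

/-! ### Hyperbolic 4-space -/

theorem norm_coe_complex (c : ℂ) : ‖(c : ℍ[ℝ])‖ = ‖c‖ := by
  have h := normSq_quatOf c 0
  have h' : quatOf c 0 = (c : ℍ[ℝ]) := by simp [quatOf]
  rw [h', Quaternion.normSq_eq_norm_mul_self, norm_zero] at h
  nlinarith [norm_nonneg (c : ℍ[ℝ]), norm_nonneg c]

theorem continuous_coe_complex : Continuous fun c : ℂ => (c : ℍ[ℝ]) :=
  LinearMap.continuous_of_finiteDimensional (𝕜 := ℝ)
    { toFun := fun c : ℂ => (c : ℍ[ℝ])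
      map_add' := Quaternion.coeComplex_add
      map_smul' := fun r c => by ext <;> simp : ℂ →ₗ[ℝ] ℍ[ℝ] }

theorem quatOf_mul_coe (z w c : ℂ) : quatOf (c * z) (c * w) = quatOf z w * (c : ℍ[ℝ]) := by
  rw [mul_comm c z, mul_comm c w, quatOf, quatOf, Quaternion.coeComplex_mul,
    Quaternion.coeComplex_mul, add_mul, mul_assoc]

theorem psiQ_ofQuat (v : ℍ[ℝ] × ℍ[ℝ]) :
    psiQ (ofQuat v) = Quaternion.normSq v.1 - Quaternion.normSq v.2 := by
  have h := quatForm_toQuat_self (ofQuat v)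
  rw [toQuat_ofQuat, quatForm, Quaternion.star_mul_self, Quaternion.star_mul_self,
    ← Quaternion.coe_sub, Quaternion.coe_inj] at h
  exact h.symm

/-- Two points of `Ψ S⁷` are equivalent if they differ by right multiplication by a unit
quaternion. -/
def PsiHP1.setoid : Setoid (PsiSphere ℂ) where
  r z w := ∃ r : ℍ[ℝ], ‖r‖ = 1 ∧ toQuat w.1 = ((toQuat z.1).1 * r, (toQuat z.1).2 * r)
  iseqv :=
    { refl := fun z => ⟨1, by simp, by simp⟩
      symm := by
        rintro z w ⟨r, hr, h⟩
        have hr0 : r ≠ 0 := by rintro rfl; simp at hr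
        exact ⟨r⁻¹, by simp [hr], by simp [h, hr0]⟩
      trans := by
        rintro z w t ⟨c, hc, h⟩ ⟨d, hd, h'⟩
        exact ⟨c * d, by simp [hc, hd], by simp [h', h, mul_assoc]⟩ }

/-- `Ψ HP¹ = Ψ S⁷ / S³`, which is hyperbolic 4-space `H⁴`. -/
def PsiHP1 : Type := Quotient PsiHP1.setoid

instance : TopologicalSpace PsiHP1 := inferInstanceAs (TopologicalSpace (Quotient PsiHP1.setoid))

/-- The twistor fibration `e S¹ ↦ e S³`. -/
def twistorMap : PsiP ℂ → PsiHP1 :=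
  Quotient.map' (s₁ := PsiP.setoid ℂ) (s₂ := PsiHP1.setoid) id (by
    rintro z w ⟨c, hc, h⟩
    refine ⟨(c : ℍ[ℝ]), ?_, ?_⟩
    · rw [← hc]
      exact norm_coe_complex c
    · simp [toQuat, h, quatOf_mul_coe])

namespace PsiHP1

/-- The quotient map. -/
def proj (z : PsiSphere ℂ) : PsiHP1 := Quotient.mk PsiHP1.setoid z

theorem isQuotientMap_proj : Topology.IsQuotientMap proj := isQuotientMap_quot_mk

theorem fst_ne_zero (z : PsiSphere ℂ) : (toQuat z.1).1 ≠ 0 := by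
  intro h
  have := normSq_pos_of_psiSphere z
  rw [h] at this; simp at this

/-- The ball model: the coordinate `[p, q] ↦ q p⁻¹`, with values in the unit ball of `ℍ`. -/
def ballCoord : PsiHP1 → ℍ[ℝ] :=
  Quotient.lift (fun z : PsiSphere ℂ => (toQuat z.1).2 * (toQuat z.1).1⁻¹) (by
    rintro z w ⟨r, hr, h⟩
    have hr0 : r ≠ 0 := by rintro rfl; simp at hr
    simp [h, mul_assoc, hr0])

/-- The inverse `x ↦ [1, x]` of `ballCoord` on the unit ball. -/
def ofBall (x : ℍ[ℝ]) : PsiHP1 := twistorMap (PsiP.mk (ofQuat (1, x)))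

theorem psiQ_pos {x : ℍ[ℝ]} (hx : ‖x‖ < 1) : 0 < psiQ (ofQuat (1, x)) := by
  rw [psiQ_ofQuat, map_one, Quaternion.normSq_eq_norm_mul_self]
  nlinarith [norm_nonneg x]

theorem norm_lt (z : PsiSphere ℂ) : ‖(toQuat z.1).2 * (toQuat z.1).1⁻¹‖ < 1 := by
  have h := normSq_of_psiSphere z
  have h0 : 0 < ‖(toQuat z.1).1‖ := norm_pos_iff.2 (fst_ne_zero z)
  rw [norm_mul, norm_inv, ← div_eq_mul_inv, div_lt_one h0]
  rw [Quaternion.normSq_eq_norm_mul_self, Quaternion.normSq_eq_norm_mul_self] at h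
  nlinarith [norm_nonneg (toQuat z.1).2]

theorem toQuat_smul (c : ℂ) (z : Fin 4 → ℂ) :
    toQuat (c • z) = ((toQuat z).1 * (c : ℍ[ℝ]), (toQuat z).2 * (c : ℍ[ℝ])) := by
  simp [toQuat, quatOf_mul_coe]

theorem exists_ofBall (x : ℍ[ℝ]) (hx : ‖x‖ < 1) : ∃ z : PsiSphere ℂ, ofBall x = proj z ∧
    ∃ c : ℂ, c ≠ 0 ∧ toQuat z.1 = ((c : ℍ[ℝ]), x * (c : ℍ[ℝ])) := by
  refine ⟨_, congrArg twistorMap (PsiP.mk_of_pos _ (psiQ_pos hx)),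
    ((Real.sqrt (psiQ (ofQuat (1, x))))⁻¹ : ℝ), ?_, ?_⟩
  · exact Complex.ofReal_ne_zero.2 (inv_ne_zero (Real.sqrt_pos.2 (psiQ_pos hx)).ne')
  · simp only [id, toQuat_smul, toQuat_ofQuat, one_mul]
    rfl

theorem ballCoord_ofBall (x : ℍ[ℝ]) (hx : ‖x‖ < 1) : ballCoord (ofBall x) = x := by
  obtain ⟨z, h, c, hc, hz⟩ := exists_ofBall x hx
  have hc' : (c : ℍ[ℝ]) ≠ 0 := by
    rw [← norm_pos_iff, norm_coe_complex]; exact norm_pos_iff.2 hc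
  rw [h]
  change (toQuat z.1).2 * (toQuat z.1).1⁻¹ = x
  rw [hz]; simp [hc']

theorem ofBall_ballCoord (y : PsiHP1) : ofBall (ballCoord y) = y := by
  induction y using Quotient.ind with | _ w =>
  obtain ⟨z, h, c, hc, hz⟩ := exists_ofBall _ (norm_lt w)
  change ofBall ((toQuat w.1).2 * (toQuat w.1).1⁻¹) = proj w
  rw [h]
  refine Quotient.sound (s := PsiHP1.setoid) ?_
  have hc' : (c : ℍ[ℝ]) ≠ 0 := by
    rw [← norm_pos_iff, norm_coe_complex]; exact norm_pos_iff.2 hc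
  have hp := fst_ne_zero w
  have e : toQuat w.1 = ((toQuat z.1).1 * ((c : ℍ[ℝ])⁻¹ * (toQuat w.1).1),
      (toQuat z.1).2 * ((c : ℍ[ℝ])⁻¹ * (toQuat w.1).1)) := by
    simp only [hz]
    rw [mul_assoc ((toQuat w.1).2 * _), mul_inv_cancel_left₀ hc', mul_assoc (toQuat w.1).2,
      inv_mul_cancel₀ hp, mul_one]
  refine ⟨(c : ℍ[ℝ])⁻¹ * (toQuat w.1).1, ?_, e⟩
  have h1 := normSq_of_psiSphere w
  have h2 := normSq_of_psiSphere z
  have h3 := congrArg (fun v => Quaternion.normSq v.1) e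
  have h4 := congrArg (fun v => Quaternion.normSq v.2) e
  simp only [map_mul (Quaternion.normSq) (toQuat z.1).1, map_mul (Quaternion.normSq) (toQuat z.1).2]
    at h3 h4
  have h5 : Quaternion.normSq ((c : ℍ[ℝ])⁻¹ * (toQuat w.1).1) = 1 := by
    rw [h3, h4, h2] at h1; linarith
  rw [Quaternion.normSq_eq_norm_mul_self] at h5
  nlinarith [norm_nonneg ((c : ℍ[ℝ])⁻¹ * (toQuat w.1).1)]

theorem continuous_twistorMap : Continuous twistorMap :=
  PsiP.isQuotientMap_proj.continuous_iff.2 isQuotientMap_proj.continuous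

theorem continuous_ballCoord : Continuous ballCoord := by
  rw [isQuotientMap_proj.continuous_iff]
  have h : ∀ z w : (Fin 4 → ℂ) → ℂ, Continuous z → Continuous w →
      Continuous fun v => quatOf (z v) (w v) := by
    intro z w hz hw
    have : Continuous fun c : ℂ => (c : ℍ[ℝ]) := continuous_coe_complex
    exact (this.comp hz).add (continuous_const.mul (this.comp hw))
  have h1 : Continuous fun z : PsiSphere ℂ => (toQuat z.1).1 :=
    (h _ _ (continuous_apply 0) (continuous_apply 1)).comp continuous_subtype_val
  have h2 : Continuous fun z : PsiSphere ℂ => (toQuat z.1).2 :=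
    (h _ _ (continuous_apply 2) (continuous_apply 3)).comp continuous_subtype_val
  exact h2.mul (h1.inv₀ fst_ne_zero)

/-- The ball model is a global chart with image the open unit ball. -/
def ballChart : OpenPartialHomeomorph PsiHP1 ℍ[ℝ] where
  toFun := ballCoord
  invFun := ofBall
  source := Set.univ
  target := Metric.ball 0 1
  map_source' := by
    intro y _
    induction y using Quotient.ind with | _ w =>
    exact mem_ball_zero_iff.2 (norm_lt w)
  map_target' := fun _ _ => Set.mem_univ _
  left_inv' := fun y _ => ofBall_ballCoord y
  right_inv' := fun x hx => ballCoord_ofBall x (mem_ball_zero_iff.1 hx)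
  open_source := isOpen_univ
  open_target := Metric.isOpen_ball
  continuousOn_toFun := continuous_ballCoord.continuousOn
  continuousOn_invFun := by
    refine continuous_twistorMap.comp_continuousOn (PsiP.continuousOn_mk.comp ?_ ?_)
    · exact (ofQuat.continuous.comp (by fun_prop)).continuousOn
    · intro x hx; exact psiQ_pos (mem_ball_zero_iff.1 hx)

instance : ChartedSpace ℍ[ℝ] PsiHP1 := ballChart.singletonChartedSpace rfl

instance : IsManifold 𝓘(ℝ, ℍ[ℝ]) ∞ PsiHP1 :=
  ballChart.isManifold_singleton (I := 𝓘(ℝ, ℍ[ℝ])) rfl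

end PsiHP1

/-! ### The nearly Calabi-Yau structure and the real points -/

/-- The metric `|dx|² / (1 - |x|²)²` of hyperbolic 4-space, in the ball model (curvature `-4`,
scalar curvature `-48`). -/
def hypMetric (y : PsiHP1) (v w : TangentSpace 𝓘(ℝ, ℍ[ℝ]) y) : ℝ :=
  @inner ℝ ℍ[ℝ] _ (mfderiv 𝓘(ℝ, ℍ[ℝ]) 𝓘(ℝ, ℍ[ℝ]) PsiHP1.ballCoord y v : ℍ[ℝ])
    (mfderiv 𝓘(ℝ, ℍ[ℝ]) 𝓘(ℝ, ℍ[ℝ]) PsiHP1.ballCoord y w : ℍ[ℝ]) /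
    (1 - ‖PsiHP1.ballCoord y‖ ^ 2) ^ 2

/-- The hyperbolic plane `H²`, as the unit disc of `ℂ`. -/
def HypPlane : TopologicalSpace.Opens ℂ := ⟨Metric.ball 0 1, Metric.isOpen_ball⟩

/-- The Poincaré metric `|dz|² / (1 - |z|²)²` of the hyperbolic plane (curvature `-4`). -/
def hypPlaneMetric (y : HypPlane) (v w : TangentSpace 𝓘(ℝ, ℂ) y) : ℝ :=
  @inner ℝ ℂ _ (mfderiv 𝓘(ℝ, ℂ) 𝓘(ℝ, ℂ) (Subtype.val : HypPlane → ℂ) y v : ℂ)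
    (mfderiv 𝓘(ℝ, ℂ) 𝓘(ℝ, ℂ) (Subtype.val : HypPlane → ℂ) y w : ℂ) /
    (1 - ‖(y : ℂ)‖ ^ 2) ^ 2

/-- The inclusion `H² ⊂ H⁴`, `a + i b ↦ a + j b` in the ball model. -/
def hypPlaneIncl (y : HypPlane) : PsiHP1 := PsiHP1.ofBall ⟨(y : ℂ).re, 0, (y : ℂ).im, 0⟩

/-- The section of `Ψ S⁷ → Ψ CP³` over `{z_i ≠ 0}` for which `z_i > 0`. -/
def PsiP.posSection (i : Fin 4) : PsiP ℂ → (Fin 4 → ℂ) :=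
  Quotient.lift (fun z : PsiSphere ℂ => ((‖z.1 i‖ : ℂ) / z.1 i) • z.1) (by
    rintro z w ⟨c, hc, h⟩
    have hc0 : c ≠ 0 := by rintro rfl; simp at hc
    by_cases hz : z.1 i = 0
    · simp [h, hz]
    · simp only [h, Pi.smul_apply, smul_eq_mul, norm_mul, hc, one_mul, smul_smul]
      congr 1; field_simp)

theorem PsiP.posSection_mem (x : PsiP ℂ) :
    PsiP.posSection (idx (chartIdx x)) x ∈ PsiSphere ℂ := by
  have hx := PsiP.mem_chart_source x
  generalize chartIdx x = b at *
  induction x using Quotient.ind with | _ z =>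
  have hz := (PsiP.proj_mem_affineSet (idx b) z).1 hx
  have h1 : psiQ z.1 = 1 := z.2
  change psiQ ((((‖z.1 (idx b)‖ : ℂ)) / z.1 (idx b)) • z.1) = 1
  rw [psiQ_smul, h1, norm_div, Complex.norm_real, norm_norm, div_self (norm_ne_zero_iff.2 hz)]
  simp

/-- The coframe `(ω₁, ω₂, ω₃)` of `Ψ CP³` at `x`: the pullback of the forms `ω_k` on `𝔉` by the
local section `y ↦ (e₁, e₂)` of `𝔉 → Ψ CP³` in which `e₁` is the local section of `Ψ S⁷ → Ψ CP³`
with positive coordinate `z_0` (or `z_1` if `z_0` vanishes at `x`). Another section changes it by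
an element of `SU(3)`, so that the metric and the forms below do not depend on it. -/
def psiCoframe (x : PsiP ℂ) : TangentSpace 𝓘(ℝ, Fin 3 → ℂ) x →L[ℝ] (Fin 3 → ℂ) :=
  (PsiFrame.ofSphere ⟨_, PsiP.posSection_mem x⟩).omega ∘L
    mfderiv 𝓘(ℝ, Fin 3 → ℂ) 𝓘(ℝ, ℍ[ℝ] × ℍ[ℝ])
      (fun y => toQuat (PsiP.posSection (PsiP.idx (PsiP.chartIdx x)) y)) x

/-- The metric `|ω₁|² + |ω₂|² + |ω₃|²` of `Ψ CP³`. -/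
def psiMetric (x : PsiP ℂ) (v w : TangentSpace 𝓘(ℝ, Fin 3 → ℂ) x) : ℝ :=
  stdMetric (psiCoframe x v) (psiCoframe x w)

/-- The form `Ω = (i/2) ∑ ω_k ∧ ω̄_k` on `Ψ CP³`. -/
def psiKahler : DiffForm (Fin 3 → ℂ) (PsiP ℂ) ℝ 2 := fun x =>
  stdKahler.compContinuousLinearMap (psiCoframe x)

/-- The form `Ψ = ω₁ ∧ ω₂ ∧ ω₃` on `Ψ CP³`. -/
def psiVolume : DiffForm (Fin 3 → ℂ) (PsiP ℂ) ℂ 3 := fun x =>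
  stdVolume.compContinuousLinearMap (psiCoframe x)

/-- The map `𝔉 → Ψ CP³`, `(e₁, e₂) ↦ e₁ S¹`. -/
def PsiFrame.proj (f : PsiFrame) : PsiP ℂ := PsiP.mk (ofQuat f.e₁)

/-- The differential of `e₁ ↦ [e₁]` (extended to the open cone `⟨e₁, e₁⟩ > 0` by scaling) at the
frame `f`. -/
def PsiFrame.dproj (f : PsiFrame) :
    (ℍ[ℝ] × ℍ[ℝ]) →L[ℝ] TangentSpace 𝓘(ℝ, Fin 3 → ℂ) f.proj :=
  mfderiv 𝓘(ℝ, ℍ[ℝ] × ℍ[ℝ]) 𝓘(ℝ, Fin 3 → ℂ) (fun v => PsiP.mk (ofQuat v)) f.e₁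

/-- The automorphism `C (z + j w) = z̄ + j w̄` of the quaternions. -/
def quatC (q : ℍ[ℝ]) : ℍ[ℝ] := quatOf (conj (quatZ q)) (conj (quatW q))

theorem ofQuat_quatC (z : Fin 4 → ℂ) :
    ofQuat (quatC (toQuat z).1, quatC (toQuat z).2) = fun k => conj (z k) := by
  have h1 : ∀ a b, quatZ (quatOf a b) = a := fun a b => by
    apply Complex.ext <;> simp [quatZ, quatOf_re, quatOf_imI]
  have h2 : ∀ a b, quatW (quatOf a b) = b := fun a b => by
    apply Complex.ext <;> simp [quatW, quatOf_imJ, quatOf_imK]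
  funext k
  fin_cases k <;> simp [ofQuat, quatC, toQuat, h1, h2]

/-- The involution `c [p, q] = [C p, C q]` of `Ψ CP³`. -/
def psiInvolution : PsiP ℂ → PsiP ℂ :=
  Quotient.map' (s₁ := PsiP.setoid ℂ) (s₂ := PsiP.setoid ℂ)
    (fun z => ⟨ofQuat (quatC (toQuat z.1).1, quatC (toQuat z.1).2), by
      have h : psiQ z.1 = 1 := z.2
      rw [ofQuat_quatC]
      simpa [PsiSphere, psiQ] using h⟩) (by
    rintro z w ⟨c, hc, h⟩
    refine ⟨conj c, by simpa using hc, ?_⟩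
    funext k
    simp [ofQuat_quatC, h])

/-- The inclusion `Ψ RP³ → Ψ CP³`, `[x] ↦ [x]`. -/
def psiRealIncl : PsiP ℝ → PsiP ℂ :=
  Quotient.map' (s₁ := PsiP.setoid ℝ) (s₂ := PsiP.setoid ℂ)
    (fun x => ⟨fun k => (x.1 k : ℂ), by
      have h : psiQ x.1 = 1 := x.2
      simpa [PsiSphere, psiQ] using h⟩) (by
    rintro z w ⟨c, hc, h⟩
    refine ⟨(c : ℂ), by simpa using hc, ?_⟩
    funext k
    simp [h])

/-- The complex structures of `ℍ` that are orthogonal and induce the orientation of the real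
coordinates of `(z, w)`, `q = z + j w`. The ball model identifies every tangent space of `H⁴`,
conformally, with `ℍ`, so these are also the positive orthogonal complex structures of the tangent
spaces of `H⁴`. -/
structure IsOrthComplexStructure (J : ℍ[ℝ] →L[ℝ] ℍ[ℝ]) : Prop where
  sq : ∀ ξ, J (J ξ) = -ξ
  norm_map : ∀ ξ, ‖J ξ‖ = ‖ξ‖
  oriented : ∀ ξ η, 0 ≤ Matrix.det (Matrix.of fun i : Fin 4 =>
    (fun q : ℍ[ℝ] => ![q.re, q.imI, q.imJ, -q.imK]) (![ξ, J ξ, η, J η] i))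

/-- `J` is the complex structure that the point `[e₁]` of `Ψ CP³` induces on the tangent space of
`H⁴` at its image (in the ball model), for which `ω₁` and `ω₂` are complex linear. -/
def PsiFrame.IsTwistorStructure (f : PsiFrame) (J : ℍ[ℝ] →L[ℝ] ℍ[ℝ]) : Prop :=
  ∀ v v' : ℍ[ℝ] × ℍ[ℝ], f.omega v' 0 = Complex.I * f.omega v 0 →
    f.omega v' 1 = Complex.I * f.omega v 1 →
    fderiv ℝ (fun e => PsiHP1.ballCoord (twistorMap (PsiP.mk (ofQuat e)))) f.e₁ v' =
      J (fderiv ℝ (fun e => PsiHP1.ballCoord (twistorMap (PsiP.mk (ofQuat e)))) f.e₁ v)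
end

/-!
Everything on `Ψ CP³` is computed on the open cone `{psiQ > 0}` of `ℂ⁴`. The quotient map
`PsiP.mk` has local smooth sections there (`PsiP.exists_section`), so its differential `PsiP.dmk`
is onto, and smoothness of maps and values of tensors can be read off on the cone. Write
`⟨z, w⟩ = h + j s` with the Hermitian form `h = psiHerm` and the complex symplectic form
`s = psiSymp`. Expanding the quaternionic form in a frame expresses `ω̄₁ ω₁ + ω̄₂ ω₂`, `ω₁ ∧ ω₂`
and `ω₃` through the values of `h` and `s` on `e₁` and the two tangent vectors, without `e₂`.
Hence the metric, `Ω` and `Ψ` become the explicit tensors `coneMetric`, `coneKahler` and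
`coneVolume` (`psiMetric_mk`, `psiKahler_mk`, `psiVolume_mk`), which gives the pullback formulas.
In these terms `dΩ = 0` and `d(Im Ψ) = 0` are polynomial identities in the values of `h`, `s` and
`1 / psiQ` (`coneHermDeriv_cyclic_im`, `coneVolumeDeriv_cyclic_im`).

Complex conjugation of `ℂ⁴` conjugates `h` and `s`, so it takes `Ω` to `-Ω` and `Ψ` to its
conjugate. On real points this makes `Ω` and `Im Ψ` vanish; an orthonormal basis of a tangent
space of `Ψ RP³` is then a unitary basis, on which `|Ψ| = 1` (`normSq_det_of_orthonormal`), so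
`Re Ψ = ±1`.

In the ball model the twistor map is `coneBall (p, q) = q p⁻¹`. For a frame with `e₁ = (p, q)` and
`e₂ = (p', q')` its differential takes `e₁ a + e₂ b` to a positive multiple of `q' b p⁻¹`
(`PsiFrame.fderiv_coneBall_combo`). Taking norms gives the metric of `H⁴`, and replacing `b` by
`b i` shows that the induced complex structure is right multiplication by the imaginary unit
`p i p⁻¹`. Conversely every orthogonal complex structure with the given orientation is right
multiplication by an imaginary unit (`IsOrthComplexStructure.eq_rightMul`), every imaginary unit
is conjugate to `i` (`exists_conj_I`), and `q p⁻¹` and `p i p⁻¹` determine `[p, q]` because only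
complex numbers commute with `i`; this identifies the fibres (`existsUnique_twistor`).

For completeness, the function `-½ log (1 - |y|²)` on the ball has differential bounded by the
hyperbolic length, so its pullback `realHeight` to `Ψ RP³` is `1`-Lipschitz. The tail of a Cauchy
sequence therefore lifts to a compact part of `Ψ S³` (`isCompact_psiSphere_le`), and a convergent
subsequence of lifts converges for the induced distance (`tendsto_inducedEDist_mk`).

With `P = x₀ + i x₁` and `Q = x₂ + i x₃`, the twistor map on `Ψ RP³` is `[x] ↦ Q / P`, and
`[x] ↦ (Q / P, P / P̄)` is a global trivialization of the circle bundle over `H²` (`bundleMap`).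
Its inverse is smooth because `θ = P / P̄` is solved locally by a `P` that is affine in `θ`
(`exists_linear_root`).
-/

noncomputable section

/-! ### The Hermitian and symplectic parts of the quaternionic form -/

/-- The indefinite Hermitian form on `ℂ⁴`: the complex part of `⟨·, ·⟩`. -/
def psiHerm (z w : Fin 4 → ℂ) : ℂ :=
  conj (z 0) * w 0 + conj (z 1) * w 1 - conj (z 2) * w 2 - conj (z 3) * w 3

/-- The complex symplectic form on `ℂ⁴`: the coefficient of `j` in `⟨·, ·⟩`. -/
def psiSymp (z w : Fin 4 → ℂ) : ℂ := z 0 * w 1 - z 1 * w 0 - (z 2 * w 3 - z 3 * w 2)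

theorem quatZ_quatOf (z w : ℂ) : quatZ (quatOf z w) = z := by
  apply Complex.ext <;> simp [quatZ, quatOf_re, quatOf_imI]

theorem quatW_quatOf (z w : ℂ) : quatW (quatOf z w) = w := by
  apply Complex.ext <;> simp [quatW, quatOf_imJ, quatOf_imK]

theorem quatZ_star_mul (a b : ℍ[ℝ]) :
    quatZ (star a * b) = conj (quatZ a) * quatZ b + conj (quatW a) * quatW b := by
  apply Complex.ext <;> simp [quatZ, quatW] <;> ring

theorem quatW_star_mul (a b : ℍ[ℝ]) :
    quatW (star a * b) = quatZ a * quatW b - quatW a * quatZ b := by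
  apply Complex.ext <;> simp [quatZ, quatW] <;> ring

theorem quatZ_quatForm (v w : ℍ[ℝ] × ℍ[ℝ]) :
    quatZ (quatForm v w) = psiHerm (ofQuat v) (ofQuat w) := by
  simp only [quatForm, map_sub, quatZ_star_mul, psiHerm, ofQuat]
  simp [ContinuousLinearMap.pi_apply]; ring

theorem quatW_quatForm (v w : ℍ[ℝ] × ℍ[ℝ]) :
    quatW (quatForm v w) = psiSymp (ofQuat v) (ofQuat w) := by
  simp only [quatForm, map_sub, quatW_star_mul, psiSymp, ofQuat]
  simp [ContinuousLinearMap.pi_apply]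

theorem psiHerm_self (z : Fin 4 → ℂ) : psiHerm z z = psiQ z := by
  simp only [psiHerm, psiQ, ← Complex.normSq_eq_norm_sq]
  push_cast
  simp only [Complex.normSq_eq_conj_mul_self]

theorem psiSymp_self (z : Fin 4 → ℂ) : psiSymp z z = 0 := by simp only [psiSymp]; ring

theorem psiHerm_conj (z w : Fin 4 → ℂ) : conj (psiHerm z w) = psiHerm w z := by
  simp only [psiHerm, map_add, map_sub, map_mul, Complex.conj_conj]; ring

theorem psiSymp_swap (z w : Fin 4 → ℂ) : psiSymp z w = -psiSymp w z := by
  simp only [psiSymp]; ring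

theorem psiHerm_add_right (z v w : Fin 4 → ℂ) :
    psiHerm z (v + w) = psiHerm z v + psiHerm z w := by
  simp only [psiHerm, Pi.add_apply]; ring

theorem psiHerm_add_left (z v w : Fin 4 → ℂ) :
    psiHerm (v + w) z = psiHerm v z + psiHerm w z := by
  simp only [psiHerm, Pi.add_apply, map_add]; ring

theorem psiHerm_smul_right (c : ℂ) (z v : Fin 4 → ℂ) : psiHerm z (c • v) = c * psiHerm z v := by
  simp only [psiHerm, Pi.smul_apply, smul_eq_mul]; ring

theorem psiHerm_smul_left (c : ℂ) (z v : Fin 4 → ℂ) :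
    psiHerm (c • z) v = conj c * psiHerm z v := by
  simp only [psiHerm, Pi.smul_apply, smul_eq_mul, map_mul]; ring

theorem psiSymp_add_right (z v w : Fin 4 → ℂ) :
    psiSymp z (v + w) = psiSymp z v + psiSymp z w := by
  simp only [psiSymp, Pi.add_apply]; ring

theorem psiSymp_add_left (z v w : Fin 4 → ℂ) :
    psiSymp (v + w) z = psiSymp v z + psiSymp w z := by
  simp only [psiSymp, Pi.add_apply]; ring

theorem psiSymp_smul_right (c : ℂ) (z v : Fin 4 → ℂ) : psiSymp z (c • v) = c * psiSymp z v := by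
  simp only [psiSymp, Pi.smul_apply, smul_eq_mul]; ring

theorem psiSymp_smul_left (c : ℂ) (z v : Fin 4 → ℂ) : psiSymp (c • z) v = c * psiSymp z v := by
  simp only [psiSymp, Pi.smul_apply, smul_eq_mul]; ring

/-! ### Frames -/

namespace PsiFrame

variable (f : PsiFrame)

theorem quatForm_star (v w : ℍ[ℝ] × ℍ[ℝ]) : star (quatForm v w) = quatForm w v := by
  simp [quatForm]

theorem form₂₁ : quatForm f.e₂ f.e₁ = 0 := by rw [← quatForm_star, f.form₁₂, star_zero]

/-- The vector `e₁ a + e₂ b`. -/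
def combo (a b : ℍ[ℝ]) : ℍ[ℝ] × ℍ[ℝ] :=
  (f.e₁.1 * a + f.e₂.1 * b, f.e₁.2 * a + f.e₂.2 * b)

theorem quatForm_combo (v : ℍ[ℝ] × ℍ[ℝ]) (a b : ℍ[ℝ]) :
    quatForm v (f.combo a b) = quatForm v f.e₁ * a + quatForm v f.e₂ * b := by
  simp only [quatForm, combo, mul_add, sub_mul, mul_assoc]; abel

theorem quatForm_e₁_combo (a b : ℍ[ℝ]) : quatForm f.e₁ (f.combo a b) = a := by
  rw [quatForm_combo, f.form₁₁, f.form₁₂]; simp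

theorem quatForm_e₂_combo (a b : ℍ[ℝ]) : quatForm f.e₂ (f.combo a b) = -b := by
  rw [quatForm_combo, f.form₂₁, f.form₂₂]; simp

/-- A frame is a basis of `ℍ²` over `ℍ`: the map `(a, b) ↦ e₁ a + e₂ b` of real vector spaces of
dimension 8 has a left inverse, given by the pairings with `e₁` and `e₂`. -/
theorem exists_combo (v : ℍ[ℝ] × ℍ[ℝ]) : ∃ a b, v = f.combo a b := by
  let L : (ℍ[ℝ] × ℍ[ℝ]) →ₗ[ℝ] (ℍ[ℝ] × ℍ[ℝ]) :=
    { toFun := fun x => f.combo x.1 x.2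
      map_add' := fun x y => by
        simp only [combo, Prod.fst_add, Prod.snd_add, mul_add, Prod.mk_add_mk]
        congr 1 <;> abel
      map_smul' := fun c x => by simp [combo] }
  have hinj : Function.Injective L := by
    intro x y h
    have h1 := congrArg (quatForm f.e₁) h
    have h2 := congrArg (quatForm f.e₂) h
    change quatForm f.e₁ (f.combo _ _) = quatForm f.e₁ (f.combo _ _) at h1
    change quatForm f.e₂ (f.combo _ _) = quatForm f.e₂ (f.combo _ _) at h2
    rw [quatForm_e₁_combo, quatForm_e₁_combo] at h1
    rw [quatForm_e₂_combo, quatForm_e₂_combo, neg_inj] at h2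
    exact Prod.ext h1 h2
  obtain ⟨x, hx⟩ := LinearMap.injective_iff_surjective.1 hinj v
  exact ⟨x.1, x.2, hx.symm⟩

/-- The expansion of the quaternionic form in the frame. -/
theorem quatForm_eq (v w : ℍ[ℝ] × ℍ[ℝ]) :
    quatForm v w = star (quatForm f.e₁ v) * quatForm f.e₁ w -
      star (quatForm f.e₂ v) * quatForm f.e₂ w := by
  obtain ⟨a, b, rfl⟩ := f.exists_combo w
  rw [quatForm_combo, quatForm_e₁_combo, quatForm_e₂_combo, quatForm_star, quatForm_star]
  simp

theorem omega_zero (v : ℍ[ℝ] × ℍ[ℝ]) : f.omega v 0 = quatZ (-quatForm f.e₂ v) := rfl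

theorem omega_one (v : ℍ[ℝ] × ℍ[ℝ]) : f.omega v 1 = quatW (-quatForm f.e₂ v) := rfl

theorem omega_two (v : ℍ[ℝ] × ℍ[ℝ]) : f.omega v 2 = conj (quatW (quatForm f.e₁ v)) := rfl

theorem omega_combo (a b : ℍ[ℝ]) :
    f.omega (f.combo a b) = ![quatZ b, quatW b, conj (quatW a)] := by
  funext k
  fin_cases k
  · simp [omega_zero, quatForm_e₂_combo]
  · simp [omega_one, quatForm_e₂_combo]
  · simp [omega_two, quatForm_e₁_combo]

theorem omega_surjective : Function.Surjective f.omega := by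
  intro u
  refine ⟨f.combo (quatOf 0 (conj (u 2))) (quatOf (u 0) (u 1)), ?_⟩
  rw [omega_combo]
  funext k
  fin_cases k <;> simp [quatZ_quatOf, quatW_quatOf]

theorem psiQ_ofQuat_e₁ : psiQ (ofQuat f.e₁) = 1 := by
  have h := quatForm_toQuat_self (ofQuat f.e₁)
  rw [toQuat_ofQuat, f.form₁₁] at h
  exact (Quaternion.coe_inj.1 (Quaternion.coe_one.trans h)).symm

/-- The Hermitian form `ω̄₁ ω₁' + ω̄₂ ω₂'` of the horizontal part, in terms of `e₁` alone: the
complex part of the expansion of `⟨v, w⟩`. -/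
theorem conj_omega_mul (v w : ℍ[ℝ] × ℍ[ℝ]) :
    conj (f.omega v 0) * f.omega w 0 + conj (f.omega v 1) * f.omega w 1 =
      conj (psiHerm (ofQuat f.e₁) (ofQuat v)) * psiHerm (ofQuat f.e₁) (ofQuat w) +
      conj (psiSymp (ofQuat f.e₁) (ofQuat v)) * psiSymp (ofQuat f.e₁) (ofQuat w) -
      psiHerm (ofQuat v) (ofQuat w) := by
  rw [← quatZ_quatForm v w, f.quatForm_eq v w, map_sub, quatZ_star_mul, quatZ_star_mul,
    omega_zero, omega_zero, omega_one, omega_one, quatZ_quatForm f.e₁, quatW_quatForm f.e₁,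
    quatZ_quatForm f.e₁, quatW_quatForm f.e₁]
  simp only [map_neg]
  ring

/-- The form `ω₁ ∧ ω₂` in terms of `e₁` alone: the `j`-part of the expansion of `⟨v, w⟩`. -/
theorem omega_mul_sub (v w : ℍ[ℝ] × ℍ[ℝ]) :
    f.omega v 0 * f.omega w 1 - f.omega v 1 * f.omega w 0 =
      psiHerm (ofQuat f.e₁) (ofQuat v) * psiSymp (ofQuat f.e₁) (ofQuat w) -
      psiSymp (ofQuat f.e₁) (ofQuat v) * psiHerm (ofQuat f.e₁) (ofQuat w) -
      psiSymp (ofQuat v) (ofQuat w) := by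
  rw [← quatW_quatForm v w, f.quatForm_eq v w, map_sub, quatW_star_mul, quatW_star_mul,
    omega_zero, omega_zero, omega_one, omega_one, quatZ_quatForm f.e₁, quatW_quatForm f.e₁,
    quatZ_quatForm f.e₁, quatW_quatForm f.e₁]
  simp only [map_neg]
  ring

theorem omega_two_eq (v : ℍ[ℝ] × ℍ[ℝ]) :
    f.omega v 2 = conj (psiSymp (ofQuat f.e₁) (ofQuat v)) := by
  rw [omega_two, quatW_quatForm]

end PsiFrame

/-! ### The tensors on the cone -/

/-- The Hermitian form `ω̄₁ ω₁' + ω̄₂ ω₂' - ω̄₃' ω₃` (complex linear in the standard complex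
structure of `ℂ⁴`), pulled back to the cone `{psiQ > 0}` of `ℂ⁴`. -/
def coneHerm (z v w : Fin 4 → ℂ) : ℂ :=
  conj (psiHerm z v) * psiHerm z w * ((psiQ z)⁻¹ : ℝ) ^ 2 - psiHerm v w * ((psiQ z)⁻¹ : ℝ)

/-- The Hermitian square of `ω̄₃`, pulled back to the cone. -/
def coneVert (z v w : Fin 4 → ℂ) : ℂ :=
  conj (psiSymp z v) * psiSymp z w * ((psiQ z)⁻¹ : ℝ) ^ 2

/-- The form `ω₁ ∧ ω₂`, pulled back to the cone by a local section of `𝔉`. -/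
def coneBivolume (z v w : Fin 4 → ℂ) : ℂ :=
  (psiHerm z v * psiSymp z w - psiSymp z v * psiHerm z w) * ((psiQ z)⁻¹ : ℝ) ^ 2 -
    psiSymp v w * ((psiQ z)⁻¹ : ℝ)

/-- The metric of `Ψ CP³`, pulled back to the cone. -/
def coneMetric (z v w : Fin 4 → ℂ) : ℝ := (coneHerm z v w).re + 2 * (coneVert z v w).re

/-- The form `Ω` of `Ψ CP³`, pulled back to the cone. -/
def coneKahler (z v w : Fin 4 → ℂ) : ℝ := (coneHerm z v w).im

/-- The form `Ψ` of `Ψ CP³`, pulled back to the cone. -/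
def coneVolume (z u v w : Fin 4 → ℂ) : ℂ :=
  (coneBivolume z u v * conj (psiSymp z w) + coneBivolume z v w * conj (psiSymp z u) +
    coneBivolume z w u * conj (psiSymp z v)) * ((psiQ z)⁻¹ : ℝ)

/-! ### Invariance of the cone tensors -/

section Invariance

variable {z : Fin 4 → ℂ}

theorem ofReal_psiQ_mul_inv (hz : 0 < psiQ z) : (psiQ z : ℂ) * ((psiQ z)⁻¹ : ℝ) = 1 := by
  rw [← Complex.ofReal_mul, mul_inv_cancel₀ hz.ne', Complex.ofReal_one]

theorem psiHerm_right_self (v : Fin 4 → ℂ) : psiHerm v z = conj (psiHerm z v) :=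
  (psiHerm_conj z v).symm

/-- The cone tensors kill the radial direction `ℂ z`. -/
theorem coneHerm_add_smul (hz : 0 < psiQ z) (a b : ℂ) (v w : Fin 4 → ℂ) :
    coneHerm z (v + a • z) (w + b • z) = coneHerm z v w := by
  have h := ofReal_psiQ_mul_inv hz
  simp only [coneHerm, psiHerm_add_right, psiHerm_add_left, psiHerm_smul_right,
    psiHerm_smul_left, psiHerm_self, psiHerm_right_self (z := z) v, map_add, map_mul,
    Complex.conj_ofReal]
  generalize psiHerm z v = p, psiHerm z w = q, psiHerm v w = r at *
  generalize (((psiQ z)⁻¹ : ℝ) : ℂ) = m at *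
  linear_combination (conj p * b * m + conj a * q * m + conj a * b * m * psiQ z) * h

theorem psiSymp_self_add_smul (a : ℂ) (v : Fin 4 → ℂ) :
    psiSymp z (v + a • z) = psiSymp z v := by
  rw [psiSymp_add_right, psiSymp_smul_right, psiSymp_self]; simp

theorem coneVert_add_smul (a b : ℂ) (v w : Fin 4 → ℂ) :
    coneVert z (v + a • z) (w + b • z) = coneVert z v w := by
  simp only [coneVert, psiSymp_self_add_smul]

theorem coneBivolume_add_smul (hz : 0 < psiQ z) (a b : ℂ) (v w : Fin 4 → ℂ) :
    coneBivolume z (v + a • z) (w + b • z) = coneBivolume z v w := by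
  have h := ofReal_psiQ_mul_inv hz
  simp only [coneBivolume, psiSymp_self_add_smul]
  simp only [psiHerm_add_right, psiHerm_smul_right, psiHerm_self, psiSymp_add_right,
    psiSymp_add_left, psiSymp_smul_left, psiSymp_smul_right, psiSymp_self, psiSymp_swap v z]
  generalize (((psiQ z)⁻¹ : ℝ) : ℂ) = m at *
  linear_combination (a * psiSymp z w * m - b * psiSymp z v * m) * h

theorem inv_psiQ_smul (c : ℂ) (z : Fin 4 → ℂ) :
    (((psiQ (c • z))⁻¹ : ℝ) : ℂ) = ((psiQ z)⁻¹ : ℝ) * (c⁻¹ * conj c⁻¹) := by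
  rw [psiQ_smul, ← Complex.normSq_eq_norm_sq, mul_inv, mul_comm, Complex.mul_conj,
    Complex.normSq_inv]
  push_cast; rfl

theorem coneHerm_smul {c : ℂ} (hc : c ≠ 0) (v w : Fin 4 → ℂ) :
    coneHerm (c • z) (c • v) (c • w) = coneHerm z v w := by
  have hc' : conj c ≠ 0 := (map_ne_zero _).2 hc
  simp only [coneHerm, psiHerm_smul_right, psiHerm_smul_left, inv_psiQ_smul, map_mul, map_inv₀,
    Complex.conj_conj]
  field_simp

theorem coneVert_smul {c : ℂ} (hc : c ≠ 0) (v w : Fin 4 → ℂ) :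
    coneVert (c • z) (c • v) (c • w) = coneVert z v w := by
  have hc' : conj c ≠ 0 := (map_ne_zero _).2 hc
  simp only [coneVert, psiSymp_smul_right, psiSymp_smul_left, inv_psiQ_smul, map_mul,
    map_inv₀]
  field_simp

theorem coneBivolume_smul {c : ℂ} (hc : c ≠ 0) (v w : Fin 4 → ℂ) :
    coneBivolume (c • z) (c • v) (c • w) = (c * (conj c)⁻¹) * coneBivolume z v w := by
  have hc' : conj c ≠ 0 := (map_ne_zero _).2 hc
  simp only [coneBivolume, psiSymp_smul_right, psiSymp_smul_left, psiHerm_smul_right,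
    psiHerm_smul_left, inv_psiQ_smul, map_inv₀]
  field_simp

/-- The factor `c / c̄` of `coneBivolume` cancels that of `ω₃`, so that `Ψ` descends to `Ψ CP³`. -/
theorem coneVolume_smul {c : ℂ} (hc : c ≠ 0) (u v w : Fin 4 → ℂ) :
    coneVolume (c • z) (c • u) (c • v) (c • w) = coneVolume z u v w := by
  have hc' : conj c ≠ 0 := (map_ne_zero _).2 hc
  simp only [coneVolume, coneBivolume_smul hc, psiSymp_smul_right, psiSymp_smul_left,
    inv_psiQ_smul, map_mul, map_inv₀]
  field_simp

theorem coneVolume_add_smul (hz : 0 < psiQ z) (a b d : ℂ) (u v w : Fin 4 → ℂ) :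
    coneVolume z (u + a • z) (v + b • z) (w + d • z) = coneVolume z u v w := by
  simp only [coneVolume, coneBivolume_add_smul hz, psiSymp_self_add_smul]

end Invariance

/-! ### The cone tensors in a frame -/

section Pullback

variable (f : PsiFrame)

theorem PsiFrame.coneHerm_eq (v w : ℍ[ℝ] × ℍ[ℝ]) :
    coneHerm (ofQuat f.e₁) (ofQuat v) (ofQuat w) =
      conj (f.omega v 0) * f.omega w 0 + conj (f.omega v 1) * f.omega w 1 -
        conj (f.omega w 2) * f.omega v 2 := by
  rw [f.conj_omega_mul, coneHerm, f.psiQ_ofQuat_e₁, f.omega_two_eq, f.omega_two_eq]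
  simp only [inv_one, Complex.ofReal_one, Complex.conj_conj]
  ring

theorem PsiFrame.coneVert_eq (v w : ℍ[ℝ] × ℍ[ℝ]) :
    coneVert (ofQuat f.e₁) (ofQuat v) (ofQuat w) = f.omega v 2 * conj (f.omega w 2) := by
  rw [coneVert, f.psiQ_ofQuat_e₁, f.omega_two_eq, f.omega_two_eq]
  simp

theorem PsiFrame.stdMetric_omega (v w : ℍ[ℝ] × ℍ[ℝ]) :
    stdMetric (f.omega v) (f.omega w) = coneMetric (ofQuat f.e₁) (ofQuat v) (ofQuat w) := by
  rw [coneMetric, f.coneHerm_eq, f.coneVert_eq, stdMetric, Fin.sum_univ_three]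
  simp only [Complex.add_re, Complex.sub_re, Complex.mul_re, Complex.conj_re, Complex.conj_im]
  ring

theorem PsiFrame.stdKahler_omega (v : Fin 2 → ℍ[ℝ] × ℍ[ℝ]) :
    stdKahler (fun i => f.omega (v i)) =
      coneKahler (ofQuat f.e₁) (ofQuat (v 0)) (ofQuat (v 1)) := by
  rw [coneKahler, f.coneHerm_eq]
  change ∑ k, (conj (f.omega (v 0) k) * f.omega (v 1) k).im = _
  rw [Fin.sum_univ_three]
  simp only [Complex.add_im, Complex.sub_im, Complex.mul_im, Complex.conj_re, Complex.conj_im]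
  ring

theorem PsiFrame.stdVolume_omega (v : Fin 3 → ℍ[ℝ] × ℍ[ℝ]) :
    stdVolume (fun i => f.omega (v i)) =
      coneVolume (ofQuat f.e₁) (ofQuat (v 0)) (ofQuat (v 1)) (ofQuat (v 2)) := by
  have h : ∀ v w, coneBivolume (ofQuat f.e₁) (ofQuat v) (ofQuat w) =
      f.omega v 0 * f.omega w 1 - f.omega v 1 * f.omega w 0 := by
    intro v w
    rw [coneBivolume, f.psiQ_ofQuat_e₁, f.omega_mul_sub]
    simp
  rw [coneVolume, h, h, h, ← f.omega_two_eq, ← f.omega_two_eq, ← f.omega_two_eq,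
    f.psiQ_ofQuat_e₁]
  change Matrix.det (Matrix.of fun i => f.omega (v i)) = _
  rw [Matrix.det_fin_three]
  simp only [Matrix.of_apply, inv_one, Complex.ofReal_one]
  ring

end Pullback

/-! ### Calculus on the pseudo-projective spaces -/

namespace PsiP

variable {𝕜 : Type} [RCLike 𝕜]

variable (𝕜) in
/-- The open cone `{psiQ > 0}`. -/
def cone : Set (Fin 4 → 𝕜) := {z | 0 < psiQ z}

theorem isOpen_cone : IsOpen (cone 𝕜) := isOpen_lt continuous_const continuous_psiQ

theorem psiSphere_subset_cone {z : Fin 4 → 𝕜} (hz : z ∈ PsiSphere 𝕜) : z ∈ cone 𝕜 := by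
  have h : psiQ z = 1 := hz
  change 0 < psiQ z
  rw [h]; exact one_pos

theorem mk_eq_proj (z : PsiSphere 𝕜) : mk z.1 = proj z := by
  simpa using mk_smul z 1 one_ne_zero

theorem exists_mk (x : PsiP 𝕜) : ∃ z ∈ PsiSphere 𝕜, mk z = x := by
  induction x using Quotient.ind with | _ z =>
  exact ⟨z.1, z.2, mk_eq_proj z⟩

theorem mk_eq_mk_smul {z : Fin 4 → 𝕜} (hz : z ∈ cone 𝕜) {c : 𝕜} (hc : c ≠ 0) :
    mk (c • z) = mk z := by
  have hz' : psiQ z > 0 := hz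
  have h := normalize_mem z hz
  have hs : ((Real.sqrt (psiQ z) : ℝ) : 𝕜) ≠ 0 := by
    rw [Ne, RCLike.ofReal_eq_zero]; exact (Real.sqrt_pos.2 hz').ne'
  have e : z = ((Real.sqrt (psiQ z) : ℝ) : 𝕜) • ((((Real.sqrt (psiQ z))⁻¹ : ℝ) : 𝕜) • z) := by
    rw [smul_smul, RCLike.ofReal_inv, mul_inv_cancel₀ hs, one_smul]
  have h1 := mk_smul ⟨_, h⟩ (c * ((Real.sqrt (psiQ z) : ℝ) : 𝕜)) (mul_ne_zero hc hs)
  have h2 := mk_smul ⟨_, h⟩ ((Real.sqrt (psiQ z) : ℝ) : 𝕜) hs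
  simp only at h1 h2
  rw [mul_smul, ← e] at h1
  rw [← e] at h2
  rw [h1, h2]

theorem affinePt_mem_cone {b : Bool} {u : Fin 3 → 𝕜} (hu : u ∈ (chart 𝕜 b).target) :
    affinePt b u ∈ cone 𝕜 := hu

/-- The linear part of the affine map `affinePt b`. -/
def affineDir (b : Bool) : (Fin 3 → 𝕜) →L[ℝ] (Fin 4 → 𝕜) :=
  cond b (ContinuousLinearMap.pi ![.proj 0, 0, .proj 1, .proj 2])
    (ContinuousLinearMap.pi ![0, .proj 0, .proj 1, .proj 2])

theorem affinePt_eq (b : Bool) (u : Fin 3 → 𝕜) :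
    affinePt b u = affineDir b u + affinePt b 0 := by
  funext k
  cases b <;> fin_cases k <;> simp [affinePt, affineDir]

theorem hasFDerivAt_affinePt (b : Bool) (u : Fin 3 → 𝕜) :
    HasFDerivAt (𝕜 := ℝ) (affinePt b) (affineDir (𝕜 := 𝕜) b) u := by
  have : (affinePt (𝕜 := 𝕜) b) = fun u => affineDir b u + affinePt b 0 :=
    funext (affinePt_eq b)
  rw [this]
  exact (affineDir (𝕜 := 𝕜) b).hasFDerivAt.add_const _

theorem contDiff_affinePt (b : Bool) : ContDiff ℝ ∞ (affinePt (𝕜 := 𝕜) b) := by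
  have : (affinePt (𝕜 := 𝕜) b) = fun u => affineDir b u + affinePt b 0 :=
    funext (affinePt_eq b)
  rw [this]
  exact (affineDir (𝕜 := 𝕜) b).contDiff.add contDiff_const

theorem chart_mk (b : Bool) {z : Fin 4 → 𝕜} (hz : z ∈ cone 𝕜) :
    chart 𝕜 b (mk z) = ![z (idx !b) / z (idx b), z 2 / z (idx b), z 3 / z (idx b)] := by
  change ![ratio _ _ (mk z), ratio _ _ (mk z), ratio _ _ (mk z)] = _
  rw [ratio_mk _ _ _ hz, ratio_mk _ _ _ hz, ratio_mk _ _ _ hz]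

theorem mk_mem_source_iff (b : Bool) {z : Fin 4 → 𝕜} (hz : z ∈ cone 𝕜) :
    mk z ∈ (chart 𝕜 b).source ↔ z (idx b) ≠ 0 := by
  change ratio _ _ (mk z) ≠ 0 ↔ _
  rw [ratio_mk _ _ _ hz]
  simp

/-- The quotient map is smooth on the cone. -/
theorem contMDiffOn_mk :
    ContMDiffOn 𝓘(ℝ, Fin 4 → 𝕜) 𝓘(ℝ, Fin 3 → 𝕜) ∞ (mk (𝕜 := 𝕜)) (cone 𝕜) := by
  intro z hz
  refine ContMDiffAt.contMDiffWithinAt ?_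
  have hcont : ContinuousAt (mk (𝕜 := 𝕜)) z :=
    continuousOn_mk.continuousAt (isOpen_cone.mem_nhds hz)
  rw [contMDiffAt_iff_target]
  refine ⟨hcont, ?_⟩
  set b := chartIdx (mk z) with hb
  have hsrc : z (idx b) ≠ 0 := (mk_mem_source_iff b hz).1 (mem_chart_source _)
  have hev : (extChartAt 𝓘(ℝ, Fin 3 → 𝕜) (mk z) ∘ mk) =ᶠ[𝓝 z]
      fun w => ![w (idx !b) / w (idx b), w 2 / w (idx b), w 3 / w (idx b)] := by
    filter_upwards [isOpen_cone.mem_nhds hz] with w hw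
    exact chart_mk b hw
  refine ContMDiffAt.congr_of_eventuallyEq ?_ hev
  rw [contMDiffAt_iff_contDiffAt]
  have hp : ∀ k, ContDiffAt ℝ ∞ (fun w : Fin 4 → 𝕜 => w k) z := fun k => by fun_prop
  refine contDiffAt_pi.2 fun k => ?_
  have hi := (hp (idx b)).inv hsrc
  fin_cases k
  · exact ((hp (idx !b)).mul hi).congr_of_eventuallyEq
      (.of_forall fun w => by simp [div_eq_mul_inv])
  · exact (((hp 2).mul hi).congr_of_eventuallyEq (.of_forall fun w => by simp [div_eq_mul_inv]))
  · exact (((hp 3).mul hi).congr_of_eventuallyEq (.of_forall fun w => by simp [div_eq_mul_inv]))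

theorem mdifferentiableAt_mk {z : Fin 4 → 𝕜} (hz : z ∈ cone 𝕜) :
    MDifferentiableAt 𝓘(ℝ, Fin 4 → 𝕜) 𝓘(ℝ, Fin 3 → 𝕜) (mk (𝕜 := 𝕜)) z :=
  (contMDiffOn_mk.contMDiffAt (isOpen_cone.mem_nhds hz)).mdifferentiableAt (by simp)

variable {E' : Type*} [NormedAddCommGroup E'] [NormedSpace ℝ E'] {H' : Type*}
  [TopologicalSpace H'] {I' : ModelWithCorners ℝ E' H'} {M' : Type*} [TopologicalSpace M']
  [ChartedSpace H' M']

/-- Near `x`, the affine representative of a point is a smooth section of `mk`. -/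
theorem contMDiffAt_affinePt_chart (x : PsiP 𝕜) (b : Bool) (hx : x ∈ (chart 𝕜 b).source) :
    ContMDiffAt 𝓘(ℝ, Fin 3 → 𝕜) 𝓘(ℝ, Fin 4 → 𝕜) ∞ (fun y => affinePt b (chart 𝕜 b y)) x := by
  have h := contMDiffAt_of_mem_maximalAtlas (I := 𝓘(ℝ, Fin 3 → 𝕜)) (n := ∞)
    (IsManifold.subset_maximalAtlas (I := 𝓘(ℝ, Fin 3 → 𝕜)) (n := ∞)
      (show chart 𝕜 b ∈ atlas (Fin 3 → 𝕜) (PsiP 𝕜) from ⟨b, rfl⟩)) hx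
  exact ((contDiff_affinePt b).contMDiff.contMDiffAt).comp x h

theorem mk_affinePt_chart {x : PsiP 𝕜} {b : Bool} (hx : x ∈ (chart 𝕜 b).source) :
    mk (affinePt b (chart 𝕜 b x)) = x := (chart 𝕜 b).left_inv hx

/-- Local smooth sections of `mk` through every point of the cone. -/
theorem exists_section {z : Fin 4 → 𝕜} (hz : z ∈ cone 𝕜) : ∃ S : PsiP 𝕜 → (Fin 4 → 𝕜),
    S (mk z) = z ∧ ContMDiffAt 𝓘(ℝ, Fin 3 → 𝕜) 𝓘(ℝ, Fin 4 → 𝕜) ∞ S (mk z) ∧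
      ∀ᶠ y in 𝓝 (mk z), mk (S y) = y := by
  have hx := mem_chart_source (mk z)
  set b := chartIdx (mk z)
  have hzb : z (idx b) ≠ 0 := (mk_mem_source_iff b hz).1 hx
  refine ⟨fun y => z (idx b) • affinePt b (chart 𝕜 b y), ?_, ?_, ?_⟩
  · change z (idx b) • affinePt b (chart 𝕜 b (mk z)) = z
    rw [chart_mk b hz, smul_affinePt b z hzb, smul_smul, mul_inv_cancel₀ hzb, one_smul]
  · have h2 : ContDiff ℝ ∞ (fun y : Fin 4 → 𝕜 => z (idx b) • y) := by fun_prop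
    exact h2.contMDiff.contMDiffAt.comp (mk z) (contMDiffAt_affinePt_chart (mk z) b hx)
  · filter_upwards [(chart 𝕜 b).open_source.mem_nhds hx] with y hy
    rw [mk_eq_mk_smul (affinePt_mem_cone ((chart 𝕜 b).map_source hy)) hzb, mk_affinePt_chart hy]

theorem contMDiffAt_of_comp_mk {F : PsiP 𝕜 → M'} {z : Fin 4 → 𝕜} (hz : z ∈ cone 𝕜)
    (hF : ContMDiffAt 𝓘(ℝ, Fin 4 → 𝕜) I' ∞ (fun z => F (mk z)) z) :
    ContMDiffAt 𝓘(ℝ, Fin 3 → 𝕜) I' ∞ F (mk z) := by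
  obtain ⟨S, hSz, hS, hid⟩ := exists_section hz
  rw [← hSz] at hF
  refine (ContMDiffAt.comp (mk z) hF hS).congr_of_eventuallyEq ?_
  filter_upwards [hid] with y hy
  exact (congrArg F hy).symm

/-- A map on the quotient is smooth if its lift to the cone is. -/
theorem contMDiff_of_comp_mk {F : PsiP 𝕜 → M'}
    (hF : ContMDiffOn 𝓘(ℝ, Fin 4 → 𝕜) I' ∞ (fun z => F (mk z)) (cone 𝕜)) :
    ContMDiff 𝓘(ℝ, Fin 3 → 𝕜) I' ∞ F := by
  intro x
  obtain ⟨z, hz, rfl⟩ := exists_mk x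
  have hz := psiSphere_subset_cone hz
  exact contMDiffAt_of_comp_mk hz (hF.contMDiffAt (isOpen_cone.mem_nhds hz))

/-- The differential of the quotient map on the cone. -/
def dmk (z : Fin 4 → 𝕜) : (Fin 4 → 𝕜) →L[ℝ] TangentSpace 𝓘(ℝ, Fin 3 → 𝕜) (mk z) :=
  mfderiv 𝓘(ℝ, Fin 4 → 𝕜) 𝓘(ℝ, Fin 3 → 𝕜) mk z

theorem mfderiv_comp_mk {F : PsiP 𝕜 → M'} {z : Fin 4 → 𝕜} (hz : z ∈ cone 𝕜)
    (hF : MDifferentiableAt 𝓘(ℝ, Fin 3 → 𝕜) I' F (mk z)) (v : Fin 4 → 𝕜) :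
    mfderiv 𝓘(ℝ, Fin 3 → 𝕜) I' F (mk z) (dmk z v) =
      mfderiv 𝓘(ℝ, Fin 4 → 𝕜) I' (fun w => F (mk w)) z v := by
  have h := mfderiv_comp z hF (mdifferentiableAt_mk hz)
  exact (DFunLike.congr_fun h v).symm

theorem mfderiv_mk_comp {E : Type*} [NormedAddCommGroup E] [NormedSpace ℝ E] {φ : E → Fin 4 → 𝕜}
    {φ' : E →L[ℝ] (Fin 4 → 𝕜)} {x : E} (hφ : HasFDerivAt φ φ' x) (hx : φ x ∈ cone 𝕜) (v : E) :
    mfderiv 𝓘(ℝ, E) 𝓘(ℝ, Fin 3 → 𝕜) (fun y => mk (φ y)) x v = dmk (φ x) (φ' v) := by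
  have h := mfderiv_comp x (mdifferentiableAt_mk hx) hφ.hasMFDerivAt.mdifferentiableAt
  rw [hφ.hasMFDerivAt.mfderiv] at h
  exact DFunLike.congr_fun h v

/-- The quotient map is a submersion, since it has local sections. -/
theorem dmk_surjective {z : Fin 4 → 𝕜} (hz : z ∈ cone 𝕜) : Function.Surjective (dmk z) := by
  intro w
  obtain ⟨S, hSz, hS, hid⟩ := exists_section hz
  have hmd : MDifferentiableAt 𝓘(ℝ, Fin 4 → 𝕜) 𝓘(ℝ, Fin 3 → 𝕜) (mk (𝕜 := 𝕜)) (S (mk z)) := by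
    rw [hSz]; exact mdifferentiableAt_mk hz
  have h := mfderiv_comp (mk z) hmd (hS.mdifferentiableAt (by simp))
  have hid' : (fun y => mk (S y)) =ᶠ[𝓝 (mk z)] id := hid
  have h' := (hid'.mfderiv_eq (I := 𝓘(ℝ, Fin 3 → 𝕜)) (I' := 𝓘(ℝ, Fin 3 → 𝕜)))
  have key : (mfderiv 𝓘(ℝ, Fin 4 → 𝕜) 𝓘(ℝ, Fin 3 → 𝕜) (mk (𝕜 := 𝕜)) (S (mk z)))
      (mfderiv 𝓘(ℝ, Fin 3 → 𝕜) 𝓘(ℝ, Fin 4 → 𝕜) S (mk z) w) = w := by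
    have h2 := DFunLike.congr_fun (h.symm.trans h') w
    rw [mfderiv_id] at h2
    exact h2
  refine ⟨mfderiv 𝓘(ℝ, Fin 3 → 𝕜) 𝓘(ℝ, Fin 4 → 𝕜) S (mk z) w, ?_⟩
  have : ∀ z' : Fin 4 → 𝕜, z' = z → ∀ v : Fin 4 → 𝕜,
      (mfderiv 𝓘(ℝ, Fin 4 → 𝕜) 𝓘(ℝ, Fin 3 → 𝕜) (mk (𝕜 := 𝕜)) z' v : Fin 3 → 𝕜) =
        (dmk z v : Fin 3 → 𝕜) := by
    rintro z' rfl v; rfl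
  exact (this _ hSz _).symm.trans key

end PsiP

/-- The coordinate expression of a form in an affine chart, whose inverse is the affine
representative followed by the quotient map. -/
theorem DiffForm.inChart_apply {𝕜 : Type} [RCLike 𝕜] {F : Type} [NormedAddCommGroup F]
    [NormedSpace ℝ F] {k : ℕ} (α : DiffForm (Fin 3 → 𝕜) (PsiP 𝕜) F k) (x₀ : PsiP 𝕜)
    {u : Fin 3 → 𝕜} (hu : u ∈ (chartAt (Fin 3 → 𝕜) x₀).target) (v : Fin k → Fin 3 → 𝕜) :
    α.inChart x₀ u v = α (PsiP.mk (PsiP.affinePt (PsiP.chartIdx x₀) u)) (fun i =>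
      PsiP.dmk (PsiP.affinePt (PsiP.chartIdx x₀) u)
        (PsiP.affineDir (PsiP.chartIdx x₀) (v i))) := by
  have h := fun w : Fin 3 → 𝕜 => PsiP.mfderiv_mk_comp
    (PsiP.hasFDerivAt_affinePt (PsiP.chartIdx x₀) u) hu w
  change α (PsiP.mk (PsiP.affinePt (PsiP.chartIdx x₀) u)) (fun i =>
    mfderiv 𝓘(ℝ, Fin 3 → 𝕜) 𝓘(ℝ, Fin 3 → 𝕜)
      (fun y => PsiP.mk (PsiP.affinePt (PsiP.chartIdx x₀) y)) u (v i)) = _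
  exact congrArg _ (funext fun i => h (v i))

/-! ### The structure of `Ψ CP³` on the cone -/

/-- `toQuat` as a continuous linear map. -/
def toQuatL : (Fin 4 → ℂ) →L[ℝ] ℍ[ℝ] × ℍ[ℝ] := LinearMap.toContinuousLinearMap
  { toFun := toQuat
    map_add' := fun z w => by
      ext <;> simp [toQuat, quatOf_re, quatOf_imI, quatOf_imJ, quatOf_imK] <;> ring
    map_smul' := fun c z => by
      ext <;> simp [toQuat, quatOf_re, quatOf_imI, quatOf_imJ, quatOf_imK] }

theorem toQuatL_apply (z : Fin 4 → ℂ) : toQuatL z = toQuat z := rfl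

namespace PsiP

theorem contDiff_psiQ : ContDiff ℝ ∞ (psiQ (𝕜 := ℂ)) := by
  have : (psiQ (𝕜 := ℂ)) = fun z => (psiHerm z z).re := by
    funext z; rw [psiHerm_self, Complex.ofReal_re]
  rw [this]
  have h : ∀ k, ContDiff ℝ ∞ fun z : Fin 4 → ℂ => z k := fun k => by fun_prop
  have h' : ∀ k, ContDiff ℝ ∞ fun z : Fin 4 → ℂ => conj (z k) := fun k =>
    Complex.conjCLE.contDiff.comp (h k)
  have h'' : ContDiff ℝ ∞ fun z : Fin 4 → ℂ => psiHerm z z :=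
    ((((h' 0).mul (h 0)).add ((h' 1).mul (h 1))).sub ((h' 2).mul (h 2))).sub ((h' 3).mul (h 3))
  exact Complex.reCLM.contDiff.comp h''

/-- The factor `|z_i| / (z_i √(psiQ z))` that makes a vector of the cone the value of
`posSection i`. -/
def posFactor (i : Fin 4) (z : Fin 4 → ℂ) : ℂ := (‖z i‖ : ℂ) / z i * ((Real.sqrt (psiQ z))⁻¹ : ℝ)

theorem posSection_mk (i : Fin 4) {z : Fin 4 → ℂ} (hz : z ∈ cone ℂ) :
    posSection i (mk z) = posFactor i z • z := by
  have hs : 0 < Real.sqrt (psiQ z) := Real.sqrt_pos.2 hz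
  rw [mk_of_pos z hz]
  change ((‖((((Real.sqrt (psiQ z))⁻¹ : ℝ) : ℂ) • z) i‖ : ℂ) /
    ((((Real.sqrt (psiQ z))⁻¹ : ℝ) : ℂ) • z) i) • ((((Real.sqrt (psiQ z))⁻¹ : ℝ) : ℂ) • z) = _
  rw [smul_smul, posFactor]
  congr 2
  rw [Pi.smul_apply, smul_eq_mul, norm_mul, Complex.norm_real, norm_inv,
    Real.norm_of_nonneg hs.le]
  push_cast
  rw [mul_div_mul_left]
  exact inv_ne_zero (Complex.ofReal_ne_zero.2 hs.ne')

theorem posFactor_ne_zero {i : Fin 4} {z : Fin 4 → ℂ} (hz : z ∈ cone ℂ) (hi : z i ≠ 0) :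
    posFactor i z ≠ 0 :=
  mul_ne_zero (div_ne_zero (Complex.ofReal_ne_zero.2 (norm_ne_zero_iff.2 hi)) hi)
    (Complex.ofReal_ne_zero.2 (inv_ne_zero (Real.sqrt_pos.2 hz).ne'))

theorem contDiffAt_posFactor {i : Fin 4} {z : Fin 4 → ℂ} (hz : z ∈ cone ℂ) (hi : z i ≠ 0) :
    ContDiffAt ℝ ∞ (posFactor i) z := by
  have h1 : ContDiffAt ℝ ∞ (fun z : Fin 4 → ℂ => z i) z := by fun_prop
  have h2 : ContDiffAt ℝ ∞ (fun z : Fin 4 → ℂ => (‖z i‖ : ℂ)) z :=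
    Complex.ofRealCLM.contDiff.contDiffAt.comp z (h1.norm ℝ hi)
  have h3 : ContDiffAt ℝ ∞ (fun z : Fin 4 → ℂ => (Real.sqrt (psiQ z))⁻¹) z :=
    (contDiff_psiQ.contDiffAt.sqrt (ne_of_gt hz)).inv (Real.sqrt_pos.2 hz).ne'
  have h4 : ContDiffAt ℝ ∞ (fun z : Fin 4 → ℂ => (((Real.sqrt (psiQ z))⁻¹ : ℝ) : ℂ)) z :=
    Complex.ofRealCLM.contDiff.contDiffAt.comp z h3
  have h5 := (h2.mul (h1.inv hi)).mul h4
  refine h5.congr_of_eventuallyEq (.of_forall fun w => ?_)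
  simp only [posFactor, div_eq_mul_inv]
  rfl

end PsiP

/-- The forms `ω₁, ω₂, ω₃` kill the tangent space `e₁ ℂ` of the orbits of `ℂˣ`. -/
theorem PsiFrame.omega_add_smul (f : PsiFrame) (v : Fin 4 → ℂ) (c : ℂ) :
    f.omega (toQuat (v + c • ofQuat f.e₁)) = f.omega (toQuat v) := by
  have h : toQuat (c • ofQuat f.e₁) = f.combo c 0 := by
    rw [PsiHP1.toQuat_smul, toQuat_ofQuat, PsiFrame.combo]; simp
  rw [← toQuatL_apply, map_add, map_add, toQuatL_apply, toQuatL_apply, h, f.omega_combo]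
  funext k
  have h0 : quatW (c : ℍ[ℝ]) = 0 := by apply Complex.ext <;> simp [quatW]
  fin_cases k <;> simp [h0]

/-- The coframe of `Ψ CP³` at `[z]`, evaluated on the image of a vector `v` of `ℂ⁴`. The coframe is
taken along the section `z ↦ a z` with values in `Ψ S⁷`, where `a = posFactor i z`; `m` is the
logarithmic derivative of `a`, and its term is a multiple of `e₁ = a z`, which the forms kill. -/
theorem exists_psiCoframe_dmk {z : Fin 4 → ℂ} (hz : z ∈ PsiP.cone ℂ) :
    ∃ (f : PsiFrame) (a : ℂ) (m : (Fin 4 → ℂ) → ℂ), a ≠ 0 ∧ ofQuat f.e₁ = a • z ∧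
      ∀ v, psiCoframe (PsiP.mk z) (PsiP.dmk z v) = f.omega (toQuat (a • v + m v • (a • z))) := by
  set b := PsiP.chartIdx (PsiP.mk z) with hb
  have hi : z (PsiP.idx b) ≠ 0 := (PsiP.mk_mem_source_iff b hz).1 (PsiP.mem_chart_source _)
  set i := PsiP.idx b with hidef
  have ha := PsiP.posFactor_ne_zero hz hi
  have hd := ((PsiP.contDiffAt_posFactor hz hi).differentiableAt (by simp)).hasFDerivAt
  have hd2 := hd.smul (hasFDerivAt_id (𝕜 := ℝ) z)
  have hd3 := toQuatL.hasFDerivAt.comp z hd2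
  have hev : (fun w => toQuat (PsiP.posSection i (PsiP.mk w))) =ᶠ[𝓝 z]
      (fun w => toQuatL (PsiP.posFactor i w • w)) := by
    filter_upwards [PsiP.isOpen_cone.mem_nhds hz] with w hw
    rw [PsiP.posSection_mk i hw, toQuatL_apply]
  have hsm : ContDiffAt ℝ ∞ (fun w => toQuatL (PsiP.posFactor i w • w)) z :=
    toQuatL.contDiff.contDiffAt.comp z ((PsiP.contDiffAt_posFactor hz hi).smul contDiffAt_id)
  have hF := PsiP.contMDiffAt_of_comp_mk (F := fun y => toQuat (PsiP.posSection i y)) hz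
    (hsm.contMDiffAt.congr_of_eventuallyEq hev)
  have hmf := fun v => PsiP.mfderiv_comp_mk hz (hF.mdifferentiableAt (by simp)) v
  refine ⟨PsiFrame.ofSphere ⟨_, PsiP.posSection_mem (PsiP.mk z)⟩, PsiP.posFactor i z,
    fun v => fderiv ℝ (PsiP.posFactor i) z v / PsiP.posFactor i z, ha, ?_, fun v => ?_⟩
  · change ofQuat (toQuat (PsiP.posSection i (PsiP.mk z))) = _
    rw [ofQuat_toQuat, PsiP.posSection_mk i hz]
  · change PsiFrame.omega _ (mfderiv 𝓘(ℝ, Fin 3 → ℂ) 𝓘(ℝ, ℍ[ℝ] × ℍ[ℝ])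
      (fun y => toQuat (PsiP.posSection i y)) (PsiP.mk z) (PsiP.dmk z v)) = _
    congr 1
    refine (hmf v).trans ?_
    rw [hev.mfderiv_eq, mfderiv_eq_fderiv, smul_smul, div_mul_cancel₀ _ ha]
    exact DFunLike.congr_fun hd3.fderiv v

section

variable {z : Fin 4 → ℂ}

theorem psiMetric_mk (hz : z ∈ PsiP.cone ℂ) (v w : Fin 4 → ℂ) :
    psiMetric (PsiP.mk z) (PsiP.dmk z v) (PsiP.dmk z w) = coneMetric z v w := by
  obtain ⟨f, a, m, ha, hf, h⟩ := exists_psiCoframe_dmk hz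
  have hz' : 0 < psiQ (a • z) := by rw [← hf, f.psiQ_ofQuat_e₁]; exact one_pos
  rw [psiMetric, h, h, f.stdMetric_omega, ofQuat_toQuat, ofQuat_toQuat, hf, coneMetric,
    coneHerm_add_smul hz', coneHerm_smul ha, coneVert_add_smul, coneVert_smul ha, coneMetric]

theorem psiKahler_mk (hz : z ∈ PsiP.cone ℂ) (v : Fin 2 → Fin 4 → ℂ) :
    psiKahler (PsiP.mk z) (fun i => PsiP.dmk z (v i)) = coneKahler z (v 0) (v 1) := by
  obtain ⟨f, a, m, ha, hf, h⟩ := exists_psiCoframe_dmk hz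
  have hz' : 0 < psiQ (a • z) := by rw [← hf, f.psiQ_ofQuat_e₁]; exact one_pos
  change stdKahler (fun i => psiCoframe (PsiP.mk z) (PsiP.dmk z (v i))) = _
  simp only [h]
  rw [f.stdKahler_omega, ofQuat_toQuat, ofQuat_toQuat, hf, coneKahler,
    coneHerm_add_smul hz', coneHerm_smul ha, coneKahler]

theorem psiVolume_mk (hz : z ∈ PsiP.cone ℂ) (v : Fin 3 → Fin 4 → ℂ) :
    psiVolume (PsiP.mk z) (fun i => PsiP.dmk z (v i)) = coneVolume z (v 0) (v 1) (v 2) := by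
  obtain ⟨f, a, m, ha, hf, h⟩ := exists_psiCoframe_dmk hz
  have hz' : 0 < psiQ (a • z) := by rw [← hf, f.psiQ_ofQuat_e₁]; exact one_pos
  change stdVolume (fun i => psiCoframe (PsiP.mk z) (PsiP.dmk z (v i))) = _
  simp only [h]
  rw [f.stdVolume_omega, ofQuat_toQuat, ofQuat_toQuat, ofQuat_toQuat, hf,
    coneVolume_add_smul hz', coneVolume_smul ha]

end

theorem psiCoframe_surjective (x : PsiP ℂ) : Function.Surjective (psiCoframe x) := by
  intro u
  obtain ⟨z, hz, rfl⟩ := PsiP.exists_mk x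
  obtain ⟨f, a, m, ha, hf, h⟩ := exists_psiCoframe_dmk (PsiP.psiSphere_subset_cone hz)
  obtain ⟨v, hv⟩ := f.omega_surjective u
  refine ⟨PsiP.dmk z (a⁻¹ • ofQuat v), ?_⟩
  rw [h, ← hf, f.omega_add_smul, smul_smul, mul_inv_cancel₀ ha, one_smul, toQuat_ofQuat, hv]

/-- The coframe as an isomorphism onto `ℂ³`. -/
def psiCoframeEquiv (x : PsiP ℂ) : TangentSpace 𝓘(ℝ, Fin 3 → ℂ) x ≃L[ℝ] (Fin 3 → ℂ) :=
  let L : (Fin 3 → ℂ) →ₗ[ℝ] (Fin 3 → ℂ) := (psiCoframe x).toLinearMap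
  have hs : Function.Surjective L := psiCoframe_surjective x
  (LinearEquiv.ofBijective L ⟨LinearMap.injective_iff_surjective.2 hs, hs⟩).toContinuousLinearEquiv

/-! ### The pullbacks to the frames -/

namespace PsiFrame

variable (f : PsiFrame)

theorem e₁_mem_cone : ofQuat f.e₁ ∈ PsiP.cone ℂ :=
  PsiP.psiSphere_subset_cone f.psiQ_ofQuat_e₁

theorem dproj_apply (v : ℍ[ℝ] × ℍ[ℝ]) : f.dproj v = PsiP.dmk (ofQuat f.e₁) (ofQuat v) :=
  PsiP.mfderiv_mk_comp ofQuat.hasFDerivAt f.e₁_mem_cone v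

theorem dproj_surjective : Function.Surjective f.dproj := by
  intro w
  obtain ⟨v, hv⟩ := PsiP.dmk_surjective f.e₁_mem_cone w
  refine ⟨toQuat v, ?_⟩
  rw [dproj_apply, ofQuat_toQuat]
  exact hv

theorem psiMetric_dproj (v w : ℍ[ℝ] × ℍ[ℝ]) :
    psiMetric f.proj (f.dproj v) (f.dproj w) = stdMetric (f.omega v) (f.omega w) := by
  rw [dproj_apply, dproj_apply, f.stdMetric_omega]
  exact psiMetric_mk f.e₁_mem_cone _ _

theorem psiKahler_dproj : (psiKahler f.proj).compContinuousLinearMap f.dproj =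
    stdKahler.compContinuousLinearMap f.omega := by
  ext v
  change psiKahler f.proj (fun i => f.dproj (v i)) = stdKahler (fun i => f.omega (v i))
  simp only [dproj_apply]
  rw [f.stdKahler_omega]
  exact psiKahler_mk f.e₁_mem_cone _

theorem psiVolume_dproj : (psiVolume f.proj).compContinuousLinearMap f.dproj =
    stdVolume.compContinuousLinearMap f.omega := by
  ext v
  change psiVolume f.proj (fun i => f.dproj (v i)) = stdVolume (fun i => f.omega (v i))
  simp only [dproj_apply]
  rw [f.stdVolume_omega]
  exact psiVolume_mk f.e₁_mem_cone _

theorem exists_proj_eq (x : PsiP ℂ) : ∃ f : PsiFrame, f.proj = x := by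
  obtain ⟨z, hz, rfl⟩ := PsiP.exists_mk x
  refine ⟨ofSphere ⟨z, hz⟩, ?_⟩
  change PsiP.mk (ofQuat (toQuat z)) = _
  rw [ofQuat_toQuat]

end PsiFrame

/-! ### Differential forms and their values on fixed vectors -/

section Evaluation

variable {E F X : Type*} [NormedAddCommGroup E] [NormedSpace ℝ E] [FiniteDimensional ℝ E]
  [NormedAddCommGroup F] [NormedSpace ℝ F] [FiniteDimensional ℝ F]
  [NormedAddCommGroup X] [NormedSpace ℝ X] {k : ℕ}

/-- A form-valued map is smooth if its values on fixed vectors are. The values on the tuples of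
basis vectors embed the space of forms into a finite-dimensional space, and a linear left inverse
of this embedding recovers the form from its values. -/
theorem contDiffOn_of_apply {α : X → E [⋀^Fin k]→L[ℝ] F} {s : Set X} {n : ℕ∞ω}
    (h : ∀ v : Fin k → E, ContDiffOn ℝ n (fun x => α x v) s) : ContDiffOn ℝ n α s := by
  let b := Module.finBasis ℝ E
  let ev : (E [⋀^Fin k]→L[ℝ] F) →ₗ[ℝ] ((Fin k → Fin (Module.finrank ℝ E)) → F) :=
    { toFun := fun a i => a fun l => b (i l)
      map_add' := fun _ _ => rfl
      map_smul' := fun _ _ => rfl }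
  have hinj : Function.Injective ev := by
    intro a a' haa'
    have hm : a.toMultilinearMap = a'.toMultilinearMap :=
      Module.Basis.ext_multilinear (fun _ => b) fun i => congrFun haa' i
    ext v
    exact DFunLike.congr_fun hm v
  obtain ⟨L, hL⟩ := ev.exists_leftInverse_of_injective (LinearMap.ker_eq_bot.2 hinj)
  have hsm : ContDiffOn ℝ n (fun x => L.toContinuousLinearMap (ev (α x))) s :=
    L.toContinuousLinearMap.contDiff.comp_contDiffOn (contDiffOn_pi.2 fun i => h _)
  exact hsm.congr fun x _ => (DFunLike.congr_fun hL (α x)).symm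

end Evaluation

/-! ### Derivatives of the cone tensors -/

section Derivatives

variable {z : Fin 4 → ℂ}

theorem contDiff_psiHerm_left (v : Fin 4 → ℂ) : ContDiff ℝ ∞ fun z => psiHerm z v := by
  have h' : ∀ k, ContDiff ℝ ∞ fun z : Fin 4 → ℂ => conj (z k) := fun k =>
    Complex.conjCLE.contDiff.comp (contDiff_apply ℝ ℂ k)
  exact (((((h' 0).mul contDiff_const).add ((h' 1).mul contDiff_const)).sub
    ((h' 2).mul contDiff_const)).sub ((h' 3).mul contDiff_const))

theorem contDiff_psiSymp_left (v : Fin 4 → ℂ) : ContDiff ℝ ∞ fun z => psiSymp z v := by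
  have h' : ∀ k, ContDiff ℝ ∞ fun z : Fin 4 → ℂ => z k := contDiff_apply ℝ ℂ
  exact ((((h' 0).mul contDiff_const).sub ((h' 1).mul contDiff_const)).sub
    (((h' 2).mul contDiff_const).sub ((h' 3).mul contDiff_const)))

theorem contDiffOn_inv_psiQ :
    ContDiffOn ℝ ∞ (fun z => (((psiQ z)⁻¹ : ℝ) : ℂ)) (PsiP.cone ℂ) :=
  Complex.ofRealCLM.contDiff.comp_contDiffOn
    (PsiP.contDiff_psiQ.contDiffOn.inv fun _ hz => (ne_of_gt hz))

theorem contDiff_conj_comp {f : (Fin 4 → ℂ) → ℂ} (hf : ContDiff ℝ ∞ f) :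
    ContDiff ℝ ∞ fun z => conj (f z) := Complex.conjCLE.contDiff.comp hf

theorem contDiffOn_coneHerm (v w : Fin 4 → ℂ) :
    ContDiffOn ℝ ∞ (fun z => coneHerm z v w) (PsiP.cone ℂ) :=
  (((contDiff_conj_comp (contDiff_psiHerm_left v)).mul
    (contDiff_psiHerm_left w)).contDiffOn.mul (contDiffOn_inv_psiQ.pow 2)).sub
    (contDiffOn_const.mul contDiffOn_inv_psiQ)

theorem contDiffOn_coneBivolume (v w : Fin 4 → ℂ) :
    ContDiffOn ℝ ∞ (fun z => coneBivolume z v w) (PsiP.cone ℂ) :=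
  (((((contDiff_psiHerm_left v).mul (contDiff_psiSymp_left w)).sub
    ((contDiff_psiSymp_left v).mul (contDiff_psiHerm_left w))).contDiffOn.mul
      (contDiffOn_inv_psiQ.pow 2)).sub (contDiffOn_const.mul contDiffOn_inv_psiQ))

theorem contDiffOn_coneVolume (u v w : Fin 4 → ℂ) :
    ContDiffOn ℝ ∞ (fun z => coneVolume z u v w) (PsiP.cone ℂ) := by
  have h := fun v => (contDiff_conj_comp (contDiff_psiSymp_left v)).contDiffOn
    (s := PsiP.cone ℂ)
  exact ((((contDiffOn_coneBivolume u v).mul (h w)).add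
    ((contDiffOn_coneBivolume v w).mul (h u))).add
    ((contDiffOn_coneBivolume w u).mul (h v))).mul contDiffOn_inv_psiQ

theorem hasDerivAt_add_mul (p q : ℂ) : HasDerivAt (fun t : ℝ => p + t * q) q 0 := by
  simpa using ((Complex.ofRealCLM.hasDerivAt (x := (0 : ℝ))).mul_const q).const_add p

theorem hasDerivAt_psiHerm (z x v : Fin 4 → ℂ) :
    HasDerivAt (fun t : ℝ => psiHerm (z + t • x) v) (psiHerm x v) 0 := by
  refine (hasDerivAt_add_mul (psiHerm z v) (psiHerm x v)).congr_of_eventuallyEq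
    (.of_forall fun t => ?_)
  have e : t • x = (t : ℂ) • x := by funext k; simp
  simp only [e, psiHerm_add_left, psiHerm_smul_left, Complex.conj_ofReal]

theorem hasDerivAt_conj_psiHerm (z x v : Fin 4 → ℂ) :
    HasDerivAt (fun t : ℝ => conj (psiHerm (z + t • x) v)) (conj (psiHerm x v)) 0 := by
  have h := (hasDerivAt_psiHerm z x v).star
  exact h

theorem hasDerivAt_psiSymp (z x v : Fin 4 → ℂ) :
    HasDerivAt (fun t : ℝ => psiSymp (z + t • x) v) (psiSymp x v) 0 := by
  refine (hasDerivAt_add_mul (psiSymp z v) (psiSymp x v)).congr_of_eventuallyEq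
    (.of_forall fun t => ?_)
  have e : t • x = (t : ℂ) • x := by funext k; simp
  simp only [e, psiSymp_add_left, psiSymp_smul_left]

theorem hasDerivAt_conj_psiSymp (z x v : Fin 4 → ℂ) :
    HasDerivAt (fun t : ℝ => conj (psiSymp (z + t • x) v)) (conj (psiSymp x v)) 0 := by
  have h := (hasDerivAt_psiSymp z x v).star
  exact h

theorem hasDerivAt_inv_psiQ (hz : z ∈ PsiP.cone ℂ) (x : Fin 4 → ℂ) :
    HasDerivAt (fun t : ℝ => (((psiQ (z + t • x))⁻¹ : ℝ) : ℂ))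
      (-(psiHerm z x + conj (psiHerm z x)) * ((psiQ z)⁻¹ : ℝ) ^ 2) 0 := by
  have h1 : HasDerivAt (fun t : ℝ => (psiQ (z + t • x) : ℂ))
      (psiHerm z x + conj (psiHerm z x)) 0 := by
    have h2 := ((hasDerivAt_add_mul (psiQ z) (psiHerm z x + conj (psiHerm z x))).add
      (((Complex.ofRealCLM.hasDerivAt (x := (0 : ℝ))).pow 2).mul_const (psiQ x : ℂ)))
    refine (h2.congr_deriv (by simp)).congr_of_eventuallyEq (.of_forall fun t => ?_)
    have e : t • x = (t : ℂ) • x := by funext k; simp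
    simp only [e, ← psiHerm_self, psiHerm_add_left, psiHerm_add_right, psiHerm_smul_left,
      psiHerm_smul_right, Complex.conj_ofReal, psiHerm_conj, Pi.add_apply, Pi.pow_apply,
      Complex.ofRealCLM_apply]
    ring
  have hz0 : (psiQ (z + (0 : ℝ) • x) : ℂ) ≠ 0 := by
    rw [zero_smul, add_zero]; exact Complex.ofReal_ne_zero.2 (ne_of_gt hz)
  refine ((h1.inv hz0).congr_deriv ?_).congr_of_eventuallyEq (.of_forall fun t => ?_)
  · rw [zero_smul, add_zero]; push_cast; rw [inv_pow, div_eq_mul_inv]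
  · simp

/-- The derivative of `coneHerm z v w` in the direction `x`. -/
def coneHermDeriv (z x v w : Fin 4 → ℂ) : ℂ :=
  (conj (psiHerm x v) * psiHerm z w + conj (psiHerm z v) * psiHerm x w) *
      ((psiQ z)⁻¹ : ℝ) ^ 2 -
    2 * conj (psiHerm z v) * psiHerm z w * (psiHerm z x + conj (psiHerm z x)) *
      ((psiQ z)⁻¹ : ℝ) ^ 3 +
    psiHerm v w * (psiHerm z x + conj (psiHerm z x)) * ((psiQ z)⁻¹ : ℝ) ^ 2

theorem hasDerivAt_coneHerm (hz : z ∈ PsiP.cone ℂ) (x v w : Fin 4 → ℂ) :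
    HasDerivAt (fun t : ℝ => coneHerm (z + t • x) v w) (coneHermDeriv z x v w) 0 := by
  have hq := hasDerivAt_inv_psiQ hz x
  have h := (((hasDerivAt_conj_psiHerm z x v).mul (hasDerivAt_psiHerm z x w)).mul
    (hq.pow 2)).sub (hq.const_mul (psiHerm v w))
  refine h.congr_deriv ?_
  simp only [zero_smul, add_zero, coneHermDeriv, Pi.mul_apply, Pi.pow_apply]
  ring

/-- The derivative of `coneBivolume z v w` in the direction `x`. -/
def coneBivolumeDeriv (z x v w : Fin 4 → ℂ) : ℂ :=
  (psiHerm x v * psiSymp z w + psiHerm z v * psiSymp x w -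
      (psiSymp x v * psiHerm z w + psiSymp z v * psiHerm x w)) * ((psiQ z)⁻¹ : ℝ) ^ 2 -
    2 * (psiHerm z v * psiSymp z w - psiSymp z v * psiHerm z w) *
      (psiHerm z x + conj (psiHerm z x)) * ((psiQ z)⁻¹ : ℝ) ^ 3 +
    psiSymp v w * (psiHerm z x + conj (psiHerm z x)) * ((psiQ z)⁻¹ : ℝ) ^ 2

theorem hasDerivAt_coneBivolume (hz : z ∈ PsiP.cone ℂ) (x v w : Fin 4 → ℂ) :
    HasDerivAt (fun t : ℝ => coneBivolume (z + t • x) v w) (coneBivolumeDeriv z x v w) 0 := by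
  have hq := hasDerivAt_inv_psiQ hz x
  have h := ((((hasDerivAt_psiHerm z x v).mul (hasDerivAt_psiSymp z x w)).sub
    ((hasDerivAt_psiSymp z x v).mul (hasDerivAt_psiHerm z x w))).mul
    (hq.pow 2)).sub (hq.const_mul (psiSymp v w))
  refine h.congr_deriv ?_
  simp only [zero_smul, add_zero, coneBivolumeDeriv, Pi.mul_apply, Pi.pow_apply, Pi.sub_apply]
  ring

/-- The derivative of `coneVolume z u v w` in the direction `x`. -/
def coneVolumeDeriv (z x u v w : Fin 4 → ℂ) : ℂ :=
  (coneBivolumeDeriv z x u v * conj (psiSymp z w) + coneBivolume z u v * conj (psiSymp x w) +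
    (coneBivolumeDeriv z x v w * conj (psiSymp z u) + coneBivolume z v w * conj (psiSymp x u)) +
    (coneBivolumeDeriv z x w u * conj (psiSymp z v) + coneBivolume z w u * conj (psiSymp x v))) *
      ((psiQ z)⁻¹ : ℝ) -
  (coneBivolume z u v * conj (psiSymp z w) + coneBivolume z v w * conj (psiSymp z u) +
    coneBivolume z w u * conj (psiSymp z v)) * (psiHerm z x + conj (psiHerm z x)) *
      ((psiQ z)⁻¹ : ℝ) ^ 2

theorem hasDerivAt_coneVolume (hz : z ∈ PsiP.cone ℂ) (x u v w : Fin 4 → ℂ) :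
    HasDerivAt (fun t : ℝ => coneVolume (z + t • x) u v w) (coneVolumeDeriv z x u v w) 0 := by
  have hq := hasDerivAt_inv_psiQ hz x
  have hb := hasDerivAt_coneBivolume hz x
  have hs := hasDerivAt_conj_psiSymp z x
  have h := ((((hb u v).mul (hs w)).add ((hb v w).mul (hs u))).add
    ((hb w u).mul (hs v))).mul hq
  refine h.congr_deriv ?_
  simp only [zero_smul, add_zero, coneVolumeDeriv, Pi.mul_apply, Pi.add_apply]
  ring

/-- `dΩ = 0` on the cone: the alternating sum of the derivatives is invariant under conjugation, as
`h` is Hermitian. -/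
theorem coneHermDeriv_cyclic_im (v₀ v₁ v₂ : Fin 4 → ℂ) :
    (coneHermDeriv z v₀ v₁ v₂ - coneHermDeriv z v₁ v₀ v₂ + coneHermDeriv z v₂ v₀ v₁).im = 0 := by
  rw [← Complex.conj_eq_iff_im]
  simp only [coneHermDeriv, map_add, map_sub, map_mul, map_pow, Complex.conj_ofReal,
    Complex.conj_conj, map_ofNat, ← psiHerm_conj v₀ v₁, ← psiHerm_conj v₀ v₂, ← psiHerm_conj v₁ v₂]
  ring

/-- `d(Im Ψ) = 0` on the cone: the alternating sum of the derivatives is invariant under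
conjugation, as `h` is Hermitian and `s` alternating. -/
theorem coneVolumeDeriv_cyclic_im (v₀ v₁ v₂ v₃ : Fin 4 → ℂ) :
    (coneVolumeDeriv z v₀ v₁ v₂ v₃ - coneVolumeDeriv z v₁ v₀ v₂ v₃ +
      coneVolumeDeriv z v₂ v₀ v₁ v₃ - coneVolumeDeriv z v₃ v₀ v₁ v₂).im = 0 := by
  rw [← Complex.conj_eq_iff_im]
  simp only [coneVolumeDeriv, coneBivolumeDeriv, coneBivolume, map_add, map_sub, map_mul, map_pow,
    Complex.conj_ofReal, Complex.conj_conj, map_ofNat, ← psiHerm_conj v₀ v₁,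
    ← psiHerm_conj v₀ v₂, ← psiHerm_conj v₁ v₂, ← psiHerm_conj v₀ v₃, ← psiHerm_conj v₁ v₃,
    ← psiHerm_conj v₂ v₃, psiSymp_swap v₁ v₀, psiSymp_swap v₂ v₀, psiSymp_swap v₃ v₀,
    psiSymp_swap v₂ v₁, psiSymp_swap v₃ v₁, psiSymp_swap v₃ v₂, map_neg]
  ring

end Derivatives

/-! ### The nearly Calabi-Yau structure -/

theorem fderiv_comp_affinePt {F : Type*} [NormedAddCommGroup F] [NormedSpace ℝ F]
    {φ : (Fin 4 → ℂ) → F} {b : Bool} {u : Fin 3 → ℂ}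
    (hφ : DifferentiableAt ℝ φ (PsiP.affinePt b u)) (v : Fin 3 → ℂ) {d : F}
    (hd : HasDerivAt (fun t : ℝ => φ (PsiP.affinePt b u + t • PsiP.affineDir b v)) d 0) :
    fderiv ℝ (fun u => φ (PsiP.affinePt b u)) u v = d := by
  have h := hφ.hasFDerivAt.comp u (PsiP.hasFDerivAt_affinePt b u)
  have h1 : fderiv ℝ (fun u => φ (PsiP.affinePt b u)) u = _ := h.fderiv
  rw [h1]
  have h2 := (hφ.hasFDerivAt.hasLineDerivAt (PsiP.affineDir b v)).unique
    (show HasLineDerivAt ℝ φ d _ (PsiP.affineDir b v) from hd)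
  exact h2

theorem psiKahler_inChart_apply (x₀ : PsiP ℂ) {u : Fin 3 → ℂ}
    (hu : u ∈ (chartAt (Fin 3 → ℂ) x₀).target) (v : Fin 2 → Fin 3 → ℂ) :
    psiKahler.inChart x₀ u v = coneKahler (PsiP.affinePt (PsiP.chartIdx x₀) u)
      (PsiP.affineDir (PsiP.chartIdx x₀) (v 0)) (PsiP.affineDir (PsiP.chartIdx x₀) (v 1)) := by
  rw [DiffForm.inChart_apply _ _ hu, psiKahler_mk hu]

theorem psiVolume_inChart_apply (x₀ : PsiP ℂ) {u : Fin 3 → ℂ}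
    (hu : u ∈ (chartAt (Fin 3 → ℂ) x₀).target) (v : Fin 3 → Fin 3 → ℂ) :
    psiVolume.inChart x₀ u v = coneVolume (PsiP.affinePt (PsiP.chartIdx x₀) u)
      (PsiP.affineDir (PsiP.chartIdx x₀) (v 0)) (PsiP.affineDir (PsiP.chartIdx x₀) (v 1))
      (PsiP.affineDir (PsiP.chartIdx x₀) (v 2)) := by
  rw [DiffForm.inChart_apply _ _ hu, psiVolume_mk hu]

theorem imPart_psiVolume_inChart_apply (x₀ : PsiP ℂ) {u : Fin 3 → ℂ}
    (hu : u ∈ (chartAt (Fin 3 → ℂ) x₀).target) (v : Fin 3 → Fin 3 → ℂ) :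
    psiVolume.imPart.inChart x₀ u v = (coneVolume (PsiP.affinePt (PsiP.chartIdx x₀) u)
      (PsiP.affineDir (PsiP.chartIdx x₀) (v 0)) (PsiP.affineDir (PsiP.chartIdx x₀) (v 1))
      (PsiP.affineDir (PsiP.chartIdx x₀) (v 2))).im := by
  rw [← psiVolume_inChart_apply x₀ hu v]
  rfl

theorem contDiffOn_comp_affinePt {F : Type*} [NormedAddCommGroup F] [NormedSpace ℝ F]
    {φ : (Fin 4 → ℂ) → F} (hφ : ContDiffOn ℝ ∞ φ (PsiP.cone ℂ)) (x₀ : PsiP ℂ) :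
    ContDiffOn ℝ ∞ (fun u => φ (PsiP.affinePt (PsiP.chartIdx x₀) u))
      (chartAt (Fin 3 → ℂ) x₀).target :=
  hφ.comp (PsiP.contDiff_affinePt _).contDiffOn fun _ hu => hu

theorem contDiffOn_coneKahler (v w : Fin 4 → ℂ) :
    ContDiffOn ℝ ∞ (fun z => coneKahler z v w) (PsiP.cone ℂ) :=
  Complex.imCLM.contDiff.comp_contDiffOn (contDiffOn_coneHerm v w)

theorem contDiffOn_coneVolume_im (u v w : Fin 4 → ℂ) :
    ContDiffOn ℝ ∞ (fun z => (coneVolume z u v w).im) (PsiP.cone ℂ) :=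
  Complex.imCLM.contDiff.comp_contDiffOn (contDiffOn_coneVolume u v w)

theorem isSmooth_psiKahler : psiKahler.IsSmooth := fun x₀ =>
  contDiffOn_of_apply fun _ => (contDiffOn_comp_affinePt (contDiffOn_coneKahler _ _) x₀).congr
    fun _ hu => psiKahler_inChart_apply x₀ hu _

theorem isSmooth_psiVolume : psiVolume.IsSmooth := fun x₀ =>
  contDiffOn_of_apply fun _ => (contDiffOn_comp_affinePt (contDiffOn_coneVolume _ _ _) x₀).congr
    fun _ hu => psiVolume_inChart_apply x₀ hu _

theorem isSmooth_imPart_psiVolume : psiVolume.imPart.IsSmooth := fun x₀ =>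
  contDiffOn_of_apply fun _ =>
    (contDiffOn_comp_affinePt (contDiffOn_coneVolume_im _ _ _) x₀).congr
      fun _ hu => imPart_psiVolume_inChart_apply x₀ hu _

theorem differentiableAt_of_contDiffOn_cone {F : Type*} [NormedAddCommGroup F] [NormedSpace ℝ F]
    {φ : (Fin 4 → ℂ) → F} (hφ : ContDiffOn ℝ ∞ φ (PsiP.cone ℂ)) {z : Fin 4 → ℂ}
    (hz : z ∈ PsiP.cone ℂ) : DifferentiableAt ℝ φ z :=
  (hφ.contDiffAt (PsiP.isOpen_cone.mem_nhds hz)).differentiableAt (by simp)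

theorem hasDerivAt_im {φ : ℝ → ℂ} {d : ℂ} {t : ℝ} (h : HasDerivAt φ d t) :
    HasDerivAt (fun t => (φ t).im) d.im t := (Complex.imCLM.hasFDerivAt.comp_hasDerivAt t h)

theorem extD_psiKahler : psiKahler.extD = 0 := by
  funext x
  have hx : chartAt (Fin 3 → ℂ) x x ∈ (chartAt (Fin 3 → ℂ) x).target :=
    mem_chart_target _ x
  have ho := (chartAt (Fin 3 → ℂ) x).open_target.mem_nhds hx
  have h0 : extDeriv (psiKahler.inChart x) (chartAt (Fin 3 → ℂ) x x) = 0 := by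
    ext v
    rw [extDeriv_apply (((isSmooth_psiKahler x).contDiffAt ho).differentiableAt (by simp))]
    set b := PsiP.chartIdx x with hb
    set u := chartAt (Fin 3 → ℂ) x x with hu
    have key : ∀ (w : Fin 2 → Fin 3 → ℂ) (w' : Fin 3 → ℂ),
        fderiv ℝ (fun y => psiKahler.inChart x y w) u w' =
          (coneHermDeriv (PsiP.affinePt b u) (PsiP.affineDir b w') (PsiP.affineDir b (w 0))
            (PsiP.affineDir b (w 1))).im := by
      intro w w'
      have hev : (fun y => psiKahler.inChart x y w) =ᶠ[𝓝 u] fun y =>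
          coneKahler (PsiP.affinePt b y) (PsiP.affineDir b (w 0)) (PsiP.affineDir b (w 1)) := by
        filter_upwards [ho] with y hy
        exact psiKahler_inChart_apply x hy w
      rw [hev.fderiv_eq]
      exact fderiv_comp_affinePt
        (differentiableAt_of_contDiffOn_cone (contDiffOn_coneKahler _ _) hx) w'
        (hasDerivAt_im (hasDerivAt_coneHerm hx _ _ _))
    simp only [key]
    refine (Fin.sum_univ_three _).trans ?_
    change _ = (0 : ℝ)
    have h := coneHermDeriv_cyclic_im (z := PsiP.affinePt b u) (PsiP.affineDir b (v 0))
      (PsiP.affineDir b (v 1)) (PsiP.affineDir b (v 2))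
    rw [Complex.add_im, Complex.sub_im] at h
    refine Eq.trans ?_ h
    change ((-1) ^ 0 : ℤ) • _ + ((-1) ^ 1 : ℤ) • _ + ((-1) ^ 2 : ℤ) • _ = _
    rw [pow_zero, one_smul, pow_one, neg_one_sq, neg_one_smul, one_smul, ← sub_eq_add_neg]
    rfl
  change ContinuousAlternatingMap.compContinuousLinearMap
    (extDeriv (psiKahler.inChart x) (chartAt (Fin 3 → ℂ) x x)) _ = 0
  rw [h0]
  rfl

theorem extD_imPart_psiVolume : psiVolume.imPart.extD = 0 := by
  funext x
  have hx : chartAt (Fin 3 → ℂ) x x ∈ (chartAt (Fin 3 → ℂ) x).target :=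
    mem_chart_target _ x
  have ho := (chartAt (Fin 3 → ℂ) x).open_target.mem_nhds hx
  have h0 : extDeriv (psiVolume.imPart.inChart x) (chartAt (Fin 3 → ℂ) x x) = 0 := by
    ext v
    rw [extDeriv_apply (((isSmooth_imPart_psiVolume x).contDiffAt ho).differentiableAt (by simp))]
    set b := PsiP.chartIdx x with hb
    set u := chartAt (Fin 3 → ℂ) x x with hu
    have key : ∀ (w : Fin 3 → Fin 3 → ℂ) (w' : Fin 3 → ℂ),
        fderiv ℝ (fun y => psiVolume.imPart.inChart x y w) u w' =
          (coneVolumeDeriv (PsiP.affinePt b u) (PsiP.affineDir b w') (PsiP.affineDir b (w 0))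
            (PsiP.affineDir b (w 1)) (PsiP.affineDir b (w 2))).im := by
      intro w w'
      have hev : (fun y => psiVolume.imPart.inChart x y w) =ᶠ[𝓝 u] fun y =>
          (coneVolume (PsiP.affinePt b y) (PsiP.affineDir b (w 0)) (PsiP.affineDir b (w 1))
            (PsiP.affineDir b (w 2))).im := by
        filter_upwards [ho] with y hy
        exact imPart_psiVolume_inChart_apply x hy w
      rw [hev.fderiv_eq]
      exact fderiv_comp_affinePt
        (differentiableAt_of_contDiffOn_cone (contDiffOn_coneVolume_im _ _ _) hx) w'
        (hasDerivAt_im (hasDerivAt_coneVolume hx _ _ _ _))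
    simp only [key]
    refine (Fin.sum_univ_four _).trans ?_
    change _ = (0 : ℝ)
    have h := coneVolumeDeriv_cyclic_im (z := PsiP.affinePt b u) (PsiP.affineDir b (v 0))
      (PsiP.affineDir b (v 1)) (PsiP.affineDir b (v 2)) (PsiP.affineDir b (v 3))
    rw [Complex.sub_im, Complex.add_im, Complex.sub_im] at h
    refine Eq.trans ?_ h
    change ((-1) ^ 0 : ℤ) • _ + ((-1) ^ 1 : ℤ) • _ + ((-1) ^ 2 : ℤ) • _ + ((-1) ^ 3 : ℤ) • _ = _
    rw [pow_zero, one_smul, pow_one, neg_one_sq, pow_succ, neg_one_sq, one_mul, neg_one_smul,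
      one_smul, neg_one_smul, ← sub_eq_add_neg, ← sub_eq_add_neg]
    rfl
  change ContinuousAlternatingMap.compContinuousLinearMap
    (extDeriv (psiVolume.imPart.inChart x) (chartAt (Fin 3 → ℂ) x x)) _ = 0
  rw [h0]
  rfl

theorem isNearlyCalabiYau_psi : IsNearlyCalabiYau psiMetric psiKahler psiVolume where
  smooth_kahler := isSmooth_psiKahler
  smooth_volume := isSmooth_psiVolume
  exists_coframe x := ⟨psiCoframeEquiv x, fun _ _ => rfl, rfl, rfl⟩
  closed_kahler := extD_psiKahler
  closed_im_volume := extD_imPart_psiVolume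

/-! ### The anti-complex involution -/

/-- Complex conjugation of `ℂ⁴`. -/
def conjL : (Fin 4 → ℂ) →L[ℝ] (Fin 4 → ℂ) :=
  ContinuousLinearMap.pi fun k =>
    (Complex.conjCLE : ℂ →L[ℝ] ℂ) ∘L (ContinuousLinearMap.proj k : (Fin 4 → ℂ) →L[ℝ] ℂ)

theorem conjL_apply (z : Fin 4 → ℂ) : conjL z = fun k => conj (z k) := rfl

theorem psiQ_conjL (z : Fin 4 → ℂ) : psiQ (conjL z) = psiQ z := by simp [psiQ, conjL_apply]

theorem PsiP.conj_mem_cone {z : Fin 4 → ℂ} (hz : z ∈ PsiP.cone ℂ) : conjL z ∈ PsiP.cone ℂ := by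
  change 0 < psiQ _
  rw [psiQ_conjL]; exact hz

theorem psiInvolution_mk {z : Fin 4 → ℂ} (hz : z ∈ PsiP.cone ℂ) :
    psiInvolution (PsiP.mk z) = PsiP.mk (conjL z) := by
  rw [PsiP.mk_of_pos z hz, PsiP.mk_of_pos (conjL z) (PsiP.conj_mem_cone hz)]
  change PsiP.proj _ = _
  congr 1
  refine Subtype.ext ((ofQuat_quatC _).trans ?_)
  funext k
  change conj ((((Real.sqrt (psiQ z))⁻¹ : ℝ) : ℂ) * z k) =
    (((Real.sqrt (psiQ (conjL z)))⁻¹ : ℝ) : ℂ) * conj (z k)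
  rw [psiQ_conjL, map_mul, Complex.conj_ofReal]

theorem contMDiff_psiInvolution :
    ContMDiff 𝓘(ℝ, Fin 3 → ℂ) 𝓘(ℝ, Fin 3 → ℂ) ∞ psiInvolution := by
  refine PsiP.contMDiff_of_comp_mk ?_
  have h : ContMDiffOn 𝓘(ℝ, Fin 4 → ℂ) 𝓘(ℝ, Fin 3 → ℂ) ∞ (fun z => PsiP.mk (conjL z))
      (PsiP.cone ℂ) :=
    PsiP.contMDiffOn_mk.comp conjL.contDiff.contMDiff.contMDiffOn fun z hz =>
      PsiP.conj_mem_cone hz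
  exact h.congr fun z hz => psiInvolution_mk hz

theorem mfderiv_psiInvolution {z : Fin 4 → ℂ} (hz : z ∈ PsiP.cone ℂ) (v : Fin 4 → ℂ) :
    (mfderiv 𝓘(ℝ, Fin 3 → ℂ) 𝓘(ℝ, Fin 3 → ℂ) psiInvolution (PsiP.mk z) (PsiP.dmk z v) :
      Fin 3 → ℂ) = (PsiP.dmk (conjL z) (conjL v) : Fin 3 → ℂ) := by
  have hev : (fun w => psiInvolution (PsiP.mk w)) =ᶠ[𝓝 z] fun w => PsiP.mk (conjL w) := by
    filter_upwards [PsiP.isOpen_cone.mem_nhds hz] with w hw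
    exact psiInvolution_mk hw
  refine (PsiP.mfderiv_comp_mk hz
    (contMDiff_psiInvolution.mdifferentiableAt (by simp)) v).trans ?_
  refine (DFunLike.congr_fun hev.mfderiv_eq v).trans ?_
  exact PsiP.mfderiv_mk_comp conjL.hasFDerivAt (PsiP.conj_mem_cone hz) v

theorem psiHerm_conjL (z w : Fin 4 → ℂ) : psiHerm (conjL z) (conjL w) = conj (psiHerm z w) := by
  simp [psiHerm, conjL_apply]

theorem psiSymp_conjL (z w : Fin 4 → ℂ) : psiSymp (conjL z) (conjL w) = conj (psiSymp z w) := by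
  simp [psiSymp, conjL_apply]

theorem coneKahler_conjL (z v w : Fin 4 → ℂ) :
    coneKahler (conjL z) (conjL v) (conjL w) = -coneKahler z v w := by
  rw [coneKahler, coneKahler, ← Complex.conj_im]
  congr 1
  simp only [coneHerm, psiHerm_conjL, psiQ_conjL, map_sub, map_mul, map_pow, Complex.conj_ofReal]

theorem coneVolume_conjL (z u v w : Fin 4 → ℂ) :
    coneVolume (conjL z) (conjL u) (conjL v) (conjL w) = conj (coneVolume z u v w) := by
  simp only [coneVolume, coneBivolume, psiHerm_conjL, psiSymp_conjL, psiQ_conjL, map_add, map_sub,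
    map_mul, map_pow, Complex.conj_ofReal]

theorem PsiP.exists_dmk {𝕜 : Type} [RCLike 𝕜] {z : Fin 4 → 𝕜} (hz : z ∈ PsiP.cone 𝕜) {k : ℕ}
    (v : Fin k → TangentSpace 𝓘(ℝ, Fin 3 → 𝕜) (PsiP.mk z)) :
    ∃ w : Fin k → Fin 4 → 𝕜, v = fun i => PsiP.dmk z (w i) := by
  choose w hw using fun i => PsiP.dmk_surjective hz (v i)
  exact ⟨w, funext fun i => (hw i).symm⟩

theorem isRealStructure_psiInvolution : IsRealStructure psiKahler psiVolume psiInvolution where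
  smooth := contMDiff_psiInvolution
  involutive x := by
    obtain ⟨z, hz, rfl⟩ := PsiP.exists_mk x
    have hz := PsiP.psiSphere_subset_cone hz
    rw [psiInvolution_mk hz, psiInvolution_mk (PsiP.conj_mem_cone hz)]
    congr 1
    funext k
    simp [conjL_apply]
  pullback_kahler x v := by
    obtain ⟨z, hz, rfl⟩ := PsiP.exists_mk x
    have hz := PsiP.psiSphere_subset_cone hz
    obtain ⟨w, rfl⟩ := PsiP.exists_dmk hz v
    have h1 := psiKahler_mk (PsiP.conj_mem_cone hz) fun i => conjL (w i)
    -- the tangent space depends on the base point, which `psiInvolution_mk` changes; generalizing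
    -- the base point and the vectors together avoids a cast
    have h2 : ∀ (y : PsiP ℂ) (a : Fin 2 → Fin 3 → ℂ), y = PsiP.mk (conjL z) →
        (a = fun i => PsiP.dmk (conjL z) (conjL (w i))) →
        psiKahler y a = coneKahler (conjL z) (conjL (w 0)) (conjL (w 1)) := by
      rintro y a rfl rfl; exact h1
    rw [psiKahler_mk hz, ← coneKahler_conjL]
    exact h2 _ _ (psiInvolution_mk hz) (funext fun i => mfderiv_psiInvolution hz (w i))
  pullback_volume x v := by
    obtain ⟨z, hz, rfl⟩ := PsiP.exists_mk x
    have hz := PsiP.psiSphere_subset_cone hz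
    obtain ⟨w, rfl⟩ := PsiP.exists_dmk hz v
    have h1 := psiVolume_mk (PsiP.conj_mem_cone hz) fun i => conjL (w i)
    have h2 : ∀ (y : PsiP ℂ) (a : Fin 3 → Fin 3 → ℂ), y = PsiP.mk (conjL z) →
        (a = fun i => PsiP.dmk (conjL z) (conjL (w i))) →
        psiVolume y a = coneVolume (conjL z) (conjL (w 0)) (conjL (w 1)) (conjL (w 2)) := by
      rintro y a rfl rfl; exact h1
    rw [psiVolume_mk hz, ← coneVolume_conjL]
    exact h2 _ _ (psiInvolution_mk hz) (funext fun i => mfderiv_psiInvolution hz (w i))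

/-! ### The real points -/

/-- The inclusion `ℝ⁴ → ℂ⁴`. -/
def ofRealL : (Fin 4 → ℝ) →L[ℝ] (Fin 4 → ℂ) :=
  ContinuousLinearMap.pi fun k =>
    Complex.ofRealCLM ∘L (ContinuousLinearMap.proj k : (Fin 4 → ℝ) →L[ℝ] ℝ)

theorem ofRealL_apply (x : Fin 4 → ℝ) : ofRealL x = fun k => (x k : ℂ) := rfl

theorem conjL_ofRealL (x : Fin 4 → ℝ) : conjL (ofRealL x) = ofRealL x := by
  funext k
  exact Complex.conj_ofReal _

theorem psiQ_ofRealL (x : Fin 4 → ℝ) : psiQ (ofRealL x) = psiQ x := by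
  simp [psiQ, ofRealL_apply]

theorem PsiP.ofRealL_mem_cone {x : Fin 4 → ℝ} (hx : x ∈ PsiP.cone ℝ) :
    ofRealL x ∈ PsiP.cone ℂ := by
  change 0 < psiQ _
  rw [psiQ_ofRealL]; exact hx

theorem psiRealIncl_mk {x : Fin 4 → ℝ} (hx : x ∈ PsiP.cone ℝ) :
    psiRealIncl (PsiP.mk x) = PsiP.mk (ofRealL x) := by
  rw [PsiP.mk_of_pos x hx, PsiP.mk_of_pos (ofRealL x) (PsiP.ofRealL_mem_cone hx)]
  change PsiP.proj _ = _
  congr 1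
  refine Subtype.ext ?_
  funext k
  change ((((Real.sqrt (psiQ x))⁻¹ : ℝ) * x k : ℝ) : ℂ) =
    (((Real.sqrt (psiQ (ofRealL x)))⁻¹ : ℝ) : ℂ) * (x k : ℂ)
  rw [psiQ_ofRealL, Complex.ofReal_mul]

theorem contMDiff_psiRealIncl :
    ContMDiff 𝓘(ℝ, Fin 3 → ℝ) 𝓘(ℝ, Fin 3 → ℂ) ∞ psiRealIncl := by
  refine PsiP.contMDiff_of_comp_mk ?_
  have h : ContMDiffOn 𝓘(ℝ, Fin 4 → ℝ) 𝓘(ℝ, Fin 3 → ℂ) ∞ (fun z => PsiP.mk (ofRealL z))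
      (PsiP.cone ℝ) :=
    PsiP.contMDiffOn_mk.comp ofRealL.contDiff.contMDiff.contMDiffOn fun z hz =>
      PsiP.ofRealL_mem_cone hz
  exact h.congr fun z hz => psiRealIncl_mk hz

theorem mfderiv_psiRealIncl {x : Fin 4 → ℝ} (hx : x ∈ PsiP.cone ℝ) (v : Fin 4 → ℝ) :
    (mfderiv 𝓘(ℝ, Fin 3 → ℝ) 𝓘(ℝ, Fin 3 → ℂ) psiRealIncl (PsiP.mk x) (PsiP.dmk x v) :
      Fin 3 → ℂ) = (PsiP.dmk (ofRealL x) (ofRealL v) : Fin 3 → ℂ) := by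
  have hev : (fun w => psiRealIncl (PsiP.mk w)) =ᶠ[𝓝 x] fun w => PsiP.mk (ofRealL w) := by
    filter_upwards [PsiP.isOpen_cone.mem_nhds hx] with w hw
    exact psiRealIncl_mk hw
  refine (PsiP.mfderiv_comp_mk hx
    (contMDiff_psiRealIncl.mdifferentiableAt (by simp)) v).trans ?_
  refine (DFunLike.congr_fun hev.mfderiv_eq v).trans ?_
  exact PsiP.mfderiv_mk_comp ofRealL.hasFDerivAt (PsiP.ofRealL_mem_cone hx) v

/-- A point fixed by the involution has a representative `z` with `z̄ = c z`, `|c| = 1`, and is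
made real by a square root of `c`. -/
theorem fixedPoints_psiInvolution : {x | psiInvolution x = x} = Set.range psiRealIncl := by
  ext x
  constructor
  · intro hx
    obtain ⟨z, hz, rfl⟩ := PsiP.exists_mk x
    have hzc := PsiP.psiSphere_subset_cone hz
    have hx' : psiInvolution (PsiP.mk z) = PsiP.mk z := hx
    have hq : psiQ z = 1 := hz
    have hcz : conjL z ∈ PsiSphere ℂ := by
      change psiQ _ = 1
      rw [psiQ_conjL]; exact hz
    rw [psiInvolution_mk hzc, PsiP.mk_eq_proj ⟨_, hcz⟩, PsiP.mk_eq_proj ⟨_, hz⟩,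
      PsiP.proj_eq_iff] at hx'
    obtain ⟨c, hc, hcz'⟩ := hx'
    obtain ⟨d, hd⟩ := IsAlgClosed.exists_pow_nat_eq c (n := 2) (by norm_num)
    have hdn : ‖d‖ = 1 := by
      have : ‖d‖ ^ 2 = 1 := by rw [← norm_pow, hd, hc]
      nlinarith [norm_nonneg d]
    have hdd : conj d * d = 1 := by
      rw [← Complex.normSq_eq_conj_mul_self, Complex.normSq_eq_norm_sq, hdn]; simp
    have hd0 : conj d ≠ 0 := left_ne_zero_of_mul_eq_one hdd
    have hreal : ∀ k, (((conj d * z k).re : ℝ) : ℂ) = conj d * z k := by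
      intro k
      rw [← Complex.conj_eq_iff_re]
      have hk : z k = c * conj (z k) := congrFun hcz' k
      rw [map_mul, Complex.conj_conj]
      calc d * conj (z k) = (conj d * d) * d * conj (z k) := by rw [hdd, one_mul]
        _ = conj d * (c * conj (z k)) := by rw [← hd]; ring
        _ = conj d * z k := by rw [← hk]
    have hw : ofRealL (fun k => (conj d * z k).re) = conj d • z := funext hreal
    have hx0 : (fun k => (conj d * z k).re) ∈ PsiP.cone ℝ := by
      change 0 < psiQ _
      rw [← psiQ_ofRealL, hw, psiQ_smul, hq]
      have := norm_pos_iff.2 hd0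
      positivity
    refine ⟨PsiP.mk fun k => (conj d * z k).re, ?_⟩
    rw [psiRealIncl_mk hx0, hw, PsiP.mk_eq_mk_smul hzc hd0]
  · rintro ⟨y, rfl⟩
    obtain ⟨x, hx, rfl⟩ := PsiP.exists_mk y
    have hx := PsiP.psiSphere_subset_cone hx
    change psiInvolution _ = _
    rw [psiRealIncl_mk hx, psiInvolution_mk (PsiP.ofRealL_mem_cone hx), conjL_ofRealL]

/-- On vectors fixed by conjugation `Ω = -Ω`. -/
theorem psiKahler_real (y : PsiP ℝ) (v : Fin 2 → TangentSpace 𝓘(ℝ, Fin 3 → ℝ) y) :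
    psiKahler (psiRealIncl y) (fun i =>
      mfderiv 𝓘(ℝ, Fin 3 → ℝ) 𝓘(ℝ, Fin 3 → ℂ) psiRealIncl y (v i)) = 0 := by
  obtain ⟨x, hx, rfl⟩ := PsiP.exists_mk y
  have hx := PsiP.psiSphere_subset_cone hx
  obtain ⟨w, rfl⟩ := PsiP.exists_dmk hx v
  have h1 := psiKahler_mk (PsiP.ofRealL_mem_cone hx) fun i => ofRealL (w i)
  -- as the tangent space depends on the base point, both are generalized together
  have h2 : ∀ (y : PsiP ℂ) (a : Fin 2 → Fin 3 → ℂ), y = PsiP.mk (ofRealL x) →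
      (a = fun i => PsiP.dmk (ofRealL x) (ofRealL (w i))) →
      psiKahler y a = coneKahler (ofRealL x) (ofRealL (w 0)) (ofRealL (w 1)) := by
    rintro y a rfl rfl; exact h1
  refine (h2 _ _ (psiRealIncl_mk hx) (funext fun i => mfderiv_psiRealIncl hx (w i))).trans ?_
  have h3 := coneKahler_conjL (ofRealL x) (ofRealL (w 0)) (ofRealL (w 1))
  simp only [conjL_ofRealL] at h3
  linarith

theorem psiVolume_real_im (y : PsiP ℝ) (v : Fin 3 → TangentSpace 𝓘(ℝ, Fin 3 → ℝ) y) :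
    (psiVolume (psiRealIncl y) (fun i =>
      mfderiv 𝓘(ℝ, Fin 3 → ℝ) 𝓘(ℝ, Fin 3 → ℂ) psiRealIncl y (v i))).im = 0 := by
  obtain ⟨x, hx, rfl⟩ := PsiP.exists_mk y
  have hx := PsiP.psiSphere_subset_cone hx
  obtain ⟨w, rfl⟩ := PsiP.exists_dmk hx v
  have h1 := psiVolume_mk (PsiP.ofRealL_mem_cone hx) fun i => ofRealL (w i)
  have h2 : ∀ (y : PsiP ℂ) (a : Fin 3 → Fin 3 → ℂ), y = PsiP.mk (ofRealL x) →
      (a = fun i => PsiP.dmk (ofRealL x) (ofRealL (w i))) →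
      psiVolume y a = coneVolume (ofRealL x) (ofRealL (w 0)) (ofRealL (w 1)) (ofRealL (w 2)) := by
    rintro y a rfl rfl; exact h1
  have h4 := h2 _ _ (psiRealIncl_mk hx) (funext fun i => mfderiv_psiRealIncl hx (w i))
  refine (congrArg Complex.im h4).trans ?_
  have h3 := coneVolume_conjL (ofRealL x) (ofRealL (w 0)) (ofRealL (w 1)) (ofRealL (w 2))
  simp only [conjL_ofRealL] at h3
  exact Complex.conj_eq_iff_im.1 h3.symm

theorem stdMetric_kahler (v w : Fin 3 → ℂ) :
    ∑ k, conj (v k) * w k = ⟨stdMetric v w, stdKahler ![v, w]⟩ := by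
  apply Complex.ext
  · rw [Complex.re_sum]; rfl
  · rw [Complex.im_sum]; rfl

/-- Orthonormal vectors of `ℂ³` that span an isotropic subspace for the Kähler form are unitary. -/
theorem normSq_det_of_orthonormal (u : Fin 3 → Fin 3 → ℂ)
    (h1 : ∀ i j, stdMetric (u i) (u j) = if i = j then 1 else 0)
    (h2 : ∀ i j, stdKahler ![u i, u j] = 0) : Complex.normSq (stdVolume u) = 1 := by
  have h : (Matrix.of u).map conj * (Matrix.of u).transpose = 1 := by
    ext i j
    rw [Matrix.mul_apply, Matrix.one_apply]
    refine (stdMetric_kahler (u i) (u j)).trans ?_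
    rw [h1, h2]
    split_ifs <;> rfl
  have hdet := congrArg Matrix.det h
  rw [Matrix.det_mul, Matrix.det_transpose, Matrix.det_one] at hdet
  have h3 : ((Matrix.of u).map conj).det = conj (Matrix.of u).det :=
    (RingHom.map_det (starRingEnd ℂ) (Matrix.of u)).symm
  rw [h3, ← Complex.normSq_eq_conj_mul_self] at hdet
  exact_mod_cast hdet

theorem psiVolume_real_calibrated (y : PsiP ℝ) (v : Fin 3 → TangentSpace 𝓘(ℝ, Fin 3 → ℝ) y)
    (hv : ∀ i j, psiMetric (psiRealIncl y)
      (mfderiv 𝓘(ℝ, Fin 3 → ℝ) 𝓘(ℝ, Fin 3 → ℂ) psiRealIncl y (v i))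
      (mfderiv 𝓘(ℝ, Fin 3 → ℝ) 𝓘(ℝ, Fin 3 → ℂ) psiRealIncl y (v j)) = if i = j then 1 else 0) :
    |(psiVolume (psiRealIncl y) (fun i =>
      mfderiv 𝓘(ℝ, Fin 3 → ℝ) 𝓘(ℝ, Fin 3 → ℂ) psiRealIncl y (v i))).re| = 1 := by
  have h0 := psiVolume_real_im y v
  have h1 := normSq_det_of_orthonormal (fun i => psiCoframe (psiRealIncl y)
    (mfderiv 𝓘(ℝ, Fin 3 → ℝ) 𝓘(ℝ, Fin 3 → ℂ) psiRealIncl y (v i))) hv (fun i j => by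
      have := psiKahler_real y ![v i, v j]
      have e : ![psiCoframe (psiRealIncl y)
            (mfderiv 𝓘(ℝ, Fin 3 → ℝ) 𝓘(ℝ, Fin 3 → ℂ) psiRealIncl y (v i)),
          psiCoframe (psiRealIncl y)
            (mfderiv 𝓘(ℝ, Fin 3 → ℝ) 𝓘(ℝ, Fin 3 → ℂ) psiRealIncl y (v j))] =
          fun k => psiCoframe (psiRealIncl y)
            (mfderiv 𝓘(ℝ, Fin 3 → ℝ) 𝓘(ℝ, Fin 3 → ℂ) psiRealIncl y (![v i, v j] k)) := by
        funext k
        fin_cases k <;> rfl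
      exact (congrArg stdKahler e).trans this)
  change Complex.normSq (psiVolume (psiRealIncl y) (fun i =>
      mfderiv 𝓘(ℝ, Fin 3 → ℝ) 𝓘(ℝ, Fin 3 → ℂ) psiRealIncl y (v i))) = 1 at h1
  rw [Complex.normSq_apply, h0, mul_zero, add_zero] at h1
  rw [← sq_eq_sq₀ (abs_nonneg _) zero_le_one, sq_abs, sq, h1, one_pow]

/-! ### The embedding of the real points -/

/-- The decomposition `ℂ³ = ℝ³ + i ℝ³`. -/
def realPartsEquiv : ((Fin 3 → ℝ) × (Fin 3 → ℝ)) ≃L[ℝ] (Fin 3 → ℂ) :=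
  LinearEquiv.toContinuousLinearEquiv
    { toFun := fun p k => ⟨p.1 k, p.2 k⟩
      invFun := fun u => (fun k => (u k).re, fun k => (u k).im)
      map_add' := fun _ _ => rfl
      map_smul' := fun c p => by
        funext k
        apply Complex.ext <;> simp
      left_inv := fun _ => rfl
      right_inv := fun _ => rfl }

theorem psiRealIncl_mem_source {b : Bool} {y : PsiP ℝ} :
    psiRealIncl y ∈ (PsiP.chart ℂ b).source ↔ y ∈ (PsiP.chart ℝ b).source := by
  obtain ⟨x, hx, rfl⟩ := PsiP.exists_mk y
  have hx := PsiP.psiSphere_subset_cone hx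
  rw [psiRealIncl_mk hx, PsiP.mk_mem_source_iff b hx,
    PsiP.mk_mem_source_iff b (PsiP.ofRealL_mem_cone hx)]
  simp [ofRealL_apply]

theorem chart_psiRealIncl {b : Bool} {y : PsiP ℝ} :
    PsiP.chart ℂ b (psiRealIncl y) = fun k => (PsiP.chart ℝ b y k : ℂ) := by
  obtain ⟨x, hx, rfl⟩ := PsiP.exists_mk y
  have hx := PsiP.psiSphere_subset_cone hx
  rw [psiRealIncl_mk hx, PsiP.chart_mk b hx, PsiP.chart_mk b (PsiP.ofRealL_mem_cone hx)]
  funext k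
  fin_cases k <;> simp [ofRealL_apply]

theorem PsiP.chart_mem_maximalAtlas {𝕜 : Type} [RCLike 𝕜] (b : Bool) :
    PsiP.chart 𝕜 b ∈ IsManifold.maximalAtlas 𝓘(ℝ, Fin 3 → 𝕜) ∞ (PsiP 𝕜) :=
  IsManifold.subset_maximalAtlas ⟨b, rfl⟩

/-- In the affine charts, the inclusion of the real points is `ℝ³ → ℂ³ = ℝ³ + i ℝ³`. -/
theorem isImmersion_psiRealIncl :
    Manifold.IsImmersion 𝓘(ℝ, Fin 3 → ℝ) 𝓘(ℝ, Fin 3 → ℂ) ∞ psiRealIncl := by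
  refine Manifold.IsImmersionOfComplement.isImmersion (F := Fin 3 → ℝ) fun y => ?_
  refine Manifold.IsImmersionAtOfComplement.mk_of_charts realPartsEquiv
    (PsiP.chart ℝ (PsiP.chartIdx y)) (PsiP.chart ℂ (PsiP.chartIdx y)) (PsiP.mem_chart_source y)
    (psiRealIncl_mem_source.2 (PsiP.mem_chart_source y)) (PsiP.chart_mem_maximalAtlas _)
    (PsiP.chart_mem_maximalAtlas _) (fun x hx => psiRealIncl_mem_source.2 hx) ?_
  intro u hu
  have hu' : u ∈ (PsiP.chart ℝ (PsiP.chartIdx y)).target := by simpa using hu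
  have h : PsiP.chart ℂ (PsiP.chartIdx y)
      (psiRealIncl ((PsiP.chart ℝ (PsiP.chartIdx y)).symm u)) = fun k => (u k : ℂ) := by
    rw [chart_psiRealIncl, (PsiP.chart ℝ (PsiP.chartIdx y)).right_inv hu']
  exact h

/-- In the affine charts, taking real parts is a continuous left inverse of the inclusion of the
real points. -/
theorem isEmbedding_psiRealIncl : Topology.IsEmbedding psiRealIncl := by
  have key : ∀ y : PsiP ℝ, ∃ r : PsiP ℂ → PsiP ℝ, ContinuousAt r (psiRealIncl y) ∧
      ∀ y' ∈ (PsiP.chart ℝ (PsiP.chartIdx y)).source, r (psiRealIncl y') = y' := by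
    intro y
    set b := PsiP.chartIdx y
    have hy : y ∈ (PsiP.chart ℝ b).source := PsiP.mem_chart_source y
    refine ⟨fun x => (PsiP.chart ℝ b).symm fun k => (PsiP.chart ℂ b x k).re, ?_, ?_⟩
    · have h1 := (PsiP.chart ℂ b).continuousAt (psiRealIncl_mem_source.2 hy)
      have h2 : Continuous fun u : Fin 3 → ℂ => fun k => (u k).re :=
        continuous_pi fun k => Complex.continuous_re.comp (continuous_apply k)
      have h3 : (fun k => (PsiP.chart ℂ b (psiRealIncl y) k).re) = PsiP.chart ℝ b y := by
        rw [chart_psiRealIncl]; rfl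
      have h4 : ContinuousAt (PsiP.chart ℝ b).symm
          (fun k => (PsiP.chart ℂ b (psiRealIncl y) k).re) := by
        rw [h3]
        exact (PsiP.chart ℝ b).symm.continuousAt ((PsiP.chart ℝ b).map_source hy)
      exact ContinuousAt.comp (f := fun x => fun k => (PsiP.chart ℂ b x k).re) h4
        (h2.continuousAt.comp h1)
    · intro y' hy'
      have h3 : (fun k => (PsiP.chart ℂ b (psiRealIncl y') k).re) = PsiP.chart ℝ b y' := by
        rw [chart_psiRealIncl]; rfl
      exact (congrArg (PsiP.chart ℝ b).symm h3).trans ((PsiP.chart ℝ b).left_inv hy')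
  refine ⟨Topology.isInducing_iff_nhds.2 fun y => le_antisymm
    contMDiff_psiRealIncl.continuous.continuousAt.le_comap ?_, fun y y' h => ?_⟩
  · obtain ⟨r, hr, hry⟩ := key y
    intro s hs
    rw [Filter.mem_comap]
    refine ⟨r ⁻¹' s ∩ (PsiP.chart ℂ (PsiP.chartIdx y)).source, Filter.inter_mem
      (hr (by rw [hry y (PsiP.mem_chart_source y)]; exact hs))
      ((PsiP.chart ℂ _).open_source.mem_nhds
        (psiRealIncl_mem_source.2 (PsiP.mem_chart_source y))), ?_⟩
    rintro x ⟨hx1, hx2⟩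
    rw [← hry x (psiRealIncl_mem_source.1 hx2)]
    exact hx1
  · obtain ⟨r, -, hry⟩ := key y
    have hy' : y' ∈ (PsiP.chart ℝ (PsiP.chartIdx y)).source := by
      rw [← psiRealIncl_mem_source, ← h]
      exact psiRealIncl_mem_source.2 (PsiP.mem_chart_source y)
    rw [← hry y (PsiP.mem_chart_source y), ← hry y' hy', h]

theorem isSpecialLagrangian_psiRealIncl :
    IsSpecialLagrangian (E' := Fin 3 → ℝ) psiMetric psiKahler psiVolume psiRealIncl where
  embedding := ⟨isImmersion_psiRealIncl, isEmbedding_psiRealIncl⟩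
  finrank_eq := by simp
  calibrated := psiVolume_real_calibrated
  kahler_eq_zero := psiKahler_real
  im_volume_eq_zero := psiVolume_real_im

/-! ### The twistor fibration in the ball model -/

/-- The ball coordinate `q p⁻¹` as a function on the cone of `ℂ⁴ = ℍ²`. -/
def coneBall (z : Fin 4 → ℂ) : ℍ[ℝ] := (toQuat z).2 * (toQuat z).1⁻¹

theorem toQuat_fst_ne_zero {z : Fin 4 → ℂ} (hz : z ∈ PsiP.cone ℂ) : (toQuat z).1 ≠ 0 := by
  intro h
  have h1 : 0 < psiQ z := hz
  rw [← ofQuat_toQuat z, psiQ_ofQuat, h, map_zero] at h1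
  have := Quaternion.normSq_nonneg (a := (toQuat z).2)
  linarith

theorem ballCoord_twistorMap_mk {z : Fin 4 → ℂ} (hz : z ∈ PsiP.cone ℂ) :
    PsiHP1.ballCoord (twistorMap (PsiP.mk z)) = coneBall z := by
  have hs : (((Real.sqrt (psiQ z))⁻¹ : ℝ) : ℂ) ≠ 0 :=
    Complex.ofReal_ne_zero.2 (inv_ne_zero (Real.sqrt_pos.2 hz).ne')
  have hs' : ((((Real.sqrt (psiQ z))⁻¹ : ℝ) : ℂ) : ℍ[ℝ]) ≠ 0 := by
    rw [← norm_pos_iff, norm_coe_complex]; exact norm_pos_iff.2 hs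
  rw [PsiP.mk_of_pos z hz]
  change (toQuat ((((Real.sqrt (psiQ z))⁻¹ : ℝ) : ℂ) • z)).2 *
    (toQuat ((((Real.sqrt (psiQ z))⁻¹ : ℝ) : ℂ) • z)).1⁻¹ = _
  rw [PsiHP1.toQuat_smul, coneBall]
  simp only [mul_inv_rev]
  rw [mul_assoc, mul_inv_cancel_left₀ hs']

theorem contDiffAt_coneBall {z : Fin 4 → ℂ} (hz : z ∈ PsiP.cone ℂ) :
    ContDiffAt ℝ ∞ coneBall z := by
  have h2 : ContDiff ℝ ∞ fun z : Fin 4 → ℂ => (toQuat z).2 := toQuatL.contDiff.snd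
  have h1 : ContDiff ℝ ∞ fun z : Fin 4 → ℂ => (toQuat z).1 := toQuatL.contDiff.fst
  have h3 : ContDiffAt ℝ ∞ (Inv.inv : ℍ[ℝ] → ℍ[ℝ]) (toQuat z).1 := by
    have h := contDiffAt_ringInverse ℝ (n := ∞) (Units.mk0 _ (toQuat_fst_ne_zero hz))
    rw [Ring.inverse_eq_inv'] at h
    exact h
  exact h2.contDiffAt.mul (h3.comp z h1.contDiffAt)

theorem fderiv_coneBall {z : Fin 4 → ℂ} (hz : z ∈ PsiP.cone ℂ) (v : Fin 4 → ℂ) :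
    fderiv ℝ coneBall z v = (toQuat v).2 * (toQuat z).1⁻¹ -
      (toQuat z).2 * ((toQuat z).1⁻¹ * (toQuat v).1 * (toQuat z).1⁻¹) := by
  have h2 : HasFDerivAt (fun z : Fin 4 → ℂ => (toQuat z).2)
      (ContinuousLinearMap.snd ℝ ℍ[ℝ] ℍ[ℝ] ∘L toQuatL) z :=
    (ContinuousLinearMap.snd ℝ ℍ[ℝ] ℍ[ℝ] ∘L toQuatL).hasFDerivAt
  have h1 : HasFDerivAt (fun z : Fin 4 → ℂ => (toQuat z).1)
      (ContinuousLinearMap.fst ℝ ℍ[ℝ] ℍ[ℝ] ∘L toQuatL) z :=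
    (ContinuousLinearMap.fst ℝ ℍ[ℝ] ℍ[ℝ] ∘L toQuatL).hasFDerivAt
  have h3 := h2.mul' ((hasFDerivAt_inv' (𝕜 := ℝ) (toQuat_fst_ne_zero hz)).comp z h1)
  have h4 := DFunLike.congr_fun h3.fderiv v
  refine Eq.trans h4 ?_
  change (toQuat z).2 * -((toQuat z).1⁻¹ * (toQuat v).1 * (toQuat z).1⁻¹) +
    (toQuat v).2 * (toQuat z).1⁻¹ = _
  rw [mul_neg, neg_add_eq_sub]

theorem contMDiff_ballCoord : ContMDiff 𝓘(ℝ, ℍ[ℝ]) 𝓘(ℝ, ℍ[ℝ]) ∞ PsiHP1.ballCoord := fun y =>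
  contMDiffAt_extChartAt (I := 𝓘(ℝ, ℍ[ℝ])) (n := ∞) (x := y)

theorem ballCoord_injective : Function.Injective PsiHP1.ballCoord := fun y y' h => by
  rw [← PsiHP1.ofBall_ballCoord y, h, PsiHP1.ofBall_ballCoord]

theorem norm_ballCoord_lt (y : PsiHP1) : ‖PsiHP1.ballCoord y‖ < 1 :=
  mem_ball_zero_iff.1 (PsiHP1.ballChart.map_source (Set.mem_univ y))

/-- A continuous map into `H⁴` is smooth if it is smooth in the ball model. -/
theorem contMDiffAt_of_ballCoord_comp {E : Type*} [NormedAddCommGroup E] [NormedSpace ℝ E]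
    {H : Type*} [TopologicalSpace H] {I : ModelWithCorners ℝ E H} {M : Type*} [TopologicalSpace M]
    [ChartedSpace H M] {F : M → PsiHP1} {x : M} (hF : ContinuousAt F x)
    (h : ContMDiffAt I 𝓘(ℝ, ℍ[ℝ]) ∞ (fun x => PsiHP1.ballCoord (F x)) x) :
    ContMDiffAt I 𝓘(ℝ, ℍ[ℝ]) ∞ F x :=
  contMDiffAt_iff_target.2 ⟨hF, h⟩

theorem contMDiff_twistorMap : ContMDiff 𝓘(ℝ, Fin 3 → ℂ) 𝓘(ℝ, ℍ[ℝ]) ∞ twistorMap := by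
  refine PsiP.contMDiff_of_comp_mk fun z hz => ContMDiffAt.contMDiffWithinAt ?_
  have hev : (fun w => PsiHP1.ballCoord (twistorMap (PsiP.mk w))) =ᶠ[𝓝 z] coneBall := by
    filter_upwards [PsiP.isOpen_cone.mem_nhds hz] with w hw
    exact ballCoord_twistorMap_mk hw
  exact contMDiffAt_of_ballCoord_comp (PsiHP1.continuous_twistorMap.continuousAt.comp
    (PsiP.mdifferentiableAt_mk hz).continuousAt)
    ((contDiffAt_coneBall hz).contMDiffAt.congr_of_eventuallyEq hev)

/-- The differential of the twistor map in the ball model. -/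
theorem mfderiv_ballCoord_twistorMap {z : Fin 4 → ℂ} (hz : z ∈ PsiP.cone ℂ) (v : Fin 4 → ℂ) :
    mfderiv 𝓘(ℝ, ℍ[ℝ]) 𝓘(ℝ, ℍ[ℝ]) PsiHP1.ballCoord (twistorMap (PsiP.mk z))
      (mfderiv 𝓘(ℝ, Fin 3 → ℂ) 𝓘(ℝ, ℍ[ℝ]) twistorMap (PsiP.mk z) (PsiP.dmk z v)) =
        fderiv ℝ coneBall z v := by
  have hev : (fun w => PsiHP1.ballCoord (twistorMap (PsiP.mk w))) =ᶠ[𝓝 z] coneBall := by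
    filter_upwards [PsiP.isOpen_cone.mem_nhds hz] with w hw
    exact ballCoord_twistorMap_mk hw
  have hT : MDifferentiableAt 𝓘(ℝ, Fin 3 → ℂ) 𝓘(ℝ, ℍ[ℝ]) twistorMap (PsiP.mk z) :=
    contMDiff_twistorMap.mdifferentiableAt (by simp)
  have hB : MDifferentiableAt 𝓘(ℝ, ℍ[ℝ]) 𝓘(ℝ, ℍ[ℝ]) PsiHP1.ballCoord
      (twistorMap (PsiP.mk z)) := contMDiff_ballCoord.mdifferentiableAt (by simp)
  have h1 := mfderiv_comp (PsiP.mk z) hB hT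
  have h2 := PsiP.mfderiv_comp_mk hz (hB.comp (PsiP.mk z) hT) v
  have h3 : mfderiv 𝓘(ℝ, Fin 4 → ℂ) 𝓘(ℝ, ℍ[ℝ])
      (fun w => PsiHP1.ballCoord (twistorMap (PsiP.mk w))) z v = fderiv ℝ coneBall z v := by
    rw [hev.mfderiv_eq, mfderiv_eq_fderiv]
    rfl
  refine Eq.trans ?_ (h2.trans h3)
  exact (DFunLike.congr_fun h1 (PsiP.dmk z v)).symm

theorem hypMetric_twistorMap {z : Fin 4 → ℂ} (hz : z ∈ PsiP.cone ℂ) (v : Fin 4 → ℂ) :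
    hypMetric (twistorMap (PsiP.mk z))
      (mfderiv 𝓘(ℝ, Fin 3 → ℂ) 𝓘(ℝ, ℍ[ℝ]) twistorMap (PsiP.mk z) (PsiP.dmk z v))
      (mfderiv 𝓘(ℝ, Fin 3 → ℂ) 𝓘(ℝ, ℍ[ℝ]) twistorMap (PsiP.mk z) (PsiP.dmk z v)) =
    ‖fderiv ℝ coneBall z v‖ ^ 2 / (1 - ‖coneBall z‖ ^ 2) ^ 2 := by
  rw [hypMetric, mfderiv_ballCoord_twistorMap hz, real_inner_self_eq_norm_sq,
    ballCoord_twistorMap_mk hz]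

namespace PsiFrame

variable (f : PsiFrame)

theorem fst_ne_zero : f.e₁.1 ≠ 0 := by
  have h := toQuat_fst_ne_zero f.e₁_mem_cone
  rwa [toQuat_ofQuat] at h

/-- The ball coordinate of the image of a frame in `H⁴`. -/
def ball : ℍ[ℝ] := f.e₁.2 * f.e₁.1⁻¹

theorem coneBall_eq : coneBall (ofQuat f.e₁) = f.ball := by
  rw [coneBall, toQuat_ofQuat, ball]

theorem ballCoord_twistorMap_proj : PsiHP1.ballCoord (twistorMap f.proj) = f.ball := by
  rw [← coneBall_eq]
  exact ballCoord_twistorMap_mk f.e₁_mem_cone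

theorem norm_sq_of_quatForm {v : ℍ[ℝ] × ℍ[ℝ]} {c : ℝ} (h : quatForm v v = (c : ℍ[ℝ])) :
    ‖v.1‖ ^ 2 - ‖v.2‖ ^ 2 = c := by
  rw [quatForm, Quaternion.star_mul_self, Quaternion.star_mul_self, ← Quaternion.coe_sub,
    Quaternion.coe_inj, Quaternion.normSq_eq_norm_mul_self, Quaternion.normSq_eq_norm_mul_self] at h
  nlinarith

theorem norm_sq_e₁ : ‖f.e₁.1‖ ^ 2 - ‖f.e₁.2‖ ^ 2 = 1 :=
  norm_sq_of_quatForm (by rw [f.form₁₁, Quaternion.coe_one])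

theorem norm_sq_e₂ : ‖f.e₂.1‖ ^ 2 - ‖f.e₂.2‖ ^ 2 = -1 :=
  norm_sq_of_quatForm (by rw [f.form₂₂, Quaternion.coe_neg, Quaternion.coe_one])

/-- Orthogonality of `e₁` and `e₂`, in terms of the ball coordinate. -/
theorem e₂_fst : f.e₂.1 = star f.ball * f.e₂.2 := by
  have h := f.form₁₂
  rw [quatForm, sub_eq_zero] at h
  have hp : star f.e₁.1 ≠ 0 := star_ne_zero.2 f.fst_ne_zero
  rw [ball, star_mul, star_inv₀, mul_assoc, ← h, inv_mul_cancel_left₀ hp]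

theorem one_sub_norm_ball_sq_mul : (1 - ‖f.ball‖ ^ 2) * ‖f.e₁.1‖ ^ 2 = 1 := by
  have h := f.norm_sq_e₁
  have hp := norm_ne_zero_iff.2 f.fst_ne_zero
  rw [ball, norm_mul, norm_inv]
  field_simp
  linarith

theorem norm_e₂_snd : ‖f.e₂.2‖ = ‖f.e₁.1‖ := by
  have h1 := f.one_sub_norm_ball_sq_mul
  have h2 : (1 - ‖f.ball‖ ^ 2) * ‖f.e₂.2‖ ^ 2 = 1 := by
    have h := f.norm_sq_e₂
    rw [f.e₂_fst, norm_mul, Quaternion.norm_star] at h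
    linarith
  have h3 : (1 - ‖f.ball‖ ^ 2) ≠ 0 := left_ne_zero_of_mul_eq_one h1
  have h4 := mul_left_cancel₀ h3 (h2.trans h1.symm)
  exact (pow_left_inj₀ (norm_nonneg _) (norm_nonneg _) two_ne_zero).1 h4

theorem e₂_snd_ne_zero : f.e₂.2 ≠ 0 := by
  rw [← norm_ne_zero_iff, f.norm_e₂_snd]
  exact norm_ne_zero_iff.2 f.fst_ne_zero

/-- In the ball model, the differential of the twistor map takes `e₁ a + e₂ b` to a positive
multiple of `q' b p⁻¹`, where `e₁ = (p, q)` and `e₂ = (p', q')`. -/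
theorem fderiv_coneBall_combo (a b : ℍ[ℝ]) :
    fderiv ℝ coneBall (ofQuat f.e₁) (ofQuat (f.combo a b)) =
      (1 - ‖f.ball‖ ^ 2) • (f.e₂.2 * b * f.e₁.1⁻¹) := by
  have hp := f.fst_ne_zero
  have h1 : f.e₁.2 * f.e₁.1⁻¹ * f.e₂.1 = (‖f.ball‖ ^ 2) • f.e₂.2 := by
    rw [f.e₂_fst, ← mul_assoc]
    change f.ball * star f.ball * f.e₂.2 = _
    rw [Quaternion.self_mul_star, Quaternion.coe_mul_eq_smul, Quaternion.normSq_eq_norm_mul_self,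
      sq]
  rw [fderiv_coneBall f.e₁_mem_cone, toQuat_ofQuat, toQuat_ofQuat, sub_smul, one_smul, combo]
  have h2 : f.e₁.2 * (f.e₁.1⁻¹ * (f.e₁.1 * a + f.e₂.1 * b) * f.e₁.1⁻¹) =
      f.e₁.2 * a * f.e₁.1⁻¹ + f.e₁.2 * f.e₁.1⁻¹ * f.e₂.1 * (b * f.e₁.1⁻¹) := by
    rw [mul_add, inv_mul_cancel_left₀ hp, add_mul, mul_add]
    simp only [mul_assoc]
  rw [h2, h1, add_mul, smul_mul_assoc]
  simp only [mul_assoc]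
  abel

theorem hypMetric_mfderiv (v : ℍ[ℝ] × ℍ[ℝ]) :
    hypMetric (twistorMap f.proj)
        (mfderiv 𝓘(ℝ, Fin 3 → ℂ) 𝓘(ℝ, ℍ[ℝ]) twistorMap f.proj (f.dproj v))
        (mfderiv 𝓘(ℝ, Fin 3 → ℂ) 𝓘(ℝ, ℍ[ℝ]) twistorMap f.proj (f.dproj v)) =
      ‖f.omega v 0‖ ^ 2 + ‖f.omega v 1‖ ^ 2 := by
  obtain ⟨a, b, rfl⟩ := f.exists_combo v
  have h1 := hypMetric_twistorMap f.e₁_mem_cone (ofQuat (f.combo a b))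
  rw [← dproj_apply] at h1
  refine h1.trans ?_
  have h2 := f.one_sub_norm_ball_sq_mul
  have hpos : 1 - ‖f.ball‖ ^ 2 ≠ 0 := left_ne_zero_of_mul_eq_one h2
  have hp := norm_ne_zero_iff.2 f.fst_ne_zero
  rw [f.fderiv_coneBall_combo, f.coneBall_eq, norm_smul, norm_mul, norm_mul, norm_inv,
    f.norm_e₂_snd, f.omega_combo, mul_pow, Real.norm_eq_abs, sq_abs, mul_div_cancel_left₀ _
    (pow_ne_zero 2 hpos)]
  have h3 : ‖b‖ ^ 2 = ‖quatZ b‖ ^ 2 + ‖quatW b‖ ^ 2 := by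
    rw [← normSq_quatOf, quatOf_quatZ_quatW, Quaternion.normSq_eq_norm_mul_self, sq]
  have h4 : ‖f.e₁.1‖ * ‖b‖ * ‖f.e₁.1‖⁻¹ = ‖b‖ := by field_simp
  rw [h4, h3]
  rfl

end PsiFrame

/-! ### Orthogonal complex structures of `ℍ` -/

/-- The determinant of four quaternions, in the coordinates that define the orientation. -/
theorem det_quat_rows (a b c d : ℍ[ℝ]) :
    Matrix.det (Matrix.of fun i : Fin 4 =>
      (fun q : ℍ[ℝ] => ![q.re, q.imI, q.imJ, -q.imK]) (![a, b, c, d] i)) =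
    -(a.re * (b.imI * (c.imJ * d.imK - c.imK * d.imJ) - b.imJ * (c.imI * d.imK - c.imK * d.imI) +
        b.imK * (c.imI * d.imJ - c.imJ * d.imI)) -
      a.imI * (b.re * (c.imJ * d.imK - c.imK * d.imJ) - b.imJ * (c.re * d.imK - c.imK * d.re) +
        b.imK * (c.re * d.imJ - c.imJ * d.re)) +
      a.imJ * (b.re * (c.imI * d.imK - c.imK * d.imI) - b.imI * (c.re * d.imK - c.imK * d.re) +
        b.imK * (c.re * d.imI - c.imI * d.re)) -
      a.imK * (b.re * (c.imI * d.imJ - c.imJ * d.imI) - b.imI * (c.re * d.imJ - c.imJ * d.re) +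
        b.imJ * (c.re * d.imI - c.imI * d.re))) := by
  rw [Matrix.det_succ_row_zero, Fin.sum_univ_four]
  simp [Matrix.det_fin_three, Fin.succAbove]
  ring

/-- Right multiplication by a quaternion. -/
def rightMul (u : ℍ[ℝ]) : ℍ[ℝ] →L[ℝ] ℍ[ℝ] := (ContinuousLinearMap.mul ℝ ℍ[ℝ]).flip u

theorem rightMul_apply (u ξ : ℍ[ℝ]) : rightMul u ξ = ξ * u := rfl

theorem Quaternion.norm_sq_eq (u : ℍ[ℝ]) :
    ‖u‖ ^ 2 = u.re ^ 2 + u.imI ^ 2 + u.imJ ^ 2 + u.imK ^ 2 := by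
  rw [sq ‖u‖, ← Quaternion.normSq_eq_norm_mul_self, Quaternion.normSq_def']

theorem Quaternion.real_inner_eq (u v : ℍ[ℝ]) :
    @inner ℝ ℍ[ℝ] _ u v = u.re * v.re + u.imI * v.imI + u.imJ * v.imJ + u.imK * v.imK := by
  rw [Quaternion.inner_def]
  simp

theorem Quaternion.sq_eq_neg_one {u : ℍ[ℝ]} (h0 : u.re = 0) (h1 : ‖u‖ = 1) : u * u = -1 := by
  have h := Quaternion.norm_sq_eq u
  rw [h1, h0] at h
  ext <;> simp [h0] <;> nlinarith

/-- Right multiplication by an imaginary unit is a positive orthogonal complex structure: the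
determinant of `(ξ, ξ u, η, η u)` is the square of the length of `u × Im (ξ̄ η)`. -/
theorem isOrthComplexStructure_rightMul {u : ℍ[ℝ]} (h0 : u.re = 0) (h1 : ‖u‖ = 1) :
    IsOrthComplexStructure (rightMul u) where
  sq ξ := by
    rw [rightMul_apply, rightMul_apply, mul_assoc, Quaternion.sq_eq_neg_one h0 h1, mul_neg_one]
  norm_map ξ := by rw [rightMul_apply, norm_mul, h1, mul_one]
  oriented ξ η := by
    rw [det_quat_rows]
    set m := star ξ * η
    have e : ∀ x : ℝ, x = (u.imJ * m.imK - u.imK * m.imJ) ^ 2 +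
        (u.imK * m.imI - u.imI * m.imK) ^ 2 + (u.imI * m.imJ - u.imJ * m.imI) ^ 2 → 0 ≤ x := by
      rintro x rfl; positivity
    refine e _ ?_
    simp only [m, rightMul_apply, Quaternion.re_mul, Quaternion.imI_mul, Quaternion.imJ_mul,
      Quaternion.imK_mul, h0, Quaternion.re_star, Quaternion.imI_star, Quaternion.imJ_star,
      Quaternion.imK_star]
    ring

/-- On vectors orthogonal to `1` and `u`, the condition to be orthogonal leaves two choices
`± η u` for `J η`, and the orientation selects one. -/
theorem eq_mul_of_orthogonal {u η x : ℍ[ℝ]} (hu0 : u.re = 0) (hu1 : ‖u‖ = 1) (hη0 : η.re = 0)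
    (hηu : @inner ℝ ℍ[ℝ] _ η u = 0) (hx0 : x.re = 0) (hxu : @inner ℝ ℍ[ℝ] _ x u = 0)
    (hxη : @inner ℝ ℍ[ℝ] _ x η = 0) (hn : ‖x‖ = ‖η‖)
    (hor : 0 ≤ Matrix.det (Matrix.of fun i : Fin 4 =>
      (fun q : ℍ[ℝ] => ![q.re, q.imI, q.imJ, -q.imK]) (![1, u, η, x] i))) : x = η * u := by
  have hu2 := Quaternion.norm_sq_eq u
  have hx2 := Quaternion.norm_sq_eq x
  have hη2 := Quaternion.norm_sq_eq η
  rw [Quaternion.real_inner_eq] at hηu hxu hxη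
  simp only [hu0, hη0, hx0, hu1, hn] at hηu hxu hxη hu2 hx2 hη2
  rw [det_quat_rows] at hor
  simp only [Quaternion.re_one, Quaternion.imI_one, Quaternion.imJ_one, Quaternion.imK_one, hu0,
    hη0, hx0] at hor
  have hin : @inner ℝ ℍ[ℝ] _ x (η * u) = x.imI * (η.imJ * u.imK - η.imK * u.imJ) +
      x.imJ * (η.imK * u.imI - η.imI * u.imK) + x.imK * (η.imI * u.imJ - η.imJ * u.imI) := by
    rw [Quaternion.real_inner_eq]
    simp only [Quaternion.re_mul, Quaternion.imI_mul, Quaternion.imJ_mul, Quaternion.imK_mul, hu0,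
      hη0, hx0]
    ring
  set d := @inner ℝ ℍ[ℝ] _ x (η * u) with hd
  have hd0 : 0 ≤ d := by rw [hin]; linarith
  -- the Gram determinant of `x, η, u`
  have hd2 : d ^ 2 = (‖η‖ ^ 2) ^ 2 := by
    have g : d ^ 2 = (x.imI ^ 2 + x.imJ ^ 2 + x.imK ^ 2) *
        ((η.imI ^ 2 + η.imJ ^ 2 + η.imK ^ 2) * (u.imI ^ 2 + u.imJ ^ 2 + u.imK ^ 2) -
          (η.imI * u.imI + η.imJ * u.imJ + η.imK * u.imK) ^ 2) -
        (x.imI * η.imI + x.imJ * η.imJ + x.imK * η.imK) *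
          ((x.imI * η.imI + x.imJ * η.imJ + x.imK * η.imK) *
            (u.imI ^ 2 + u.imJ ^ 2 + u.imK ^ 2) -
          (η.imI * u.imI + η.imJ * u.imJ + η.imK * u.imK) *
            (x.imI * u.imI + x.imJ * u.imJ + x.imK * u.imK)) +
        (x.imI * u.imI + x.imJ * u.imJ + x.imK * u.imK) *
          ((x.imI * η.imI + x.imJ * η.imJ + x.imK * η.imK) *
            (η.imI * u.imI + η.imJ * u.imJ + η.imK * u.imK) -
          (η.imI ^ 2 + η.imJ ^ 2 + η.imK ^ 2) *
            (x.imI * u.imI + x.imJ * u.imJ + x.imK * u.imK)) := by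
      rw [hin]; ring
    have a1 : η.imI * u.imI + η.imJ * u.imJ + η.imK * u.imK = 0 := by linarith
    have a2 : x.imI * u.imI + x.imJ * u.imJ + x.imK * u.imK = 0 := by linarith
    have a3 : x.imI * η.imI + x.imJ * η.imJ + x.imK * η.imK = 0 := by linarith
    have a4 : u.imI ^ 2 + u.imJ ^ 2 + u.imK ^ 2 = 1 := by linarith
    have a5 : x.imI ^ 2 + x.imJ ^ 2 + x.imK ^ 2 = ‖η‖ ^ 2 := by linarith
    have a6 : η.imI ^ 2 + η.imJ ^ 2 + η.imK ^ 2 = ‖η‖ ^ 2 := by linarith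
    rw [g, a1, a2, a3, a4, a5, a6]
    ring
  have hd3 : d = ‖η‖ ^ 2 := (sq_eq_sq₀ hd0 (by positivity)).1 hd2
  have h := norm_sub_sq_real x (η * u)
  rw [← hd, hd3, hn, norm_mul, hu1] at h
  have h' : ‖x - η * u‖ ^ 2 = 0 := by rw [h]; ring
  exact sub_eq_zero.1 (norm_eq_zero.1 (pow_eq_zero_iff two_ne_zero |>.1 h'))

namespace IsOrthComplexStructure

variable {J : ℍ[ℝ] →L[ℝ] ℍ[ℝ]} (hJ : IsOrthComplexStructure J)

include hJ in
theorem inner_map_map (ξ η : ℍ[ℝ]) :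
    @inner ℝ ℍ[ℝ] _ (J ξ) (J η) = @inner ℝ ℍ[ℝ] _ ξ η :=
  LinearIsometry.inner_map_map ⟨J.toLinearMap, hJ.norm_map⟩ ξ η

include hJ in
theorem inner_map_self (ξ : ℍ[ℝ]) : @inner ℝ ℍ[ℝ] _ (J ξ) ξ = 0 := by
  have h := hJ.inner_map_map (J ξ) ξ
  rw [hJ.sq, inner_neg_left, real_inner_comm] at h
  linarith

include hJ in
theorem re_map_one : (J 1).re = 0 := by
  have h := hJ.inner_map_self 1
  rw [Quaternion.real_inner_eq] at h
  simpa using h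

include hJ in
theorem norm_map_one : ‖J 1‖ = 1 := by rw [hJ.norm_map, norm_one]

include hJ in
/-- An orthogonal complex structure with the given orientation is right multiplication by the
imaginary unit `J 1`: this holds on `1` and `J 1` by definition, and on the orthogonal complement
of these two by `eq_mul_of_orthogonal`. -/
theorem eq_rightMul : J = rightMul (J 1) := by
  have h0 := hJ.re_map_one
  have h1 := hJ.norm_map_one
  have hre : ∀ ξ : ℍ[ℝ], @inner ℝ ℍ[ℝ] _ ξ 1 = ξ.re := fun ξ => by
    rw [Quaternion.real_inner_eq]; simp
  have key : ∀ η : ℍ[ℝ], η.re = 0 → @inner ℝ ℍ[ℝ] _ η (J 1) = 0 → J η = η * J 1 := by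
    intro η hη0 hηu
    refine eq_mul_of_orthogonal h0 h1 hη0 hηu ?_ ?_ (hJ.inner_map_self η) (hJ.norm_map η)
      (hJ.oriented 1 η)
    · have h := hJ.inner_map_map (J η) 1
      rw [hJ.sq, inner_neg_left, hηu, hre] at h
      linarith
    · rw [hJ.inner_map_map, hre, hη0]
  ext1 ξ
  have hdec := key (ξ - ξ.re • 1 - (@inner ℝ ℍ[ℝ] _ ξ (J 1)) • J 1) (by simp [h0]) (by
    have h10 : @inner ℝ ℍ[ℝ] _ 1 (J 1) = 0 := by rw [real_inner_comm, hre, h0]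
    rw [inner_sub_left, inner_sub_left, real_inner_smul_left, real_inner_smul_left,
      real_inner_self_eq_norm_sq, h1, h10]
    ring)
  rw [map_sub, map_sub, map_smul, map_smul, hJ.sq, sub_mul, sub_mul, smul_mul_assoc,
    smul_mul_assoc, one_mul, Quaternion.sq_eq_neg_one h0 h1] at hdec
  rw [rightMul_apply]
  exact sub_left_injective (sub_left_injective hdec)

end IsOrthComplexStructure

/-- Every imaginary unit is conjugate to `i`. -/
theorem exists_conj_I {u : ℍ[ℝ]} (h0 : u.re = 0) (h1 : ‖u‖ = 1) :
    ∃ p : ℍ[ℝ], p ≠ 0 ∧ p * (Complex.I : ℍ[ℝ]) = u * p := by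
  have hI : (Complex.I : ℍ[ℝ]) * (Complex.I : ℍ[ℝ]) = -1 := by
    rw [← Quaternion.coeComplex_mul, Complex.I_mul_I]; ext <;> simp
  by_cases h : u + (Complex.I : ℍ[ℝ]) = 0
  · refine ⟨quatJ, fun hj => ?_, ?_⟩
    · have := congrArg (fun q : ℍ[ℝ] => q.imJ) hj
      simp [quatJ] at this
    · rw [eq_neg_of_add_eq_zero_left h]
      ext <;> simp only [Quaternion.re_mul, Quaternion.imI_mul, Quaternion.imJ_mul,
        Quaternion.imK_mul] <;> simp [quatJ]
  · refine ⟨u + Complex.I, h, ?_⟩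
    rw [add_mul, mul_add, hI, Quaternion.sq_eq_neg_one h0 h1, add_comm]

/-! ### The fibres of the twistor fibration -/

theorem mul_I_eq (b : ℍ[ℝ]) :
    b * (Complex.I : ℍ[ℝ]) = quatOf (Complex.I * quatZ b) (Complex.I * quatW b) := by
  rw [quatOf_mul_coe, quatOf_quatZ_quatW]

namespace PsiFrame

variable (f : PsiFrame)

/-- The imaginary unit `p i p⁻¹` of a frame with `e₁ = (p, q)`. -/
def unit : ℍ[ℝ] := f.e₁.1 * (Complex.I : ℍ[ℝ]) * f.e₁.1⁻¹

theorem fderiv_ball (v : ℍ[ℝ] × ℍ[ℝ]) :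
    fderiv ℝ (fun e => PsiHP1.ballCoord (twistorMap (PsiP.mk (ofQuat e)))) f.e₁ v =
      fderiv ℝ coneBall (ofQuat f.e₁) (ofQuat v) := by
  have hev : (fun e => PsiHP1.ballCoord (twistorMap (PsiP.mk (ofQuat e)))) =ᶠ[𝓝 f.e₁]
      fun e => coneBall (ofQuat e) := by
    filter_upwards [ofQuat.continuous.continuousAt.preimage_mem_nhds
      (PsiP.isOpen_cone.mem_nhds f.e₁_mem_cone)] with w hw
    exact ballCoord_twistorMap_mk hw
  rw [hev.fderiv_eq]
  have h := ((contDiffAt_coneBall f.e₁_mem_cone).differentiableAt (by simp)).hasFDerivAt.comp f.e₁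
    ofQuat.hasFDerivAt
  exact DFunLike.congr_fun h.fderiv v

/-- Multiplying `ω₁` and `ω₂` by `i` replaces `b` by `b i`, hence `q' b p⁻¹` by
`q' b p⁻¹ (p i p⁻¹)`. -/
theorem isTwistorStructure_rightMul : f.IsTwistorStructure (rightMul f.unit) := by
  intro v v' h0 h1
  obtain ⟨a, b, rfl⟩ := f.exists_combo v
  obtain ⟨a', b', rfl⟩ := f.exists_combo v'
  rw [f.omega_combo, f.omega_combo] at h0 h1
  have hb : b' = b * (Complex.I : ℍ[ℝ]) := by
    rw [mul_I_eq, ← quatOf_quatZ_quatW b']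
    exact congrArg₂ quatOf h0 h1
  rw [fderiv_ball, fderiv_ball, fderiv_coneBall_combo, fderiv_coneBall_combo, rightMul_apply, hb,
    smul_mul_assoc, unit]
  congr 1
  simp only [mul_assoc]
  rw [inv_mul_cancel_left₀ f.fst_ne_zero]

/-- The complex structure induced by a point of `Ψ CP³` is unique, because the differential of
the twistor map is onto. -/
theorem IsTwistorStructure.map_one_eq {f : PsiFrame} {J : ℍ[ℝ] →L[ℝ] ℍ[ℝ]}
    (h : f.IsTwistorStructure J) : J 1 = f.unit := by
  have hc : 1 - ‖f.ball‖ ^ 2 ≠ 0 := left_ne_zero_of_mul_eq_one f.one_sub_norm_ball_sq_mul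
  have hq := f.e₂_snd_ne_zero
  -- the vector whose image under the differential is `1`
  set b : ℍ[ℝ] := (1 - ‖f.ball‖ ^ 2)⁻¹ • (f.e₂.2⁻¹ * f.e₁.1) with hb
  have h1 : fderiv ℝ coneBall (ofQuat f.e₁) (ofQuat (f.combo 0 b)) = 1 := by
    rw [fderiv_coneBall_combo, hb, mul_smul_comm, smul_mul_assoc, mul_inv_cancel_left₀ hq,
      mul_inv_cancel₀ f.fst_ne_zero, smul_smul, mul_inv_cancel₀ hc, one_smul]
  have hω0 : f.omega (f.combo 0 (b * (Complex.I : ℍ[ℝ]))) 0 =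
      Complex.I * f.omega (f.combo 0 b) 0 := by
    rw [f.omega_combo, f.omega_combo, mul_I_eq]
    exact quatZ_quatOf _ _
  have hω1 : f.omega (f.combo 0 (b * (Complex.I : ℍ[ℝ]))) 1 =
      Complex.I * f.omega (f.combo 0 b) 1 := by
    rw [f.omega_combo, f.omega_combo, mul_I_eq]
    exact quatW_quatOf _ _
  have e1 := h _ _ hω0 hω1
  have e2 := f.isTwistorStructure_rightMul _ _ hω0 hω1
  rw [fderiv_ball, fderiv_ball] at e1 e2
  rw [h1] at e1 e2
  rw [← e1, e2, rightMul_apply, one_mul]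

theorem unit_re : f.unit.re = 0 := by
  have h : f.unit = (Quaternion.normSq f.e₁.1)⁻¹ • (f.e₁.1 * (Complex.I : ℍ[ℝ]) * star f.e₁.1) := by
    rw [unit, Quaternion.inv_def, mul_smul_comm]
  rw [h]
  simp
  right
  ring

theorem norm_unit : ‖f.unit‖ = 1 := by
  have hp := norm_ne_zero_iff.2 f.fst_ne_zero
  rw [unit, norm_mul, norm_mul, norm_inv, norm_coe_complex, Complex.norm_I]
  field_simp

theorem exists_isTwistorStructure : ∃ J, IsOrthComplexStructure J ∧ f.IsTwistorStructure J :=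
  ⟨_, isOrthComplexStructure_rightMul f.unit_re f.norm_unit, f.isTwistorStructure_rightMul⟩

/-- A quaternion that commutes with `i` is complex. -/
theorem eq_coe_of_commute {c : ℍ[ℝ]} (h : c * (Complex.I : ℍ[ℝ]) = (Complex.I : ℍ[ℝ]) * c) :
    c = (quatZ c : ℍ[ℝ]) := by
  have h1 := congrArg (fun q : ℍ[ℝ] => q.imJ) h
  have h2 := congrArg (fun q : ℍ[ℝ] => q.imK) h
  simp at h1 h2
  ext <;> simp [quatZ] <;> linarith

/-- A point `[p, q]` is determined by `q p⁻¹` and `p i p⁻¹`. -/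
theorem proj_eq_of_ball_unit {f f' : PsiFrame} (hb : f.ball = f'.ball) (hu : f.unit = f'.unit) :
    f.proj = f'.proj := by
  have hp := f.fst_ne_zero
  have hp' := f'.fst_ne_zero
  obtain ⟨c, hpc⟩ : ∃ c, f'.e₁.1 = f.e₁.1 * c :=
    ⟨f.e₁.1⁻¹ * f'.e₁.1, (mul_inv_cancel_left₀ hp _).symm⟩
  have hcomm : c * (Complex.I : ℍ[ℝ]) = (Complex.I : ℍ[ℝ]) * c := by
    have h1 : f'.e₁.1 * (Complex.I : ℍ[ℝ]) = f.unit * f'.e₁.1 := by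
      rw [hu, unit, inv_mul_cancel_right₀ hp']
    rw [hpc, unit, mul_assoc, mul_assoc, mul_assoc] at h1
    have h2 := mul_left_cancel₀ hp h1
    rw [h2, inv_mul_cancel_left₀ hp]
  have hcc := eq_coe_of_commute hcomm
  have hqc : f'.e₁.2 = f.e₁.2 * c := by
    have h1 : f'.e₁.2 = f'.ball * f'.e₁.1 := by rw [ball, inv_mul_cancel_right₀ hp']
    rw [h1, ← hb, hpc, ball, mul_assoc, inv_mul_cancel_left₀ hp]
  have hc0 : quatZ c ≠ 0 := by
    intro h
    rw [h] at hcc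
    have : c = 0 := by rw [hcc]; ext <;> simp
    exact hp' (by rw [hpc, this, mul_zero])
  have he : ofQuat f'.e₁ = quatZ c • ofQuat f.e₁ := by
    rw [← ofQuat_toQuat (quatZ c • ofQuat f.e₁), PsiHP1.toQuat_smul, toQuat_ofQuat, ← hcc, ← hpc,
      ← hqc]
  rw [proj, proj, he, PsiP.mk_eq_mk_smul f.e₁_mem_cone hc0]

theorem exists_ball_unit {x u : ℍ[ℝ]} (hx : ‖x‖ < 1) (h0 : u.re = 0) (h1 : ‖u‖ = 1) :
    ∃ f : PsiFrame, f.ball = x ∧ f.unit = u := by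
  obtain ⟨p, hp, hpu⟩ := exists_conj_I h0 h1
  have hpn := norm_pos_iff.2 hp
  have hx2 : 0 < 1 - ‖x‖ ^ 2 := by nlinarith [norm_nonneg x]
  -- the real factor that normalizes `(p, x p)`
  set t : ℝ := (‖p‖ * Real.sqrt (1 - ‖x‖ ^ 2))⁻¹ with ht
  have ht0 : t ≠ 0 := by positivity
  have hmem : ofQuat (t • p, x * (t • p)) ∈ PsiSphere ℂ := by
    change psiQ _ = 1
    rw [psiQ_ofQuat, map_mul, Quaternion.normSq_eq_norm_mul_self,
      Quaternion.normSq_eq_norm_mul_self, norm_smul, Real.norm_eq_abs]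
    have hs := Real.sq_sqrt hx2.le
    have ht2 : |t| * ‖p‖ * (|t| * ‖p‖) = (1 - ‖x‖ ^ 2)⁻¹ := by
      have : |t| * ‖p‖ * (|t| * ‖p‖) = |t| ^ 2 * ‖p‖ ^ 2 := by ring
      rw [this, sq_abs, ht, inv_pow, mul_pow, hs]
      field_simp
    rw [ht2]
    field_simp
  have hf : (ofSphere ⟨_, hmem⟩).e₁ = (t • p, x * (t • p)) := toQuat_ofQuat _
  have htp : t • p ≠ 0 := smul_ne_zero ht0 hp
  refine ⟨ofSphere ⟨_, hmem⟩, ?_, ?_⟩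
  · rw [ball, hf, mul_inv_cancel_right₀ htp]
  · rw [unit, hf]
    simp only
    rw [smul_mul_assoc, hpu, ← mul_smul_comm, mul_inv_cancel_right₀ htp]

end PsiFrame

/-- The fibre of the twistor fibration over `y` consists of the positive orthogonal complex
structures. -/
theorem existsUnique_twistor (y : PsiHP1) (J : ℍ[ℝ] →L[ℝ] ℍ[ℝ]) (hJ : IsOrthComplexStructure J) :
    ∃! x : PsiP ℂ, twistorMap x = y ∧ ∃ f : PsiFrame, f.proj = x ∧ f.IsTwistorStructure J := by
  obtain ⟨f, hf1, hf2⟩ := PsiFrame.exists_ball_unit (norm_ballCoord_lt y) hJ.re_map_one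
    hJ.norm_map_one
  refine ⟨f.proj, ⟨?_, f, rfl, ?_⟩, ?_⟩
  · apply ballCoord_injective
    rw [f.ballCoord_twistorMap_proj, hf1]
  · rw [hJ.eq_rightMul, ← hf2]
    exact f.isTwistorStructure_rightMul
  · rintro _ ⟨hy, f', rfl, hf'⟩
    refine PsiFrame.proj_eq_of_ball_unit ?_ ?_
    · rw [← f'.ballCoord_twistorMap_proj, hy, hf1]
    · rw [← hf'.map_one_eq, hf2]

/-! ### Distances of induced metrics -/

section InducedDistance

variable {E : Type} [NormedAddCommGroup E] [NormedSpace ℝ E] {M : Type} [TopologicalSpace M]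
  [ChartedSpace E M] {E' : Type} [NormedAddCommGroup E'] [NormedSpace ℝ E'] {L : Type}
  [TopologicalSpace L] [ChartedSpace E' L]
  (g : ∀ x : M, TangentSpace 𝓘(ℝ, E) x → TangentSpace 𝓘(ℝ, E) x → ℝ) (f : L → M)

/-- The length `√(g(f_* v, f_* v))` of a tangent vector `v` of `L`. -/
def inducedLength (x : L) (v : TangentSpace 𝓘(ℝ, E') x) : ℝ :=
  Real.sqrt (g (f x) (mfderiv 𝓘(ℝ, E') 𝓘(ℝ, E) f x v) (mfderiv 𝓘(ℝ, E') 𝓘(ℝ, E) f x v))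

/-- `inducedLength` as a family of extended norms. -/
abbrev inducedENorm (x : L) : ENorm (TangentSpace 𝓘(ℝ, E') x) :=
  ⟨fun v => ENNReal.ofReal (inducedLength g f x v)⟩

variable {g f}

/-- A function whose differential is bounded by the induced length is `1`-Lipschitz. -/
theorem ofReal_abs_sub_le_inducedEDist {G : L → ℝ} (hG : ContMDiff 𝓘(ℝ, E') 𝓘(ℝ, ℝ) 1 G)
    (h : ∀ x v, @norm ℝ _ (mfderiv 𝓘(ℝ, E') 𝓘(ℝ, ℝ) G x v) ≤ inducedLength g f x v) (x y : L) :
    ENNReal.ofReal |G y - G x| ≤ inducedEDist (E' := E') g f x y := by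
  let _ : ∀ z : L, ENorm (TangentSpace 𝓘(ℝ, E') z) := inducedENorm g f
  refine le_of_forall_gt fun r hr => ?_
  obtain ⟨γ, rfl, rfl, hγ, hl⟩ := Manifold.exists_lt_of_riemannianEDist_lt (I := 𝓘(ℝ, E')) hr
  refine lt_of_le_of_lt ?_ hl
  have hGγ : ContDiffOn ℝ 1 (G ∘ γ) (Set.Icc 0 1) :=
    (hG.comp_contMDiffOn hγ).contDiffOn
  have h1 := enorm_sub_le_lintegral_derivWithin_Icc_of_contDiffOn_Icc hGγ zero_le_one
  rw [← Real.norm_eq_abs, ofReal_norm]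
  refine h1.trans ?_
  rw [Manifold.pathELength_eq_lintegral_mfderivWithin_Icc]
  refine MeasureTheory.setLIntegral_mono' measurableSet_Icc fun t ht => ?_
  have hu : UniqueMDiffWithinAt 𝓘(ℝ, ℝ) (Set.Icc (0 : ℝ) 1) t :=
    (uniqueDiffOn_Icc zero_lt_one t ht).uniqueMDiffWithinAt
  have hc := mfderiv_comp_mfderivWithin t ((hG (γ t)).mdifferentiableAt one_ne_zero)
    ((hγ t ht).mdifferentiableWithinAt one_ne_zero) hu
  have h2 : derivWithin (G ∘ γ) (Set.Icc 0 1) t =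
      mfderiv 𝓘(ℝ, E') 𝓘(ℝ, ℝ) G (γ t)
        (mfderivWithin 𝓘(ℝ, ℝ) 𝓘(ℝ, E') γ (Set.Icc 0 1) t (1 : ℝ)) := by
    have h3 := DFunLike.congr_fun hc (1 : ℝ)
    rw [mfderivWithin_eq_fderivWithin] at h3
    exact h3
  rw [← ofReal_norm, h2]
  exact ENNReal.ofReal_le_ofReal (h _ _)

/-- A path whose velocity has length at most `ε` on `[0, 1]` bounds the distance of its ends. -/
theorem inducedEDist_le_of_path {γ : ℝ → L} (hγ : ContMDiffOn 𝓘(ℝ, ℝ) 𝓘(ℝ, E') 1 γ (Set.Icc 0 1))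
    (hs : ∀ x (c : ℝ) (v : TangentSpace 𝓘(ℝ, E') x),
      inducedLength g f x (c • v) = |c| * inducedLength g f x v)
    {ε : ℝ} (h : ∀ t ∈ Set.Icc (0 : ℝ) 1,
      inducedLength g f (γ t) (mfderiv 𝓘(ℝ, ℝ) 𝓘(ℝ, E') γ t (1 : ℝ)) ≤ ε) :
    inducedEDist (E' := E') g f (γ 0) (γ 1) ≤ ENNReal.ofReal ε := by
  let _ : ∀ z : L, ENorm (TangentSpace 𝓘(ℝ, E') z) := inducedENorm g f
  have _ : ∀ z : L, ENormSMulClass ℝ (TangentSpace 𝓘(ℝ, E') z) := fun z => ⟨fun c v => by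
    change ENNReal.ofReal _ = _ * ENNReal.ofReal _
    rw [hs, ENNReal.ofReal_mul (abs_nonneg c), ← Real.norm_eq_abs, ofReal_norm]⟩
  refine (Manifold.riemannianEDist_le_pathELength hγ rfl rfl zero_le_one).trans ?_
  rw [Manifold.pathELength_eq_lintegral_mfderiv_Icc]
  refine (MeasureTheory.setLIntegral_mono' measurableSet_Icc
    (fun t ht => ENNReal.ofReal_le_ofReal (h t ht))).trans ?_
  simp

theorem inducedEDist_triangle
    (hs : ∀ x (c : ℝ) (v : TangentSpace 𝓘(ℝ, E') x),
      inducedLength g f x (c • v) = |c| * inducedLength g f x v) (x y z : L) :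
    inducedEDist (E' := E') g f x z ≤
      inducedEDist (E' := E') g f x y + inducedEDist (E' := E') g f y z := by
  let _ : ∀ z : L, ENorm (TangentSpace 𝓘(ℝ, E') z) := inducedENorm g f
  have _ : ∀ z : L, ENormSMulClass ℝ (TangentSpace 𝓘(ℝ, E') z) := fun z => ⟨fun c v => by
    change ENNReal.ofReal _ = _ * ENNReal.ofReal _
    rw [hs, ENNReal.ofReal_mul (abs_nonneg c), ← Real.norm_eq_abs, ofReal_norm]⟩
  have h := Manifold.riemannianEDist_triangle (I := 𝓘(ℝ, E')) (x := x) (y := y) (z := z)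
  exact h

end InducedDistance

/-! ### Completeness of the real points -/

theorem inducedLength_psi_smul (y : PsiP ℝ) (c : ℝ) (v : TangentSpace 𝓘(ℝ, Fin 3 → ℝ) y) :
    inducedLength psiMetric psiRealIncl y (c • v) =
      |c| * inducedLength psiMetric psiRealIncl y v := by
  have h : ∀ u : TangentSpace 𝓘(ℝ, Fin 3 → ℂ) (psiRealIncl y),
      psiMetric (psiRealIncl y) (c • u) (c • u) = c ^ 2 * psiMetric (psiRealIncl y) u u := by
    intro u
    simp only [psiMetric, map_smul, stdMetric, Finset.mul_sum]
    refine Finset.sum_congr rfl fun k _ => ?_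
    simp
    ring
  rw [inducedLength, inducedLength, map_smul, h, Real.sqrt_mul (sq_nonneg c), Real.sqrt_sq_eq_abs]

theorem inducedLength_psi_mk {z : Fin 4 → ℝ} (hz : z ∈ PsiP.cone ℝ) (v : Fin 4 → ℝ) :
    inducedLength psiMetric psiRealIncl (PsiP.mk z) (PsiP.dmk z v) =
      Real.sqrt (coneMetric (ofRealL z) (ofRealL v) (ofRealL v)) := by
  -- as the tangent space depends on the base point, both are generalized together
  have h2 : ∀ (y : PsiP ℂ) (a : TangentSpace 𝓘(ℝ, Fin 3 → ℂ) y), y = PsiP.mk (ofRealL z) →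
      (a : Fin 3 → ℂ) = (PsiP.dmk (ofRealL z) (ofRealL v) : Fin 3 → ℂ) →
      psiMetric y a a = coneMetric (ofRealL z) (ofRealL v) (ofRealL v) := by
    rintro _ _ rfl rfl
    exact psiMetric_mk (PsiP.ofRealL_mem_cone hz) _ _
  rw [inducedLength, h2 _ _ (psiRealIncl_mk hz) (mfderiv_psiRealIncl hz v)]

/-- The induced distance is continuous: straight segments in the cone have short images. -/
theorem tendsto_inducedEDist_mk {z : Fin 4 → ℝ} (hz : z ∈ PsiP.cone ℝ) :
    Filter.Tendsto (fun w => inducedEDist (E' := Fin 3 → ℝ) psiMetric psiRealIncl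
      (PsiP.mk w) (PsiP.mk z)) (𝓝 z) (𝓝 0) := by
  have hcont : ContinuousAt (fun p : (Fin 4 → ℝ) × (Fin 4 → ℝ) =>
      Real.sqrt (coneMetric (ofRealL p.1) (ofRealL p.2) (ofRealL p.2))) (z, 0) := by
    have hq : ContinuousAt (fun p : (Fin 4 → ℝ) × (Fin 4 → ℝ) => (psiQ (ofRealL p.1))⁻¹) (z, 0) :=
      ContinuousAt.inv₀ (continuous_psiQ.comp (ofRealL.continuous.comp continuous_fst)).continuousAt
        (show psiQ (ofRealL z) ≠ 0 from (PsiP.ofRealL_mem_cone hz).ne')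
    have hq' := Complex.continuous_ofReal.continuousAt.comp hq
    refine Real.continuous_sqrt.continuousAt.comp ?_
    have c1 : Continuous fun p : (Fin 4 → ℝ) × (Fin 4 → ℝ) =>
        psiHerm (ofRealL p.1) (ofRealL p.2) := by
      simp only [psiHerm, ofRealL_apply]; fun_prop
    have c2 : Continuous fun p : (Fin 4 → ℝ) × (Fin 4 → ℝ) =>
        psiHerm (ofRealL p.2) (ofRealL p.2) := by
      simp only [psiHerm, ofRealL_apply]; fun_prop
    have c3 : Continuous fun p : (Fin 4 → ℝ) × (Fin 4 → ℝ) =>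
        psiSymp (ofRealL p.1) (ofRealL p.2) := by
      simp only [psiSymp, ofRealL_apply]; fun_prop
    have h1 : ContinuousAt (fun p : (Fin 4 → ℝ) × (Fin 4 → ℝ) =>
        coneHerm (ofRealL p.1) (ofRealL p.2) (ofRealL p.2)) (z, 0) :=
      (((Complex.continuous_conj.comp c1).mul c1).continuousAt.mul (hq'.pow 2)).sub
        (c2.continuousAt.mul hq')
    have h2 : ContinuousAt (fun p : (Fin 4 → ℝ) × (Fin 4 → ℝ) =>
        coneVert (ofRealL p.1) (ofRealL p.2) (ofRealL p.2)) (z, 0) :=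
      ((Complex.continuous_conj.comp c3).mul c3).continuousAt.mul (hq'.pow 2)
    exact (Complex.continuous_re.continuousAt.comp h1).add
      (continuousAt_const.mul (Complex.continuous_re.continuousAt.comp h2))
  have h0 : Real.sqrt (coneMetric (ofRealL z) (ofRealL 0) (ofRealL 0)) = 0 := by
    simp [coneMetric, coneHerm, coneVert, psiHerm, psiSymp]
  rw [ENNReal.tendsto_nhds_zero]
  intro ε hε
  obtain ⟨e, he0, he⟩ : ∃ e : ℝ, 0 < e ∧ ENNReal.ofReal e ≤ ε := by
    rcases eq_or_ne ε ⊤ with rfl | ht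
    · exact ⟨1, one_pos, le_top⟩
    · exact ⟨ε.toReal, ENNReal.toReal_pos hε.ne' ht, ENNReal.ofReal_toReal_le⟩
  have hev : ∀ᶠ p : (Fin 4 → ℝ) × (Fin 4 → ℝ) in 𝓝 (z, 0), p.1 ∈ PsiP.cone ℝ ∧
      Real.sqrt (coneMetric (ofRealL p.1) (ofRealL p.2) (ofRealL p.2)) < e := by
    refine Filter.Eventually.and ?_ (hcont.eventually (Iio_mem_nhds (by
      change Real.sqrt _ < e
      rw [h0]; exact he0)))
    exact continuousAt_fst.eventually (PsiP.isOpen_cone.mem_nhds hz)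
  obtain ⟨δ, hδ, hball⟩ := Metric.eventually_nhds_iff_ball.1 hev
  filter_upwards [Metric.ball_mem_nhds z hδ] with w hw
  have hwz : ‖w - z‖ < δ := by rwa [← dist_eq_norm]
  refine le_trans ?_ he
  -- the segment from `w` to `z`
  have hseg : ∀ t ∈ Set.Icc (0 : ℝ) 1, w + t • (z - w) ∈ PsiP.cone ℝ ∧
      Real.sqrt (coneMetric (ofRealL (w + t • (z - w))) (ofRealL (z - w)) (ofRealL (z - w))) <
        e := by
    intro t ht
    refine hball (w + t • (z - w), z - w) ?_
    have h1 : ‖w + t • (z - w) - z‖ < δ := by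
      have : w + t • (z - w) - z = (1 - t) • (w - z) := by module
      rw [this, norm_smul, Real.norm_eq_abs, abs_of_nonneg (by linarith [ht.2])]
      nlinarith [norm_nonneg (w - z), ht.1]
    rw [Metric.mem_ball, Prod.dist_eq, max_lt_iff, dist_eq_norm, dist_eq_norm, sub_zero,
      norm_sub_rev z w]
    exact ⟨h1, hwz⟩
  have hd : ∀ t : ℝ, HasFDerivAt (fun t : ℝ => w + t • (z - w))
      ((ContinuousLinearMap.id ℝ ℝ).smulRight (z - w)) t := fun t =>
    ((ContinuousLinearMap.id ℝ ℝ).smulRight (z - w)).hasFDerivAt.const_add w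
  have hline : ContDiff ℝ ∞ fun t : ℝ => w + t • (z - w) := by fun_prop
  have hpath : ContMDiffOn 𝓘(ℝ, ℝ) 𝓘(ℝ, Fin 3 → ℝ) 1 (fun t : ℝ => PsiP.mk (w + t • (z - w)))
      (Set.Icc 0 1) :=
    ((PsiP.contMDiffOn_mk (𝕜 := ℝ)).comp hline.contMDiff.contMDiffOn
      fun t ht => (hseg t ht).1).of_le (by simp)
  have hle := inducedEDist_le_of_path (g := psiMetric) (f := psiRealIncl) hpath
    inducedLength_psi_smul (ε := e) (fun t ht => by
      rw [PsiP.mfderiv_mk_comp (hd t) (hseg t ht).1, inducedLength_psi_mk (hseg t ht).1]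
      simpa using (hseg t ht).2.le)
  simpa using hle

/-- The twistor map does not increase lengths. -/
theorem hypMetric_twistorMap_le (x : PsiP ℂ) (v : TangentSpace 𝓘(ℝ, Fin 3 → ℂ) x) :
    hypMetric (twistorMap x) (mfderiv 𝓘(ℝ, Fin 3 → ℂ) 𝓘(ℝ, ℍ[ℝ]) twistorMap x v)
      (mfderiv 𝓘(ℝ, Fin 3 → ℂ) 𝓘(ℝ, ℍ[ℝ]) twistorMap x v) ≤ psiMetric x v v := by
  obtain ⟨f, rfl⟩ := PsiFrame.exists_proj_eq x
  obtain ⟨v, rfl⟩ := f.dproj_surjective v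
  have h : ∀ a : ℂ, (conj a * a).re = ‖a‖ ^ 2 := fun a => by
    rw [← Complex.normSq_eq_conj_mul_self, Complex.ofReal_re, Complex.normSq_eq_norm_sq]
  rw [f.hypMetric_mfderiv, f.psiMetric_dproj, stdMetric, Fin.sum_univ_three, h, h, h]
  exact le_add_of_nonneg_right (sq_nonneg _)

/-- The ball coordinate of the image of a real point in `H⁴`. -/
def realBall (x : PsiP ℝ) : ℍ[ℝ] := PsiHP1.ballCoord (twistorMap (psiRealIncl x))

theorem contMDiff_realBall : ContMDiff 𝓘(ℝ, Fin 3 → ℝ) 𝓘(ℝ, ℍ[ℝ]) ∞ realBall :=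
  contMDiff_ballCoord.comp (contMDiff_twistorMap.comp contMDiff_psiRealIncl)

theorem norm_realBall_lt (x : PsiP ℝ) : ‖realBall x‖ < 1 := norm_ballCoord_lt _

theorem norm_mfderiv_realBall_le (x : PsiP ℝ) (v : TangentSpace 𝓘(ℝ, Fin 3 → ℝ) x) :
    @norm ℍ[ℝ] _ (mfderiv 𝓘(ℝ, Fin 3 → ℝ) 𝓘(ℝ, ℍ[ℝ]) realBall x v) / (1 - ‖realBall x‖ ^ 2) ≤
      inducedLength psiMetric psiRealIncl x v := by
  have hι : MDifferentiableAt 𝓘(ℝ, Fin 3 → ℝ) 𝓘(ℝ, Fin 3 → ℂ) psiRealIncl x :=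
    contMDiff_psiRealIncl.mdifferentiableAt (by simp)
  have hT : MDifferentiableAt 𝓘(ℝ, Fin 3 → ℂ) 𝓘(ℝ, ℍ[ℝ]) twistorMap (psiRealIncl x) :=
    contMDiff_twistorMap.mdifferentiableAt (by simp)
  have hB : MDifferentiableAt 𝓘(ℝ, ℍ[ℝ]) 𝓘(ℝ, ℍ[ℝ]) PsiHP1.ballCoord
      (twistorMap (psiRealIncl x)) := contMDiff_ballCoord.mdifferentiableAt (by simp)
  have h1 := DFunLike.congr_fun (mfderiv_comp x hB (hT.comp x hι)) v
  have h2 := DFunLike.congr_fun (mfderiv_comp x hT hι) v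
  have h3 : (mfderiv 𝓘(ℝ, Fin 3 → ℝ) 𝓘(ℝ, ℍ[ℝ]) realBall x v : ℍ[ℝ]) =
      mfderiv 𝓘(ℝ, ℍ[ℝ]) 𝓘(ℝ, ℍ[ℝ]) PsiHP1.ballCoord (twistorMap (psiRealIncl x))
        (mfderiv 𝓘(ℝ, Fin 3 → ℂ) 𝓘(ℝ, ℍ[ℝ]) twistorMap (psiRealIncl x)
          (mfderiv 𝓘(ℝ, Fin 3 → ℝ) 𝓘(ℝ, Fin 3 → ℂ) psiRealIncl x v)) :=
    h1.trans (congrArg _ h2)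
  have hpos : 0 < 1 - ‖realBall x‖ ^ 2 := by
    nlinarith [norm_realBall_lt x, norm_nonneg (realBall x)]
  rw [inducedLength]
  refine Real.le_sqrt_of_sq_le (le_trans (le_of_eq ?_) (hypMetric_twistorMap_le _ _))
  have h4 : ∀ q q' : ℍ[ℝ], q = q' → (‖q‖ / (1 - ‖realBall x‖ ^ 2)) ^ 2 =
      @inner ℝ ℍ[ℝ] _ q' q' / (1 - ‖realBall x‖ ^ 2) ^ 2 := by
    rintro q _ rfl
    rw [real_inner_self_eq_norm_sq, div_pow]
  exact h4 _ _ h3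

/-- The function `-½ log (1 - |·|²)` of the ball coordinate, which is proper on `Ψ RP³` and has
bounded differential. -/
def realHeight (x : PsiP ℝ) : ℝ := -(1 / 2) * Real.log (1 - ‖realBall x‖ ^ 2)

theorem hasFDerivAt_height {q : ℍ[ℝ]} (hq : ‖q‖ < 1) :
    HasFDerivAt (fun q : ℍ[ℝ] => -(1 / 2) * Real.log (1 - ‖q‖ ^ 2))
      ((1 - ‖q‖ ^ 2)⁻¹ • innerSL ℝ q) q := by
  have hpos : 1 - ‖q‖ ^ 2 ≠ 0 := by nlinarith [norm_nonneg q]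
  have h := (((hasFDerivAt_id (𝕜 := ℝ) q).norm_sq.const_sub 1).log hpos).const_mul (-(1 / 2))
  refine h.congr_fderiv ?_
  ext w
  simp
  ring

theorem contMDiff_realHeight : ContMDiff 𝓘(ℝ, Fin 3 → ℝ) 𝓘(ℝ, ℝ) ∞ realHeight := by
  intro x
  have h : ContDiffAt ℝ ∞ (fun q : ℍ[ℝ] => -(1 / 2) * Real.log (1 - ‖q‖ ^ 2)) (realBall x) := by
    refine contDiffAt_const.mul (ContDiffAt.log ?_ ?_)
    · exact contDiffAt_const.sub (contDiff_norm_sq ℝ).contDiffAt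
    · nlinarith [norm_realBall_lt x, norm_nonneg (realBall x)]
  exact h.contMDiffAt.comp x (contMDiff_realBall x)

theorem norm_mfderiv_realHeight_le (x : PsiP ℝ) (v : TangentSpace 𝓘(ℝ, Fin 3 → ℝ) x) :
    @norm ℝ _ (mfderiv 𝓘(ℝ, Fin 3 → ℝ) 𝓘(ℝ, ℝ) realHeight x v) ≤
      inducedLength psiMetric psiRealIncl x v := by
  refine le_trans ?_ (norm_mfderiv_realBall_le x v)
  have hd := hasFDerivAt_height (norm_realBall_lt x)
  have hpos : 0 < 1 - ‖realBall x‖ ^ 2 := by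
    nlinarith [norm_realBall_lt x, norm_nonneg (realBall x)]
  have h1 := DFunLike.congr_fun (mfderiv_comp x hd.hasMFDerivAt.mdifferentiableAt
    (contMDiff_realBall.mdifferentiableAt (by simp) (x := x))) v
  rw [hd.hasMFDerivAt.mfderiv] at h1
  have h2 : (mfderiv 𝓘(ℝ, Fin 3 → ℝ) 𝓘(ℝ, ℝ) realHeight x v : ℝ) =
      (1 - ‖realBall x‖ ^ 2)⁻¹ * @inner ℝ ℍ[ℝ] _ (realBall x)
        (mfderiv 𝓘(ℝ, Fin 3 → ℝ) 𝓘(ℝ, ℍ[ℝ]) realBall x v) := h1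
  have h3 : ∀ a : ℝ, ∀ w : ℍ[ℝ], a = (1 - ‖realBall x‖ ^ 2)⁻¹ * @inner ℝ ℍ[ℝ] _ (realBall x) w →
      ‖a‖ ≤ ‖w‖ / (1 - ‖realBall x‖ ^ 2) := by
    rintro _ w rfl
    rw [norm_mul, norm_inv, Real.norm_of_nonneg hpos.le, inv_mul_eq_div]
    gcongr
    refine (norm_inner_le_norm _ _).trans ?_
    nlinarith [norm_realBall_lt x, norm_nonneg w]
  exact h3 _ _ h2

theorem realHeight_mk {z : Fin 4 → ℝ} (hz : z ∈ PsiSphere ℝ) :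
    realHeight (PsiP.mk z) = 1 / 2 * Real.log (z 0 ^ 2 + z 1 ^ 2) := by
  have hz' : ofRealL z ∈ PsiSphere ℂ := by
    change psiQ _ = 1
    rw [psiQ_ofRealL]; exact hz
  set f := PsiFrame.ofSphere ⟨_, hz'⟩ with hf
  have he : ofQuat f.e₁ = ofRealL z := ofQuat_toQuat _
  have hb : realBall (PsiP.mk z) = f.ball := by
    rw [realBall, psiRealIncl_mk (PsiP.psiSphere_subset_cone hz), ← f.ballCoord_twistorMap_proj,
      PsiFrame.proj, he]
  have hn : ‖f.e₁.1‖ ^ 2 = z 0 ^ 2 + z 1 ^ 2 := by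
    rw [sq ‖f.e₁.1‖, ← Quaternion.normSq_eq_norm_mul_self]
    change Quaternion.normSq (quatOf _ _) = _
    rw [normSq_quatOf]
    simp [ofRealL_apply]
  rw [realHeight, hb, eq_inv_of_mul_eq_one_left f.one_sub_norm_ball_sq_mul, hn, Real.log_inv]
  ring

/-- The part of `Ψ S³` of bounded height is compact. -/
theorem isCompact_psiSphere_le (B : ℝ) :
    IsCompact {z : Fin 4 → ℝ | z ∈ PsiSphere ℝ ∧ z 0 ^ 2 + z 1 ^ 2 ≤ B} := by
  refine Metric.isCompact_of_isClosed_isBounded ?_ ?_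
  · exact (isClosed_eq continuous_psiQ continuous_const).inter
      (isClosed_le (f := fun z : Fin 4 → ℝ => z 0 ^ 2 + z 1 ^ 2) (by fun_prop) continuous_const)
  · refine (Metric.isBounded_closedBall (x := (0 : Fin 4 → ℝ)) (r := Real.sqrt B)).subset ?_
    rintro z ⟨hz, hB⟩
    have hq : psiQ z = 1 := hz
    simp only [psiQ, Real.norm_eq_abs, sq_abs] at hq
    rw [mem_closedBall_zero_iff, pi_norm_le_iff_of_nonneg (Real.sqrt_nonneg B)]
    intro k
    refine Real.abs_le_sqrt ?_
    fin_cases k <;> simp <;> nlinarith [sq_nonneg (z 0), sq_nonneg (z 1), sq_nonneg (z 2),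
      sq_nonneg (z 3)]

/-- A Cauchy sequence has bounded height, so its lifts to `Ψ S³` have a convergent subsequence. -/
theorem isCompleteInduced_psiRealIncl :
    IsCompleteInduced (E' := Fin 3 → ℝ) psiMetric psiRealIncl := by
  intro u hu
  have hlip := ofReal_abs_sub_le_inducedEDist (contMDiff_realHeight.of_le (by simp))
    norm_mfderiv_realHeight_le
  obtain ⟨N, hN⟩ := hu 1 one_pos
  choose z hz hzu using fun n => PsiP.exists_mk (u n)
  set B := realHeight (u N) + 1 with hB
  have hmem : ∀ n, z (n + N) ∈ {z : Fin 4 → ℝ | z ∈ PsiSphere ℝ ∧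
      z 0 ^ 2 + z 1 ^ 2 ≤ Real.exp (2 * B)} := by
    intro n
    refine ⟨hz _, ?_⟩
    have h1 := (hlip (u N) (u (n + N))).trans_lt (hN N le_rfl (n + N) (Nat.le_add_left _ _))
    rw [ENNReal.ofReal_lt_one] at h1
    have h2 : realHeight (u (n + N)) ≤ B := by
      linarith [le_abs_self (realHeight (u (n + N)) - realHeight (u N))]
    rw [← hzu, realHeight_mk (hz _)] at h2
    have hq : psiQ (z (n + N)) = 1 := hz _
    simp only [psiQ, Real.norm_eq_abs, sq_abs] at hq
    have hpos : 0 < z (n + N) 0 ^ 2 + z (n + N) 1 ^ 2 := by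
      nlinarith [sq_nonneg (z (n + N) 2), sq_nonneg (z (n + N) 3)]
    rw [← Real.log_le_iff_le_exp hpos]
    linarith
  obtain ⟨w, hw, φ, hφ, hlim⟩ := (isCompact_psiSphere_le _).tendsto_subseq hmem
  have hconv := (tendsto_inducedEDist_mk (PsiP.psiSphere_subset_cone hw.1)).comp hlim
  refine ⟨PsiP.mk w, ?_⟩
  rw [ENNReal.tendsto_nhds_zero] at hconv ⊢
  intro ε hε
  have hε2 : 0 < ε / 2 := ENNReal.half_pos hε.ne'
  obtain ⟨N', hN'⟩ := hu (ε / 2) hε2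
  filter_upwards [Filter.eventually_ge_atTop N'] with n hn
  obtain ⟨m, hm1, hm2⟩ := ((hconv (ε / 2) hε2).and (Filter.eventually_ge_atTop N')).exists
  have hm3 : N' ≤ φ m + N := hm2.trans ((hφ.id_le m).trans (Nat.le_add_right _ _))
  rw [← ENNReal.add_halves ε]
  refine (inducedEDist_triangle inducedLength_psi_smul (u n) (u (φ m + N)) _).trans ?_
  refine add_le_add (hN' n hn _ hm3).le ?_
  rw [← hzu]
  exact hm1

/-! ### The hyperbolic plane in hyperbolic 4-space -/

/-- The inclusion `a + i b ↦ a + j b` of the complex numbers in the quaternions. -/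
def jPlane : ℂ →L[ℝ] ℍ[ℝ] := LinearMap.toContinuousLinearMap
  { toFun := fun c => ⟨c.re, 0, c.im, 0⟩
    map_add' := fun _ _ =>
      Quaternion.ext _ _ rfl (add_zero (0 : ℝ)).symm rfl (add_zero (0 : ℝ)).symm
    map_smul' := fun r _ => Quaternion.ext _ _ (Complex.re_ofReal_mul r _) (mul_zero r).symm
      (Complex.im_ofReal_mul r _) (mul_zero r).symm }

theorem jPlane_re (c : ℂ) : (jPlane c).re = c.re := rfl

theorem jPlane_imI (c : ℂ) : (jPlane c).imI = 0 := rfl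

theorem jPlane_imJ (c : ℂ) : (jPlane c).imJ = c.im := rfl

theorem jPlane_imK (c : ℂ) : (jPlane c).imK = 0 := rfl

/-- The left inverse `q ↦ q.re + i q.imJ` of `jPlane`. -/
def jPart : ℍ[ℝ] →L[ℝ] ℂ := LinearMap.toContinuousLinearMap
  { toFun := fun q => ⟨q.re, q.imJ⟩
    map_add' := fun _ _ => by apply Complex.ext <;> simp
    map_smul' := fun _ _ => by apply Complex.ext <;> simp }

theorem jPart_jPlane (c : ℂ) : jPart (jPlane c) = c := rfl

theorem jPlane_mul (c d : ℂ) : jPlane (c * d) = jPlane c * jPlane d := by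
  ext <;> simp only [Quaternion.re_mul, Quaternion.imI_mul, Quaternion.imJ_mul,
    Quaternion.imK_mul, jPlane_re, jPlane_imI, jPlane_imJ, jPlane_imK, Complex.mul_re,
    Complex.mul_im] <;> ring

theorem inner_jPlane (c d : ℂ) :
    @inner ℝ ℍ[ℝ] _ (jPlane c) (jPlane d) = @inner ℝ ℂ _ c d := by
  rw [Quaternion.real_inner_eq, Complex.inner]
  simp only [jPlane_re, jPlane_imI, jPlane_imJ, jPlane_imK, Complex.mul_re, Complex.conj_re,
    Complex.conj_im]
  ring

theorem norm_jPlane (c : ℂ) : ‖jPlane c‖ = ‖c‖ := by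
  rw [norm_eq_sqrt_real_inner, norm_eq_sqrt_real_inner (F := ℂ), inner_jPlane]

theorem norm_coe_hypPlane_lt (y : HypPlane) : ‖(y : ℂ)‖ < 1 := mem_ball_zero_iff.1 y.2

theorem norm_jPlane_coe_lt (y : HypPlane) : ‖jPlane y‖ < 1 := by
  rw [norm_jPlane]; exact norm_coe_hypPlane_lt y

theorem ballCoord_hypPlaneIncl (y : HypPlane) :
    PsiHP1.ballCoord (hypPlaneIncl y) = jPlane y :=
  PsiHP1.ballCoord_ofBall _ (norm_jPlane_coe_lt y)

theorem continuous_hypPlaneIncl : Continuous hypPlaneIncl :=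
  PsiHP1.ballChart.continuousOn_symm.comp_continuous
    (jPlane.continuous.comp continuous_subtype_val)
    fun y => mem_ball_zero_iff.2 (norm_jPlane_coe_lt y)

theorem contMDiff_coe_hypPlane :
    ContMDiff 𝓘(ℝ, ℂ) 𝓘(ℝ, ℂ) ∞ (Subtype.val : HypPlane → ℂ) :=
  contMDiff_subtype_val (I := 𝓘(ℝ, ℂ)) (U := HypPlane)

theorem contMDiff_hypPlaneIncl : ContMDiff 𝓘(ℝ, ℂ) 𝓘(ℝ, ℍ[ℝ]) ∞ hypPlaneIncl := by
  refine fun y => contMDiffAt_of_ballCoord_comp continuous_hypPlaneIncl.continuousAt ?_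
  have h : (fun y => PsiHP1.ballCoord (hypPlaneIncl y)) = fun y : HypPlane => jPlane y :=
    funext ballCoord_hypPlaneIncl
  rw [h]
  exact (jPlane.contDiff.contMDiff.comp contMDiff_coe_hypPlane).contMDiffAt

/-- The splitting of the quaternions into `{a + j b}` and its complement. -/
def jPlaneSplit : (ℂ × ℂ) ≃L[ℝ] ℍ[ℝ] :=
  LinearEquiv.toContinuousLinearEquiv
    { toFun := fun p => ⟨p.1.re, p.2.re, p.1.im, p.2.im⟩
      invFun := fun q => (⟨q.re, q.imJ⟩, ⟨q.imI, q.imK⟩)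
      map_add' := fun _ _ => Quaternion.ext _ _ rfl rfl rfl rfl
      map_smul' := fun r _ => Quaternion.ext _ _ (Complex.re_ofReal_mul r _)
        (Complex.re_ofReal_mul r _) (Complex.im_ofReal_mul r _) (Complex.im_ofReal_mul r _)
      left_inv := fun _ => rfl
      right_inv := fun _ => rfl }

theorem isSmoothEmbedding_hypPlaneIncl :
    Manifold.IsSmoothEmbedding 𝓘(ℝ, ℂ) 𝓘(ℝ, ℍ[ℝ]) ∞ hypPlaneIncl := by
  refine ⟨Manifold.IsImmersionOfComplement.isImmersion (F := ℂ) fun y => ?_, ?_⟩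
  · refine Manifold.IsImmersionAtOfComplement.mk_of_charts jPlaneSplit (chartAt ℂ y)
      (chartAt ℍ[ℝ] (hypPlaneIncl y)) (mem_chart_source ℂ y) (mem_chart_source ℍ[ℝ] _)
      (IsManifold.chart_mem_maximalAtlas y) (IsManifold.chart_mem_maximalAtlas _)
      (fun x _ => Set.mem_univ _) ?_
    intro u hu
    have hu' : u ∈ (chartAt ℂ y).target := by simpa using hu
    have h1 : ((chartAt ℂ y).symm u : ℂ) = u := (chartAt ℂ y).right_inv hu'
    have h2 : PsiHP1.ballCoord (hypPlaneIncl ((chartAt ℂ y).symm u)) = jPlane u := by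
      rw [ballCoord_hypPlaneIncl, h1]
    exact h2
  · refine Topology.IsEmbedding.of_comp continuous_hypPlaneIncl
      (jPart.continuous.comp PsiHP1.continuous_ballCoord) ?_
    have h : (jPart ∘ PsiHP1.ballCoord) ∘ hypPlaneIncl = (Subtype.val : HypPlane → ℂ) := by
      funext y
      change jPart (PsiHP1.ballCoord (hypPlaneIncl y)) = _
      rw [ballCoord_hypPlaneIncl, jPart_jPlane]
    exact h ▸ Topology.IsEmbedding.subtypeVal

theorem hypMetric_hypPlaneIncl (y : HypPlane) (v w : TangentSpace 𝓘(ℝ, ℂ) y) :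
    hypMetric (hypPlaneIncl y) (mfderiv 𝓘(ℝ, ℂ) 𝓘(ℝ, ℍ[ℝ]) hypPlaneIncl y v)
      (mfderiv 𝓘(ℝ, ℂ) 𝓘(ℝ, ℍ[ℝ]) hypPlaneIncl y w) = hypPlaneMetric y v w := by
  have h : PsiHP1.ballCoord ∘ hypPlaneIncl = jPlane ∘ (Subtype.val : HypPlane → ℂ) :=
    funext ballCoord_hypPlaneIncl
  have h1 := mfderiv_comp y
    (contMDiff_ballCoord.mdifferentiableAt (by simp) (x := hypPlaneIncl y))
    (contMDiff_hypPlaneIncl.mdifferentiableAt (by simp))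
  have h2 := mfderiv_comp y jPlane.hasFDerivAt.hasMFDerivAt.mdifferentiableAt
    (contMDiff_coe_hypPlane.mdifferentiableAt (by simp))
  rw [jPlane.hasFDerivAt.hasMFDerivAt.mfderiv, ← h, h1] at h2
  have h3 : ∀ v : TangentSpace 𝓘(ℝ, ℂ) y,
      (mfderiv 𝓘(ℝ, ℍ[ℝ]) 𝓘(ℝ, ℍ[ℝ]) PsiHP1.ballCoord (hypPlaneIncl y)
        (mfderiv 𝓘(ℝ, ℂ) 𝓘(ℝ, ℍ[ℝ]) hypPlaneIncl y v) : ℍ[ℝ]) =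
      jPlane (mfderiv 𝓘(ℝ, ℂ) 𝓘(ℝ, ℂ) (Subtype.val : HypPlane → ℂ) y v) :=
    fun v => DFunLike.congr_fun h2 v
  have h4 : ∀ (q q' : ℍ[ℝ]) (c c' : ℂ), q = jPlane c → q' = jPlane c' →
      @inner ℝ ℍ[ℝ] _ q q' = @inner ℝ ℂ _ c c' := by
    rintro _ _ c c' rfl rfl
    exact inner_jPlane c c'
  rw [hypMetric, hypPlaneMetric, ballCoord_hypPlaneIncl, norm_jPlane]
  exact congrArg (· / (1 - ‖(y : ℂ)‖ ^ 2) ^ 2) (h4 _ _ _ _ (h3 v) (h3 w))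

/-! ### The circle bundle of real points -/

/-- The vector of `ℝ⁴` with complex coordinates `x₀ + i x₁ = P` and `x₂ + i x₃ = Q`. -/
def realVec (P Q : ℂ) : Fin 4 → ℝ := ![P.re, P.im, Q.re, Q.im]

theorem exists_realVec (z : Fin 4 → ℝ) : ∃ P Q, z = realVec P Q :=
  ⟨⟨z 0, z 1⟩, ⟨z 2, z 3⟩, by funext k; fin_cases k <;> rfl⟩

theorem psiQ_realVec (P Q : ℂ) : psiQ (realVec P Q) = ‖P‖ ^ 2 - ‖Q‖ ^ 2 := by
  rw [← Complex.normSq_eq_norm_sq, ← Complex.normSq_eq_norm_sq, Complex.normSq_apply,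
    Complex.normSq_apply]
  simp [psiQ, realVec]
  ring

theorem smul_realVec (r : ℝ) (P Q : ℂ) : r • realVec P Q = realVec (r * P) (r * Q) := by
  funext k
  fin_cases k <;> simp [realVec]

theorem fst_ne_zero_of_realVec {P Q : ℂ} (h : realVec P Q ∈ PsiP.cone ℝ) : P ≠ 0 := by
  rintro rfl
  have h : 0 < psiQ (realVec 0 Q) := h
  rw [psiQ_realVec, norm_zero] at h
  nlinarith [sq_nonneg ‖Q‖]

/-- On the real points the ball coordinate is the complex quotient `(x₂ + i x₃) / (x₀ + i x₁)`. -/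
theorem realBall_mk {P Q : ℂ} (h : realVec P Q ∈ PsiP.cone ℝ) :
    realBall (PsiP.mk (realVec P Q)) = jPlane (Q / P) := by
  have hP := fst_ne_zero_of_realVec h
  have h1 : ∀ a b : ℝ, quatOf a b = jPlane ⟨a, b⟩ := fun a b => by
    ext
    · rw [quatOf_re]; rfl
    · rw [quatOf_imI]; rfl
    · rw [quatOf_imJ]; rfl
    · rw [quatOf_imK]; exact neg_zero
  have h2 : (toQuat (ofRealL (realVec P Q))) = (jPlane P, jPlane Q) :=
    Prod.ext (h1 P.re P.im) (h1 Q.re Q.im)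
  have hP' : jPlane P ≠ 0 := by
    rw [← norm_ne_zero_iff, norm_jPlane]; exact norm_ne_zero_iff.2 hP
  rw [realBall, psiRealIncl_mk h, ballCoord_twistorMap_mk (PsiP.ofRealL_mem_cone h), coneBall, h2,
    ← div_eq_mul_inv, div_eq_iff hP', ← jPlane_mul, div_mul_cancel₀ Q hP]

/-- The restriction of the twistor map to the real points. -/
def planeProj (x : PsiP ℝ) : HypPlane := ⟨jPart (realBall x), by
  obtain ⟨z, hz, rfl⟩ := PsiP.exists_mk x
  obtain ⟨P, Q, rfl⟩ := exists_realVec z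
  have h := realBall_mk (PsiP.psiSphere_subset_cone hz)
  refine mem_ball_zero_iff.2 ?_
  have h' := norm_realBall_lt (PsiP.mk (realVec P Q))
  rw [h, norm_jPlane] at h'
  rwa [h, jPart_jPlane]⟩

theorem planeProj_mk {P Q : ℂ} (h : realVec P Q ∈ PsiP.cone ℝ) :
    (planeProj (PsiP.mk (realVec P Q)) : ℂ) = Q / P := by
  change jPart (realBall _) = _
  rw [realBall_mk h, jPart_jPlane]

theorem hypPlaneIncl_planeProj (x : PsiP ℝ) :
    hypPlaneIncl (planeProj x) = twistorMap (psiRealIncl x) := by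
  apply ballCoord_injective
  rw [ballCoord_hypPlaneIncl]
  change _ = realBall x
  obtain ⟨z, hz, rfl⟩ := PsiP.exists_mk x
  obtain ⟨P, Q, rfl⟩ := exists_realVec z
  have hz := PsiP.psiSphere_subset_cone hz
  rw [planeProj_mk hz, realBall_mk hz]

theorem contMDiff_planeProj : ContMDiff 𝓘(ℝ, Fin 3 → ℝ) 𝓘(ℝ, ℂ) ∞ planeProj := by
  rw [← ContMDiff.subtypeVal_comp_iff]
  exact jPart.contDiff.contMDiff.comp contMDiff_realBall

/-- The fibre coordinate `[x] ↦ P / P̄`, `P = x₀ + i x₁`, of the circle bundle, as a complex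
number. -/
def fibreFun : PsiP ℝ → ℂ :=
  Quotient.lift (fun z : PsiSphere ℝ =>
    (⟨z.1 0, z.1 1⟩ : ℂ) / conj (⟨z.1 0, z.1 1⟩ : ℂ)) (by
    rintro z w ⟨c, hc, h⟩
    have hc0 : (c : ℂ) ≠ 0 := by
      rw [Complex.ofReal_ne_zero]; rintro rfl; simp at hc
    have e : (⟨w.1 0, w.1 1⟩ : ℂ) = c * ⟨z.1 0, z.1 1⟩ := by
      apply Complex.ext <;> simp [h]
    rw [e, map_mul, Complex.conj_ofReal, mul_div_mul_left _ _ hc0])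

theorem fibreFun_mk {P Q : ℂ} (h : realVec P Q ∈ PsiP.cone ℝ) :
    fibreFun (PsiP.mk (realVec P Q)) = P / conj P := by
  have hs : (((Real.sqrt (psiQ (realVec P Q)))⁻¹ : ℝ) : ℂ) ≠ 0 :=
    Complex.ofReal_ne_zero.2 (inv_ne_zero (Real.sqrt_pos.2 h).ne')
  rw [PsiP.mk_of_pos _ h]
  set s := (Real.sqrt (psiQ (realVec P Q)))⁻¹
  have e : (⟨(s • realVec P Q) 0, (s • realVec P Q) 1⟩ : ℂ) = s * P := by
    apply Complex.ext <;> simp [realVec]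
  change (⟨(s • realVec P Q) 0, (s • realVec P Q) 1⟩ : ℂ) /
    conj (⟨(s • realVec P Q) 0, (s • realVec P Q) 1⟩ : ℂ) = _
  rw [e, map_mul, Complex.conj_ofReal, mul_div_mul_left _ _ hs]

theorem norm_fibreFun (x : PsiP ℝ) : ‖fibreFun x‖ = 1 := by
  obtain ⟨z, hz, rfl⟩ := PsiP.exists_mk x
  obtain ⟨P, Q, rfl⟩ := exists_realVec z
  have hz := PsiP.psiSphere_subset_cone hz
  rw [fibreFun_mk hz, norm_div, RCLike.norm_conj,
    div_self (norm_ne_zero_iff.2 (fst_ne_zero_of_realVec hz))]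

theorem contMDiff_fibreFun : ContMDiff 𝓘(ℝ, Fin 3 → ℝ) 𝓘(ℝ, ℂ) ∞ fibreFun := by
  refine PsiP.contMDiff_of_comp_mk ?_
  let A : (Fin 4 → ℝ) →L[ℝ] ℂ := LinearMap.toContinuousLinearMap
    { toFun := fun z => ⟨z 0, z 1⟩
      map_add' := fun _ _ => rfl
      map_smul' := fun _ _ => by apply Complex.ext <;> simp }
  have h : ContDiffOn ℝ ∞ (fun z => A z * (Complex.conjCLE (A z))⁻¹) (PsiP.cone ℝ) := by
    refine A.contDiff.contDiffOn.mul
      (((Complex.conjCLE.contDiff.comp A.contDiff).contDiffOn).inv fun z hz => ?_)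
    obtain ⟨P, Q, rfl⟩ := exists_realVec z
    exact (map_ne_zero (starRingEnd ℂ)).2 (fst_ne_zero_of_realVec hz)
  refine h.contMDiffOn.congr fun z hz => ?_
  obtain ⟨P, Q, rfl⟩ := exists_realVec z
  exact fibreFun_mk hz

/-- The fibre coordinate `[x] ↦ P / P̄` as a map to the circle. -/
def fibreCoord (x : PsiP ℝ) : Circle := ⟨fibreFun x, mem_sphere_zero_iff_norm.2 (norm_fibreFun x)⟩

theorem contMDiff_fibreCoord : ContMDiff 𝓘(ℝ, Fin 3 → ℝ) (𝓡 1) ∞ fibreCoord :=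
  have := Complex.finrank_real_complex_fact
  contMDiff_fibreFun.codRestrict_sphere fun x => mem_sphere_zero_iff_norm.2 (norm_fibreFun x)

/-- The global trivialization `[x] ↦ (Q / P, P / P̄)`, `P = x₀ + i x₁`, `Q = x₂ + i x₃`. -/
def bundleMap (x : PsiP ℝ) : HypPlane × Circle := (planeProj x, fibreCoord x)

theorem contMDiff_bundleMap :
    ContMDiff 𝓘(ℝ, Fin 3 → ℝ) (𝓘(ℝ, ℂ).prod (𝓡 1)) ∞ bundleMap :=
  contMDiff_planeProj.prodMk contMDiff_fibreCoord

/-- If `P / P̄ = P' / P̄'`, then `P'` is a real multiple of `P`, and `Q / P = Q' / P'` gives the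
same multiple for `Q`. -/
theorem bundleMap_injective : Function.Injective bundleMap := by
  intro x y hxy
  obtain ⟨z, hz, rfl⟩ := PsiP.exists_mk x
  obtain ⟨P, Q, rfl⟩ := exists_realVec z
  obtain ⟨z', hz', rfl⟩ := PsiP.exists_mk y
  obtain ⟨P', Q', rfl⟩ := exists_realVec z'
  have hz := PsiP.psiSphere_subset_cone hz
  have hz' := PsiP.psiSphere_subset_cone hz'
  have hP := fst_ne_zero_of_realVec hz
  have hP' := fst_ne_zero_of_realVec hz'
  have h1 : Q / P = Q' / P' := by
    rw [← planeProj_mk hz, ← planeProj_mk hz']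
    exact congrArg (fun q => (q.1 : ℂ)) hxy
  have h2 : P / conj P = P' / conj P' := by
    rw [← fibreFun_mk hz, ← fibreFun_mk hz']
    exact congrArg (fun q => (q.2 : ℂ)) hxy
  have hcP : conj P ≠ 0 := (map_ne_zero _).2 hP
  have hcP' : conj P' ≠ 0 := (map_ne_zero _).2 hP'
  -- the quotient `P' / P` is real
  obtain ⟨r, hr⟩ : ∃ r : ℝ, P' / P = r := by
    refine Complex.conj_eq_iff_real.1 ?_
    rw [map_div₀, div_eq_div_iff hcP hP]
    rw [div_eq_div_iff hcP hcP'] at h2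
    linear_combination h2
  have hr1 : P' = r * P := by rw [← hr, div_mul_cancel₀ _ hP]
  have hr0 : r ≠ 0 := by
    rintro rfl
    exact hP' (by rw [hr1]; simp)
  have hr2 : Q' = r * Q := by
    rw [div_eq_div_iff hP hP'] at h1
    apply mul_right_cancel₀ hP
    rw [← h1, hr1]; ring
  rw [hr1, hr2, ← smul_realVec, PsiP.mk_eq_mk_smul hz hr0]

theorem realVec_mul_mem_cone {P : ℂ} (hP : P ≠ 0) (w : HypPlane) :
    realVec P (w * P) ∈ PsiP.cone ℝ := by
  change 0 < psiQ _
  rw [psiQ_realVec, norm_mul]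
  have h1 := norm_pos_iff.2 hP
  have h2 := norm_coe_hypPlane_lt w
  have : ‖P‖ ^ 2 - (‖(w : ℂ)‖ * ‖P‖) ^ 2 = ‖P‖ ^ 2 * (1 - ‖(w : ℂ)‖ ^ 2) := by ring
  rw [this]
  have : 0 < 1 - ‖(w : ℂ)‖ ^ 2 := by nlinarith [norm_nonneg (w : ℂ)]
  positivity

theorem bundleMap_mk {P : ℂ} (hP : P ≠ 0) (w : HypPlane) {θ : Circle} (hθ : P / conj P = θ) :
    bundleMap (PsiP.mk (realVec P (w * P))) = (w, θ) := by
  have h := realVec_mul_mem_cone hP w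
  refine Prod.ext (Subtype.ext ?_) (Circle.ext ?_)
  · change (planeProj _ : ℂ) = w
    rw [planeProj_mk h, mul_div_cancel_right₀ _ hP]
  · change fibreFun _ = θ
    rw [fibreFun_mk h, hθ]

/-- Every point of the circle is `P / P̄` with `P = a + b θ`, where `(a, b)` is `(1, 1)` or
`(i, -i)`; the same `(a, b)` serves nearby points. -/
theorem exists_linear_root (θ : Circle) : ∃ a b : ℂ, a + b * θ ≠ 0 ∧
    ∀ η : Circle, a + b * η ≠ 0 → (a + b * η) / conj (a + b * η) = η := by
  have hη : ∀ η : Circle, (η : ℂ) * conj (η : ℂ) = 1 := fun η => by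
    rw [Complex.mul_conj, Circle.normSq_coe, Complex.ofReal_one]
  by_cases h : (1 : ℂ) + 1 * θ = 0
  · refine ⟨Complex.I, -Complex.I, fun h' => ?_, fun η h' => ?_⟩
    · have h1 : (θ : ℂ) = -1 := by linear_combination h
      rw [h1] at h'
      have h2 : (2 : ℂ) * Complex.I = 0 := by linear_combination h'
      exact mul_ne_zero two_ne_zero Complex.I_ne_zero h2
    · rw [div_eq_iff ((map_ne_zero _).2 h'), map_add, map_mul, map_neg, Complex.conj_I]
      linear_combination -Complex.I * hη η
  · refine ⟨1, 1, h, fun η h' => ?_⟩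
    rw [div_eq_iff ((map_ne_zero _).2 h'), map_add, map_mul, map_one]
    linear_combination -hη η

theorem contMDiffAt_realVec_section (a b : ℂ) (q : HypPlane × Circle) (h : a + b * q.2 ≠ 0) :
    ContMDiffAt (𝓘(ℝ, ℂ).prod (𝓡 1)) 𝓘(ℝ, Fin 3 → ℝ) ∞
      (fun q : HypPlane × Circle => PsiP.mk (realVec (a + b * q.2) (q.1 * (a + b * q.2)))) q := by
  have h1 : ContMDiff (𝓘(ℝ, ℂ).prod (𝓡 1)) 𝓘(ℝ, ℂ) ∞ fun q : HypPlane × Circle => (q.1 : ℂ) :=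
    contMDiff_coe_hypPlane.comp contMDiff_fst
  have hc : ContMDiff (𝓡 1) 𝓘(ℝ, ℂ) ∞ fun θ : Circle => (θ : ℂ) :=
    have := Complex.finrank_real_complex_fact
    contMDiff_coe_sphere
  have h2 : ContMDiff (𝓘(ℝ, ℂ).prod (𝓡 1)) 𝓘(ℝ, ℂ) ∞ fun q : HypPlane × Circle => (q.2 : ℂ) :=
    hc.comp contMDiff_snd
  have h3 : ContDiff ℝ ∞ fun p : ℂ × ℂ => realVec (a + b * p.2) (p.1 * (a + b * p.2)) := by
    refine contDiff_pi.2 fun k => ?_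
    have hP : ContDiff ℝ ∞ fun p : ℂ × ℂ => a + b * p.2 := by fun_prop
    have hQ : ContDiff ℝ ∞ fun p : ℂ × ℂ => p.1 * (a + b * p.2) := by fun_prop
    fin_cases k
    · exact Complex.reCLM.contDiff.comp hP
    · exact Complex.imCLM.contDiff.comp hP
    · exact Complex.reCLM.contDiff.comp hQ
    · exact Complex.imCLM.contDiff.comp hQ
  have h4 : ContMDiff (𝓘(ℝ, ℂ).prod (𝓡 1)) 𝓘(ℝ, Fin 4 → ℝ) ∞
      fun q : HypPlane × Circle => realVec (a + b * q.2) (q.1 * (a + b * q.2)) :=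
    h3.contMDiff.comp (h1.prodMk_space h2)
  exact (PsiP.contMDiffOn_mk.contMDiffAt
    (PsiP.isOpen_cone.mem_nhds (realVec_mul_mem_cone h q.1))).comp q h4.contMDiffAt

theorem bundleMap_surjective : Function.Surjective bundleMap := by
  rintro ⟨w, θ⟩
  obtain ⟨a, b, h, h'⟩ := exists_linear_root θ
  exact ⟨_, bundleMap_mk h w (h' θ h)⟩

/-- The global trivialization as a bijection. -/
def bundleEquiv : PsiP ℝ ≃ HypPlane × Circle :=
  Equiv.ofBijective bundleMap ⟨bundleMap_injective, bundleMap_surjective⟩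

theorem contMDiff_bundleEquiv_symm :
    ContMDiff (𝓘(ℝ, ℂ).prod (𝓡 1)) 𝓘(ℝ, Fin 3 → ℝ) ∞ bundleEquiv.symm := by
  intro q
  obtain ⟨a, b, h, h'⟩ := exists_linear_root q.2
  refine (contMDiffAt_realVec_section a b q h).congr_of_eventuallyEq ?_
  have hcont : Continuous fun q : HypPlane × Circle => a + b * (q.2 : ℂ) := by fun_prop
  filter_upwards [hcont.continuousAt.eventually_ne h] with r hr
  rw [Equiv.symm_apply_eq]
  exact (bundleMap_mk hr r.1 (h' r.2 hr)).symm

theorem isSmoothCircleBundle_planeProj :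
    IsSmoothCircleBundle (E := ℂ) (E' := Fin 3 → ℝ) planeProj := by
  intro y
  let Φ : PsiP ℝ ≃ₜ HypPlane × Circle :=
    { bundleEquiv with
      continuous_toFun := contMDiff_bundleMap.continuous
      continuous_invFun := contMDiff_bundleEquiv_symm.continuous }
  exact ⟨Set.univ, Φ.toOpenPartialHomeomorph, isOpen_univ, Set.mem_univ y, rfl,
    Set.univ_prod_univ.symm, fun _ _ => rfl, contMDiff_bundleMap.contMDiffOn,
    contMDiff_bundleEquiv_symm.contMDiffOn⟩

end

theorem mainTheorem7 :
    -- the metric and the forms of `Ψ CP³` pull back to those given by `ω₁, ω₂, ω₃` on `𝔉`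
    (∀ x : PsiP ℂ, ∃ f : PsiFrame, f.proj = x) ∧
    (∀ f : PsiFrame, Function.Surjective f.dproj ∧
      (∀ v w, psiMetric f.proj (f.dproj v) (f.dproj w) = stdMetric (f.omega v) (f.omega w)) ∧
      (psiKahler f.proj).compContinuousLinearMap f.dproj =
        stdKahler.compContinuousLinearMap f.omega ∧
      (psiVolume f.proj).compContinuousLinearMap f.dproj =
        stdVolume.compContinuousLinearMap f.omega) ∧
    -- `Ψ CP³` is the twistor space of `H⁴`
    ContMDiff 𝓘(ℝ, Fin 3 → ℂ) 𝓘(ℝ, ℍ[ℝ]) ∞ twistorMap ∧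
    (∀ (f : PsiFrame) (v : ℍ[ℝ] × ℍ[ℝ]),
      hypMetric (twistorMap f.proj)
        (mfderiv 𝓘(ℝ, Fin 3 → ℂ) 𝓘(ℝ, ℍ[ℝ]) twistorMap f.proj (f.dproj v))
        (mfderiv 𝓘(ℝ, Fin 3 → ℂ) 𝓘(ℝ, ℍ[ℝ]) twistorMap f.proj (f.dproj v)) =
      ‖f.omega v 0‖ ^ 2 + ‖f.omega v 1‖ ^ 2) ∧
    (∀ f : PsiFrame, ∃ J, IsOrthComplexStructure J ∧ f.IsTwistorStructure J) ∧
    (∀ (y : PsiHP1) (J : ℍ[ℝ] →L[ℝ] ℍ[ℝ]), IsOrthComplexStructure J →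
      ∃! x : PsiP ℂ, twistorMap x = y ∧ ∃ f : PsiFrame, f.proj = x ∧ f.IsTwistorStructure J) ∧
    -- the nearly Calabi-Yau structure and its anti-complex involution
    IsNearlyCalabiYau psiMetric psiKahler psiVolume ∧
    IsRealStructure psiKahler psiVolume psiInvolution ∧
    -- `Ψ RP³` is the fixed set, and it is special Lagrangian and complete
    {x | psiInvolution x = x} = Set.range psiRealIncl ∧
    IsSpecialLagrangian (E' := Fin 3 → ℝ) psiMetric psiKahler psiVolume psiRealIncl ∧
    IsCompleteInduced (E' := Fin 3 → ℝ) psiMetric psiRealIncl ∧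
    -- the twistor map restricts to a circle bundle of `Ψ RP³` over `H² ⊂ H⁴`
    Manifold.IsSmoothEmbedding 𝓘(ℝ, ℂ) 𝓘(ℝ, ℍ[ℝ]) ∞ hypPlaneIncl ∧
    (∀ (y : HypPlane) (v w : TangentSpace 𝓘(ℝ, ℂ) y),
      hypMetric (hypPlaneIncl y) (mfderiv 𝓘(ℝ, ℂ) 𝓘(ℝ, ℍ[ℝ]) hypPlaneIncl y v)
        (mfderiv 𝓘(ℝ, ℂ) 𝓘(ℝ, ℍ[ℝ]) hypPlaneIncl y w) = hypPlaneMetric y v w) ∧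
    (∃ p : PsiP ℝ → HypPlane, (∀ x, hypPlaneIncl (p x) = twistorMap (psiRealIncl x)) ∧
      IsSmoothCircleBundle (E := ℂ) (E' := Fin 3 → ℝ) p) := by
  exact ⟨PsiFrame.exists_proj_eq,
    fun f => ⟨f.dproj_surjective, f.psiMetric_dproj, f.psiKahler_dproj, f.psiVolume_dproj⟩,
    contMDiff_twistorMap, PsiFrame.hypMetric_mfderiv, PsiFrame.exists_isTwistorStructure,
    existsUnique_twistor, isNearlyCalabiYau_psi, isRealStructure_psiInvolution,
    fixedPoints_psiInvolution, isSpecialLagrangian_psiRealIncl, isCompleteInduced_psiRealIncl,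
    isSmoothEmbedding_hypPlaneIncl, hypMetric_hypPlaneIncl, planeProj, hypPlaneIncl_planeProj,
    isSmoothCircleBundle_planeProj⟩
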